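/- **Setting.** For sets $T_1,T_2,\dots$ write $T_S=\bigcup_{j\in S}T_j$ and $T^{k}=T_1\cup\dots\cup T_k$; for vectors $u_S=(u_j)_{j\in S}$. Let $\mathcal X_1,\dots,\mathcal X_N,\mathcal Y_1,\dots,\mathcal Y_N$ be finite alphabets. An $N$-node acyclic discrete memoryless network is a collection of conditional pmfs $p(y_k|y^{k-1},x^{k-1})$, $k\in[1:N]$. In $n$ channel uses, for $k=1,\dots,N$ in turn, $Y_k^n$ is generated according to $\prod_{i=1}^n p(y_{k,i}|y_i^{k-1},x_i^{k-1})$ and node $k$ maps $Y_k^n$ to $X_k^n$. A target pmf $p^*(x_{[1:N]},y_{[1:N]})$ is *achievable* if there is a sequence (in $n$) of node processing functions $Y_k^n\mapsto X_k^n$, $k\in[1:N]$, such that for every $\epsilon>0$ $$\lim_{n\to\infty}P\big((X_{[1:N]}^n,Y_{[1:N]}^n)\notin\mathcal T^{(n)}_\epsilon\big)=0,$$ where $\mathcal T_\epsilon^{(n)}$ is the set of sequences $z^n$ with $|\pi_{z^n}(z)/n-p^*(z)|\le\epsilon\,p^*(z)$ for all $z=(x_{[1:N]},y_{[1:N]})$,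 and $\pi_{z^n}(z)$ is the number of occurrences of $z$ in $z^n$. **Coding parameters.** Let $\Omega(p^*)$ be the set of all $\omega$ consisting of: positive integers $\mu,\nu$; finite alphabets $\mathcal U_j$, $j\in[1:\nu]$; rates $r_1,\dots,r_\mu\ge0$; sets $\Gamma_j\subseteq[1:\mu]$ and $A_j\subseteq[1:\nu]$ for $j\in[1:\nu]$, and $D_k\subseteq W^{k-1}$, $B_k\subseteq W^{k-1}\setminus D_k$, $W_k\subseteq[1:\nu]\setminus W^{k-1}$ for $k\in[1:N]$, such that * the sets $\Gamma_{W_k}\setminus\Gamma_{D_k}$, $k\in[1:N]$, are pairwise disjoint; * $\Gamma_{A_j}\subseteq\Gamma_j$, and $j'<j$ whenever $j'\in A_j$; * $A_{W_k}\subseteq W_k\cup D_k$, $A_{B_k}\subseteq D_k\cup B_k$, $A_{D_k}\subseteq D_k$; and conditional pmfs $p(u_{W_k}|u_{D_k},y_k)$ and functions $x_k(u_{D_k},u_{W_k},y_k)$, $k\in[1:N]$, such that the joint pmf $$\prod_{k=1}^N p(y_k|y^{k-1},x^{k-1})\,p(u_{W_k}|u_{D_k},y_k)\,\mathbb 1_{x_k=x_k(u_{D_k},u_{W_k},y_k)}$$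 has $p^*$ as its marginal on $(x_{[1:N]},y_{[1:N]})$. Put $\bar D_k=\Gamma_{D_k}$, $\bar B_k=\Gamma_{B_k}\setminus\Gamma_{D_k}$, $\bar W_k=\Gamma_{W_k}\setminus\Gamma_{D_k}$. For $\bar S_k\subseteq\bar D_k\cup\bar B_k$ and $\bar T_k\subseteq\bar W_k$ put $$S_k=\{j\in D_k\cup B_k:\Gamma_j\cap\bar S_k\ne\emptyset\},\qquad T_k=\{j\in W_k:\Gamma_j\subseteq\bar T_k\cup\bar D_k\},$$ $S_k^c=(D_k\cup B_k)\setminus S_k$, and $S[j]=\{i\in S:i<j\}$. Mutual informations are in bits and computed under the joint pmf above. **Theorem 1 (unified coding theorem).** For an $N$-node acyclic discrete memoryless network, $p^*$ is achievable if there is $\omega\in\Omega(p^*)$ such that for every $k\in[1:N]$: $$\sum_{j\in\bar S_k}r_j<\sum_{j\in S_k}I(U_j;U_{S_k[j]\cup S_k^c},Y_k|U_{A_j})\quad\text{for all }\bar S_k\subseteq\bar D_k\cup\bar B_k\text{ with }\bar S_k\cap\bar D_k\ne\emptyset,$$ $$\sum_{j\in\bar T_k}r_j>\sum_{j\in T_k}I(U_j;U_{T_k[j]\cup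 D_k},Y_k|U_{A_j})\quad\text{for all nonempty }\bar T_k\subseteq\bar W_k,$$ and, with $T_k^\circ=\{j\in W_k:\Gamma_j\subseteq\bar D_k\}$, $$\sum_{j\in T_k^\circ}I(U_j;U_{T_k^\circ[j]\cup D_k},Y_k|U_{A_j})=0 .$$ The last condition holds automatically when every $\Gamma_j$ with $j\in W_k$ contains an index outside $\Gamma_{D_k}$. -/

import Mathlib

open Filter Topology

universe u v w

noncomputable section

namespace UnifiedCoding

/-! ### Finite information measures -/

/-- The marginal pmf, at the value `a`, of the random variable `V` under the pmf `P` on the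
finite sample space `S`. -/
def marginal {S : Type*} [Fintype S] {α : Type*} (P : S → ℝ) (V : S → α) (a : α) : ℝ :=
  open Classical in ∑ s with V s = a, P s

/-- Conditional mutual information `I(V₁; V₂ | V₃)` in bits, as the expectation of
`log₂ (p(v₁,v₂,v₃) p(v₃) / (p(v₁,v₃) p(v₂,v₃)))`. Sample points of probability zero
contribute zero; at the others all four marginals are positive. -/
def condMutualInfo {S : Type*} [Fintype S] {α β γ : Type*}
    (P : S → ℝ) (V₁ : S → α) (V₂ : S → β) (V₃ : S → γ) : ℝ :=
  ∑ s, P s * Real.logb 2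
    (marginal P (fun t => (V₁ t, V₂ t, V₃ t)) (V₁ s, V₂ s, V₃ s) * marginal P V₃ (V₃ s) /
      (marginal P (fun t => (V₁ t, V₃ t)) (V₁ s, V₃ s) *
        marginal P (fun t => (V₂ t, V₃ t)) (V₂ s, V₃ s)))

/-- `z` is an `ε`-typical sequence for the pmf `p`:
`|π(a | z) / n - p(a)| ≤ ε p(a)` for every letter `a`. -/
def IsTypical {α : Type*} (p : α → ℝ) (ε : ℝ) {n : ℕ} (z : Fin n → α) : Prop :=
  ∀ a : α, |(Nat.card {i : Fin n // z i = a} : ℝ) / n - p a| ≤ ε * p a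

/-! ### Acyclic discrete memoryless networks -/

/-- An `N`-node acyclic discrete memoryless network with channel input alphabets `X k` and
channel output alphabets `Y k`: the conditional pmfs `p(y_k | y^{k-1}, x^{k-1})`. -/
structure ADMN (N : ℕ) (X : Fin N → Type u) (Y : Fin N → Type v) [∀ k, Fintype (Y k)] where
  channel : ∀ k : Fin N,
    (∀ i : Set.Iio k, Y i) → (∀ i : Set.Iio k, X i) → stdSimplex ℝ (Y k)

namespace ADMN

variable {N : ℕ} {X : Fin N → Type u} {Y : Fin N → Type v} [∀ k, Fintype (Y k)]

/-- The single-letter probability `p(y_k | y^{k-1}, x^{k-1})` read off from full tuples. -/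
def prob (net : ADMN N X Y) (k : Fin N) (y : ∀ i, Y i) (x : ∀ i, X i) : ℝ :=
  net.channel k (fun i => y i) (fun i => x i) (y k)

/-- The probability that the channel output sequences are `y` in `n` channel uses, when node `k`
maps its received sequence `y_k^n` to `x_k^n = f k (y_k^n)`. -/
def outputLaw (net : ADMN N X Y) {n : ℕ} (f : ∀ k, (Fin n → Y k) → (Fin n → X k))
    (y : ∀ k, Fin n → Y k) : ℝ :=
  ∏ i : Fin n, ∏ k : Fin N, net.prob k (fun j => y j i) (fun j => f j (y j) i)

/-- The `ε`-probability of error: the probability that `(X_{[1:N]}^n, Y_{[1:N]}^n)` is not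
`ε`-typical for the target distribution. -/
def errorProb (net : ADMN N X Y) (pstar : (∀ k, X k) × (∀ k, Y k) → ℝ) (ε : ℝ) {n : ℕ}
    (f : ∀ k, (Fin n → Y k) → (Fin n → X k)) : ℝ :=
  open Classical in
  ∑ y : (∀ k, Fin n → Y k) with
      ¬ IsTypical pstar ε (fun i : Fin n => ((fun k => f k (y k) i), (fun k => y k i))),
    net.outputLaw f y

/-- Achievability: one sequence of node processing functions makes the `ε`-probability of error
vanish for every `ε > 0`. -/
def Achievable (net : ADMN N X Y) (pstar : (∀ k, X k) × (∀ k, Y k) → ℝ) : Prop :=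
  ∃ f : ∀ n : ℕ, ∀ k, (Fin n → Y k) → (Fin n → X k),
    ∀ ε : ℝ, 0 < ε → Tendsto (fun n => net.errorProb pstar ε (f n)) atTop (𝓝 0)

end ADMN

/-! ### Coding parameters -/

/-- The coding parameters: `ν` covering codebooks with alphabets `U j`, indexed by `μ` index sets
of rates `r i`, together with the superposition, decoding and compression sets. Write
`Γ_S = ⋃_{j ∈ S} Γ_j`. -/
structure CodingParams (N : ℕ) (X : Fin N → Type u) (Y : Fin N → Type v) where
  μ : ℕ
  ν : ℕ
  μ_pos : 0 < μ
  ν_pos : 0 < ν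
  /-- Alphabet of the codeword symbols of codebook `j`. -/
  U : Fin ν → Type w
  [fintypeU : ∀ j, Fintype (U j)]
  /-- Rates of the index sets. -/
  r : Fin μ → ℝ
  r_nonneg : ∀ i, 0 ≤ r i
  /-- Index sets attached to codebook `j`. -/
  Γ : Fin ν → Finset (Fin μ)
  /-- Codebooks on which codebook `j` is superposed. -/
  A : Fin ν → Finset (Fin ν)
  /-- Codebooks decoded uniquely at node `k`. -/
  D : Fin N → Finset (Fin ν)
  /-- Codebooks decoded nonuniquely at node `k`. -/
  B : Fin N → Finset (Fin ν)
  /-- Codebooks used for compression at node `k`. -/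
  W : Fin N → Finset (Fin ν)
  D_subset : ∀ k, D k ⊆ (Finset.Iio k).biUnion W
  B_subset : ∀ k, B k ⊆ (Finset.Iio k).biUnion W \ D k
  W_disjoint : ∀ k, Disjoint (W k) ((Finset.Iio k).biUnion W)
  fresh_disjoint : ∀ k k', k ≠ k' →
    Disjoint ((W k).biUnion Γ \ (D k).biUnion Γ) ((W k').biUnion Γ \ (D k').biUnion Γ)
  Γ_superposition : ∀ j, (A j).biUnion Γ ⊆ Γ j
  A_lt : ∀ j, ∀ j' ∈ A j, j' < j
  A_W : ∀ k, (W k).biUnion A ⊆ W k ∪ D k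
  A_B : ∀ k, (B k).biUnion A ⊆ D k ∪ B k
  A_D : ∀ k, (D k).biUnion A ⊆ D k
  /-- The conditional pmf `p(u_{W_k} | u_{D_k}, y_k)`. -/
  cover : ∀ k, (∀ j : D k, U j) → Y k → stdSimplex ℝ (∀ j : W k, U j)
  /-- The symbol-by-symbol map `x_k(u_{D_k}, u_{W_k}, y_k)`. -/
  symbolMap : ∀ k, (∀ j : D k, U j) → (∀ j : W k, U j) → Y k → X k

attribute [instance] CodingParams.fintypeU

namespace CodingParams

variable {N : ℕ} {X : Fin N → Type u} {Y : Fin N → Type v}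

/-- `Γ_{D_k}`. -/
def barD (ω : CodingParams.{u, v, w} N X Y) (k : Fin N) : Finset (Fin ω.μ) :=
  (ω.D k).biUnion ω.Γ

/-- `Γ_{B_k} \ Γ_{D_k}`. -/
def barB (ω : CodingParams.{u, v, w} N X Y) (k : Fin N) : Finset (Fin ω.μ) :=
  (ω.B k).biUnion ω.Γ \ (ω.D k).biUnion ω.Γ

/-- `Γ_{W_k} \ Γ_{D_k}`. -/
def barW (ω : CodingParams.{u, v, w} N X Y) (k : Fin N) : Finset (Fin ω.μ) :=
  (ω.W k).biUnion ω.Γ \ (ω.D k).biUnion ω.Γ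

/-- For a set `S` of indices, the codebooks in `D_k ∪ B_k` with an index in `S`. -/
def packSet (ω : CodingParams.{u, v, w} N X Y) (k : Fin N) (S : Finset (Fin ω.μ)) :
    Finset (Fin ω.ν) :=
  (ω.D k ∪ ω.B k).filter fun j => (ω.Γ j ∩ S).Nonempty

/-- For a set `T` of indices, the codebooks in `W_k` all of whose indices lie in
`T ∪ Γ_{D_k}`. -/
def coverSet (ω : CodingParams.{u, v, w} N X Y) (k : Fin N) (T : Finset (Fin ω.μ)) :
    Finset (Fin ω.ν) :=
  (ω.W k).filter fun j => ω.Γ j ⊆ T ∪ ω.barD k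

/-- The sample space of `(U_{[1:ν]}, X_{[1:N]}, Y_{[1:N]})`. -/
abbrev Sample (ω : CodingParams.{u, v, w} N X Y) : Type (max u v w) :=
  (∀ j, ω.U j) × (∀ k, X k) × (∀ k, Y k)

variable [∀ k, Fintype (X k)] [∀ k, Fintype (Y k)]

open Classical in
/-- The joint pmf
`∏_k p(y_k | y^{k-1}, x^{k-1}) p(u_{W_k} | u_{D_k}, y_k) 1[x_k = x_k(u_{D_k}, u_{W_k}, y_k)]`
of `(U, X, Y)`. This product only involves `U_j` for `j` in some `W_k`; the last factor gives the
symbols of codebooks outside all `W_k`, which no node uses and no information quantity below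
involves, an independent uniform distribution. -/
def joint (ω : CodingParams.{u, v, w} N X Y) (net : ADMN N X Y) (s : ω.Sample) : ℝ :=
  (∏ k, net.prob k s.2.2 s.2.1
      * ω.cover k (fun j => s.1 j) (s.2.2 k) (fun j => s.1 j)
      * (if s.2.1 k = ω.symbolMap k (fun j => s.1 j) (fun j => s.1 j) (s.2.2 k) then 1 else 0))
    * ∏ j ∈ Finset.univ \ Finset.univ.biUnion ω.W, ((Fintype.card (ω.U j) : ℝ))⁻¹

/-- The distribution of `(X_{[1:N]}, Y_{[1:N]})` induced by the coding parameters is `pstar`. -/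
def Induces (ω : CodingParams.{u, v, w} N X Y) (net : ADMN N X Y)
    (pstar : (∀ k, X k) × (∀ k, Y k) → ℝ) : Prop :=
  ∀ x y, ∑ u : (∀ j, ω.U j), ω.joint net (u, x, y) = pstar (x, y)

/-- `I(U_j; U_S, Y_k | U_{A_j})`, in bits, under the joint pmf of the coding parameters. -/
def info (ω : CodingParams.{u, v, w} N X Y) (net : ADMN N X Y) (k : Fin N)
    (j : Fin ω.ν) (S : Finset (Fin ω.ν)) : ℝ :=
  condMutualInfo (ω.joint net)
    (fun s => s.1 j)
    (fun s => ((fun i : S => s.1 i), s.2.2 k))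
    (fun s => (fun i : ω.A j => s.1 i))

/-- `∑_{j ∈ S_k} I(U_j; U_{S_k[j] ∪ S_k^c}, Y_k | U_{A_j})` for the set `S_k` of codebooks that
belongs to `S`; here `S_k[j] = {i ∈ S_k : i < j}` and `S_k^c = (D_k ∪ B_k) \ S_k`. -/
def packInfo (ω : CodingParams.{u, v, w} N X Y) (net : ADMN N X Y) (k : Fin N)
    (S : Finset (Fin ω.μ)) : ℝ :=
  ∑ j ∈ ω.packSet k S,
    ω.info net k j
      ((ω.packSet k S).filter (· < j) ∪ ((ω.D k ∪ ω.B k) \ ω.packSet k S))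

/-- `∑_{j ∈ T_k} I(U_j; U_{T_k[j] ∪ D_k}, Y_k | U_{A_j})` for the set `T_k` of codebooks that
belongs to `T`; here `T_k[j] = {i ∈ T_k : i < j}`. -/
def coverInfo (ω : CodingParams.{u, v, w} N X Y) (net : ADMN N X Y) (k : Fin N)
    (T : Finset (Fin ω.μ)) : ℝ :=
  ∑ j ∈ ω.coverSet k T,
    ω.info net k j ((ω.coverSet k T).filter (· < j) ∪ ω.D k)

end CodingParams

end UnifiedCoding

end

/-! The proof is random coding with likelihood encoders, reduced to first-moment estimates by a
change of measure.

Codebook `j` holds one random word for each value of the indices in `Γ j`, drawn from p(u_j |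
u_{A_j}). Node k decodes the indices in Γ_{D_k}, then draws its fresh indices with probability
proportional to p(u_{W_k} | u_{D_k}, y_k) / ∏_{j ∈ W_k} p(u_j | u_{A_j}), evaluated at the words
they select. Fix an index tuple L. If all nodes decode correctly, the probability of the codebook
times that of the choice L is, up to a uniform factor, the intended law of (U, Y) at the selected
words, times the conditional probability of the rest of the codebook, divided by the encoder
normalizations Z_k. Since ∏ 1/Z_k ≥ 1 - ∑ (Z_k - 1), only an upper bound on the mean of each Z_k is
needed (`le_codebookProb_mul_prod_enc`).

Covering: sort the competing choices by the set T of fresh indices on which they agree with L. The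
words of W_k outside `coverSet k T` are then independent redraws, and averaging over them leaves the
likelihood ratio of the words in `coverSet k T`. This ratio is beaten by the sizes of the index sets
in T when T is nonempty. For T = ∅ there is no rate to beat it, so the ratio must be exactly 1; this
is what the vanishing condition provides, through the equality case of the nonnegativity of relative
entropy (`ratio_eq_one`).

Packing: the decoder compares likelihood ratios with thresholds. A competitor that is wrong exactly
on S passes with probability at most the inverse threshold, and a union bound over such competitors
costs the product of the index set sizes in S. Errors confined to indices outside Γ_{D_k} are
harmless, so only sets S meeting Γ_{D_k} enter.

Together these give a bound over arbitrary finite alphabets (`exists_maps`), applied to blocks of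
length n. By the chain rule `sum_info_eq` the information sums of the theorem are means of
log-likelihood ratios, so the law of large numbers puts every ratio on the right side of a threshold
halfway between information and rate. `cyl_union_W` identifies the compression kernel with a
conditional law of the joint pmf, and `exists_diagonal` merges the codes for the different
tolerances into one sequence. -/

noncomputable section

namespace UnifiedCoding

/-! ### Elimination in finite Bayesian networks and derandomization of local kernels. -/

section FiniteSums

open Classical in
/-- Tower property: two weights with equal fibre sums integrate functions of `r` equally. -/
theorem sum_mul_congr_fiber {Ω R : Type*} [Fintype Ω] (r : Ω → R) {h g κ : Ω → ℝ}
    (hh : ∀ c c', r c = r c' → h c = h c')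
    (hg : ∀ c, ∑ c' with r c' = r c, g c' = ∑ c' with r c' = r c, κ c') :
    ∑ c, h c * g c = ∑ c, h c * κ c := by
  have key : ∀ f : Ω → ℝ, ∑ c, h c * f c
      = ∑ b ∈ Finset.univ.image r, ∑ c with r c = b, h c * f c := fun f =>
    (Finset.sum_fiberwise_of_maps_to (fun c _ => Finset.mem_image_of_mem r (Finset.mem_univ c))
      _).symm
  rw [key, key]
  refine Finset.sum_congr rfl fun b hb => ?_
  obtain ⟨c, -, rfl⟩ := Finset.mem_image.1 hb
  have : ∀ f : Ω → ℝ, ∑ c' with r c' = r c, h c' * f c' = h c * ∑ c' with r c' = r c, f c' := by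
    intro f
    rw [Finset.mul_sum]
    refine Finset.sum_congr rfl fun c' hc' => ?_
    rw [hh c' c (Finset.mem_filter.1 hc').2]
  rw [this, this, hg]

open Classical in
/-- Elimination in a Bayesian network. The map `o v` overwrites the `v`-th coordinate block by a
base point; the kernels `g v` outside the ancestor-closed set `K` are replaced by point masses. -/
theorem sum_prod_elim {Ω V : Type*} [Fintype Ω] [Fintype V] (o : V → Ω → Ω) (rank : V → ℕ)
    (g : V → Ω → ℝ) (idem : ∀ v c, o v (o v c) = o v c)
    (hfix : ∀ a b, a ≠ b → ∀ c, o a (o b c) = o b c ↔ o a c = c)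
    (hsum : ∀ v c, ∑ c' with o v c' = o v c, g v c' = 1)
    (hdep : ∀ a b, a ≠ b → rank b ≤ rank a → ∀ c, g b (o a c) = g b c)
    (K : Finset V) (hK : ∀ b ∈ K, ∀ a ∉ K, ∀ c, g b (o a c) = g b c)
    (h : Ω → ℝ) (hh : ∀ a ∉ K, ∀ c, h (o a c) = h c) :
    ∑ c, h c * ∏ v, g v c
      = ∑ c, h c * ((∏ v ∈ K, g v c) * ∏ v ∈ Kᶜ, if o v c = c then 1 else 0) := by
  induction hn : Kᶜ.card generalizing K with
  | zero =>
    have : K = Finset.univ := by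
      rw [Finset.card_eq_zero] at hn
      exact (Finset.compl_eq_empty_iff K).1 hn
    simp [this]
  | succ n ih =>
    -- A vertex of least rank outside `K` has a kernel that ignores every other vertex outside `K`,
    -- so `insert v K` is again ancestor-closed.
    obtain ⟨v, hv, hmin⟩ := Finset.exists_min_image Kᶜ rank
      (Finset.card_pos.1 (by omega))
    have hvK : v ∉ K := Finset.mem_compl.1 hv
    have hcompl : Kᶜ = insert v (insert v K)ᶜ := by
      ext a; by_cases a = v <;> simp_all
    have hv' : v ∉ (insert v K)ᶜ := by simp
    rw [ih (insert v K) ?_ ?_ ?_]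
    · have e1 : ∀ c, h c * ((∏ v ∈ insert v K, g v c) *
          ∏ v ∈ (insert v K)ᶜ, if o v c = c then 1 else 0)
          = (h c * ((∏ v ∈ K, g v c) * ∏ v ∈ (insert v K)ᶜ, if o v c = c then 1 else 0))
            * g v c := by
        intro c; rw [Finset.prod_insert hvK]; ring
      have e2 : ∀ c, h c * ((∏ v ∈ K, g v c) * ∏ v ∈ Kᶜ, if o v c = c then 1 else 0)
          = (h c * ((∏ v ∈ K, g v c) * ∏ v ∈ (insert v K)ᶜ, if o v c = c then 1 else 0))
            * (if o v c = c then 1 else 0) := by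
        intro c; rw [hcompl, Finset.prod_insert hv']; ring
      simp only [e1, e2]
      -- All other factors are constant on the fibres of `o v`, and on each fibre both `g v` and the
      -- point mass at the base point sum to 1.
      refine sum_mul_congr_fiber (o v) ?_ ?_
      · have inv : ∀ c, h c * ((∏ v ∈ K, g v c) *
            ∏ v ∈ (insert v K)ᶜ, if o v c = c then (1 : ℝ) else 0)
            = h (o v c) * ((∏ w ∈ K, g w (o v c)) *
            ∏ w ∈ (insert v K)ᶜ, if o w (o v c) = o v c then (1 : ℝ) else 0) := by
          intro c
          rw [hh v hvK]
          congr 2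
          · exact Finset.prod_congr rfl fun w hw => (hK w hw v hvK c).symm
          · refine Finset.prod_congr rfl fun w hw => ?_
            have hwv : w ≠ v := by rintro rfl; exact hv' hw
            simp only [hfix w v hwv c]
        intro c c' hcc
        rw [inv c, inv c', hcc]
      · intro c
        rw [hsum, Finset.sum_filter]
        rw [Finset.sum_eq_single (o v c)]
        · simp [idem]
        · intro c' _ hne
          split_ifs with h1 h2
          · exact absurd (h2.symm.trans h1) hne
          · rfl
          · rfl
        · simp
    · intro b hb a ha c
      simp only [Finset.mem_insert, not_or] at ha
      rcases Finset.mem_insert.1 hb with rfl | hb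
      · exact hdep a b ha.1 (hmin a (Finset.mem_compl.2 ha.2)) c
      · exact hK b hb a ha.2 c
    · intro a ha c
      simp only [Finset.mem_insert, not_or] at ha
      exact hh a ha.2 c
    · have := congrArg Finset.card hcompl
      rw [Finset.card_insert_of_notMem hv'] at this
      omega

open Classical in
/-- Summing over the functions that agree with `c` outside `v`. -/
theorem sum_update_fiber {V : Type*} {α : V → Type*} [Fintype V] [DecidableEq V]
    [∀ v, Fintype (α v)] (c c₀ : ∀ v, α v) (v : V) (F : (∀ v, α v) → ℝ) :
    ∑ c' with Function.update c' v (c₀ v) = Function.update c v (c₀ v), F c'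
      = ∑ a, F (Function.update c v a) := by
  refine Finset.sum_nbij' (fun c' => c' v) (fun a => Function.update c v a) ?_ ?_ ?_ ?_ ?_
  · simp
  · simp
  · intro c' hc'
    have h := (Finset.mem_filter.1 hc').2
    ext w
    by_cases hw : w = v
    · subst hw; simp
    · have := congrFun h w
      simp [hw] at this ⊢
      exact this.symm
  · simp
  · intro c' hc'
    have h := (Finset.mem_filter.1 hc').2
    congr 1
    ext w
    by_cases hw : w = v
    · subst hw; simp
    · have := congrFun h w
      simp [hw] at this ⊢
      exact this

open Classical in
/-- Elimination in a Bayesian network whose configuration space is a product. -/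
theorem sum_prod_elim_pi {V : Type*} {α : V → Type*} [Fintype V] [DecidableEq V]
    [∀ v, Fintype (α v)] (rank : V → ℕ) (g : V → (∀ v, α v) → ℝ) (c₀ : ∀ v, α v)
    (hsum : ∀ v c, ∑ a, g v (Function.update c v a) = 1)
    (hdep : ∀ b c c', c b = c' b → (∀ a, rank a < rank b → c a = c' a) → g b c = g b c')
    (K : Finset V) (hK : ∀ b ∈ K, ∀ c c', (∀ a ∈ K, c a = c' a) → g b c = g b c')
    (h : (∀ v, α v) → ℝ) (hh : ∀ c c', (∀ a ∈ K, c a = c' a) → h c = h c') :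
    ∑ c, h c * ∏ v, g v c = ∑ c with ∀ v ∉ K, c v = c₀ v, h c * ∏ v ∈ K, g v c := by
  rw [sum_prod_elim (fun v c => Function.update c v (c₀ v)) rank g (by simp) ?_ ?_ ?_ K ?_ h ?_]
  · rw [Finset.sum_filter]
    refine Finset.sum_congr rfl fun c _ => ?_
    have e : (∏ v ∈ Kᶜ, if Function.update c v (c₀ v) = c then (1 : ℝ) else 0)
        = if ∀ v ∉ K, c₀ v = c v then 1 else 0 := by
      simp only [Function.update_eq_self_iff, Finset.prod_ite_zero, Finset.mem_compl,
        Finset.prod_const_one]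
    simp only [Function.update_eq_self_iff] at e ⊢
    refine (congrArg (fun z => h c * ((∏ v ∈ K, g v c) * z)) (Eq.trans ?_ e)).trans ?_
    · congr!
    by_cases hc : ∀ v ∉ K, c v = c₀ v
    · rw [if_pos hc, if_pos (fun v hv => (hc v hv).symm), mul_one]
    · rw [if_neg hc, if_neg (fun H => hc fun v hv => (H v hv).symm), mul_zero, mul_zero]
  · intro a b hab c
    simp [hab]
  · intro v c
    refine Eq.trans ?_ ((sum_update_fiber c c₀ v _).trans (hsum v c))
    congr!
  · intro a b hab hr c
    refine hdep b _ _ (Function.update_of_ne hab.symm _ _) fun w hw => ?_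
    exact Function.update_of_ne (by rintro rfl; omega) _ _
  · intro b hb a ha c
    exact hK b hb _ _ fun w hw => Function.update_of_ne (by rintro rfl; exact ha hw) _ _
  · intro a ha c
    exact hh _ _ fun w hw => Function.update_of_ne (by rintro rfl; exact ha hw) _ _

theorem sum_pi_prod {ι : Type*} [Fintype ι] [DecidableEq ι] {α : ι → Type*} [∀ i, Fintype (α i)]
    (f : ∀ i, α i → ℝ) : ∑ x : ∀ i, α i, ∏ i, f i (x i) = ∏ i, ∑ a, f i a := by
  rw [← Fintype.piFinset_univ, ← Finset.prod_univ_sum]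

open Classical in
/-- A product of stochastic kernels applied at separate nodes is no better than the best choice of
deterministic maps. -/
theorem exists_deterministic {ι : Type*} [Fintype ι] [DecidableEq ι] {Y L : ι → Type*}
    [∀ k, Fintype (Y k)] [∀ k, Fintype (L k)] (κ : ∀ k, Y k → L k → ℝ)
    (κ_nonneg : ∀ k y l, 0 ≤ κ k y l) (κ_sum : ∀ k y, ∑ l, κ k y l = 1)
    (F : (∀ k, Y k) → (∀ k, L k) → ℝ) :
    ∃ φ : ∀ k, Y k → L k,
      ∑ y, ∑ m, (∏ k, κ k (y k) (m k)) * F y m ≤ ∑ y, F y fun k => φ k (y k) := by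
  -- Draw `φ` at random with all values `φ k b` independent, `φ k b` having law `κ k b`. For fixed
  -- `y` the tuple `φ k (y k)` then has the product law, so the stochastic value is an average of
  -- deterministic ones.
  have total : ∑ φ : ∀ k, Y k → L k, ∏ k, ∏ b, κ k b (φ k b) = 1 := by
    rw [sum_pi_prod fun k (φ : Y k → L k) => ∏ b, κ k b (φ b)]
    refine Finset.prod_eq_one fun k _ => ?_
    rw [sum_pi_prod fun b l => κ k b l]
    exact Finset.prod_eq_one fun b _ => κ_sum k b
  have marg : ∀ (y : ∀ k, Y k) (m : ∀ k, L k),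
      ∑ φ : ∀ k, Y k → L k, (∏ k, ∏ b, κ k b (φ k b)) * (if (fun k => φ k (y k)) = m then 1 else 0)
        = ∏ k, κ k (y k) (m k) := by
    intro y m
    have e : ∀ φ : ∀ k, Y k → L k,
        (∏ k, ∏ b, κ k b (φ k b)) * (if (fun k => φ k (y k)) = m then 1 else 0)
          = ∏ k, ∏ b, κ k b (φ k b) * (if b = y k then (if φ k b = m k then 1 else 0) else 1) := by
      intro φ
      simp only [Finset.prod_mul_distrib, Finset.prod_ite_eq', Finset.mem_univ, if_true]
      congr 1
      rw [Finset.prod_ite_zero]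
      simp [funext_iff]
    simp only [e]
    rw [sum_pi_prod fun k (φ : Y k → L k) =>
      ∏ b, κ k b (φ b) * (if b = y k then (if φ b = m k then 1 else 0) else 1)]
    refine Finset.prod_congr rfl fun k _ => ?_
    rw [sum_pi_prod
      (fun b l => κ k b l * (if b = y k then (if l = m k then 1 else 0) else 1))]
    rw [Finset.prod_eq_single (y k)]
    · simp
    · intro b _ hb
      simp [hb, κ_sum]
    · simp
  have avg : ∑ φ : ∀ k, Y k → L k, (∏ k, ∏ b, κ k b (φ k b)) * ∑ y, F y (fun k => φ k (y k))
      = ∑ y, ∑ m, (∏ k, κ k (y k) (m k)) * F y m := by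
    simp only [← marg, Finset.sum_mul, Finset.mul_sum]
    rw [Finset.sum_comm]
    refine Finset.sum_congr rfl fun y _ => ?_
    rw [Finset.sum_comm]
    refine Finset.sum_congr rfl fun φ _ => ?_
    simp
  by_contra! hcon
  have hpos : ∃ φ : ∀ k, Y k → L k, φ ∈ Finset.univ ∧ (∏ k, ∏ b, κ k b (φ k b)) ≠ 0 := by
    by_contra! h0
    rw [Finset.sum_eq_zero fun φ h => h0 φ h] at total
    exact zero_ne_one total
  obtain ⟨φ₀, -, hφ₀⟩ := hpos
  have nn : ∀ φ : ∀ k, Y k → L k, 0 ≤ ∏ k, ∏ b, κ k b (φ k b) := fun φ =>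
    Finset.prod_nonneg fun k _ => Finset.prod_nonneg fun b _ => κ_nonneg _ _ _
  have : ∑ φ : ∀ k, Y k → L k, (∏ k, ∏ b, κ k b (φ k b)) * ∑ y, F y (fun k => φ k (y k))
      < ∑ φ : ∀ k, Y k → L k, (∏ k, ∏ b, κ k b (φ k b)) *
        ∑ y, ∑ m, (∏ k, κ k (y k) (m k)) * F y m := by
    refine Finset.sum_lt_sum (fun φ _ => mul_le_mul_of_nonneg_left (hcon φ).le (nn φ))
      ⟨φ₀, Finset.mem_univ _, mul_lt_mul_of_pos_left (hcon φ₀) ((nn φ₀).lt_of_ne' hφ₀)⟩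
  rw [← Finset.sum_mul, total, one_mul, avg] at this
  exact lt_irrefl _ this

end FiniteSums

/-! ### The weak law of large numbers by second moments. -/

section LawOfLargeNumbers

variable {S : Type*} [Fintype S]

theorem sum_prod_eq_one {q : S → ℝ} (hq : ∑ s, q s = 1) (n : ℕ) :
    ∑ s : Fin n → S, ∏ t, q (s t) = 1 := by
  classical
  rw [← Fintype.piFinset_univ, ← Finset.prod_univ_sum]
  simp [hq]

theorem sum_fin_succ_fun (n : ℕ) (F : (Fin (n + 1) → S) → ℝ) :
    ∑ s, F s = ∑ a : S, ∑ s : Fin n → S, F (Fin.cons a s) := by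
  rw [← Fintype.sum_prod_type']
  exact (Fintype.sum_equiv (Fin.consEquiv fun _ => S) _ _ fun _ => rfl).symm

theorem sum_prod_mul_sum_eq_zero {q f : S → ℝ} (hq : ∑ s, q s = 1) (hf : ∑ s, q s * f s = 0)
    (n : ℕ) : ∑ s : Fin n → S, (∏ t, q (s t)) * ∑ t, f (s t) = 0 := by
  induction n with
  | zero => simp
  | succ n ih =>
    rw [sum_fin_succ_fun]
    have : ∀ a : S, ∑ s : Fin n → S, (∏ t, q ((Fin.cons a s : Fin (n+1) → S) t)) *
        ∑ t, f ((Fin.cons a s : Fin (n+1) → S) t) = q a * f a := by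
      intro a
      simp only [Fin.prod_univ_succ, Fin.sum_univ_succ, Fin.cons_zero, Fin.cons_succ]
      have e : ∀ s : Fin n → S, q a * (∏ t, q (s t)) * (f a + ∑ t, f (s t))
          = q a * f a * (∏ t, q (s t)) + q a * ((∏ t, q (s t)) * ∑ t, f (s t)) := by
        intro s; ring
      simp only [e, Finset.sum_add_distrib, ← Finset.mul_sum, ih, sum_prod_eq_one hq]
      ring
    simp only [this, hf]

/-- Additivity of variance: when the first coordinate is split off, the cross term vanishes by
`sum_prod_mul_sum_eq_zero`. -/
theorem sum_prod_mul_sum_sq {q f : S → ℝ} (hq : ∑ s, q s = 1) (hf : ∑ s, q s * f s = 0)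
    (n : ℕ) : ∑ s : Fin n → S, (∏ t, q (s t)) * (∑ t, f (s t)) ^ 2
      = n * ∑ s, q s * f s ^ 2 := by
  induction n with
  | zero => simp
  | succ n ih =>
    rw [sum_fin_succ_fun]
    have : ∀ a : S, ∑ s : Fin n → S, (∏ t, q ((Fin.cons a s : Fin (n+1) → S) t)) *
        (∑ t, f ((Fin.cons a s : Fin (n+1) → S) t)) ^ 2
          = q a * f a ^ 2 + q a * (n * ∑ s, q s * f s ^ 2) := by
      intro a
      simp only [Fin.prod_univ_succ, Fin.sum_univ_succ, Fin.cons_zero, Fin.cons_succ]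
      have e : ∀ s : Fin n → S, q a * (∏ t, q (s t)) * (f a + ∑ t, f (s t)) ^ 2
          = q a * f a ^ 2 * (∏ t, q (s t)) + 2 * q a * f a * ((∏ t, q (s t)) * ∑ t, f (s t))
            + q a * ((∏ t, q (s t)) * (∑ t, f (s t)) ^ 2) := by
        intro s; ring
      simp only [e, Finset.sum_add_distrib, ← Finset.mul_sum, ih, sum_prod_eq_one hq,
        sum_prod_mul_sum_eq_zero hq hf]
      ring
    simp only [this, Finset.sum_add_distrib, ← Finset.sum_mul, hq]
    push_cast
    ring

open Classical in
/-- Weak law of large numbers for a finitely supported law. -/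
theorem tendsto_deviation {q : S → ℝ} (hq0 : ∀ s, 0 ≤ q s) (hq : ∑ s, q s = 1) (f : S → ℝ)
    {δ : ℝ} (hδ : 0 < δ) :
    Tendsto (fun n : ℕ => ∑ s : Fin n → S with
        ¬ |∑ t, f (s t) - n * ∑ a, q a * f a| < n * δ, ∏ t, q (s t)) atTop (𝓝 0) := by
  set m := ∑ a, q a * f a with hm
  set v := ∑ s, q s * (f s - m) ^ 2 with hv
  have hcent : ∑ s, q s * (f s - m) = 0 := by
    simp only [mul_sub, Finset.sum_sub_distrib, ← Finset.sum_mul, hq, ← hm]; ring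
  have hbound : ∀ n : ℕ, 0 < n → ∑ s : Fin n → S with
        ¬ |∑ t, f (s t) - n * m| < n * δ, ∏ t, q (s t) ≤ v / δ ^ 2 / n := by
    intro n hn
    have hn' : (0 : ℝ) < n := Nat.cast_pos.2 hn
    -- Chebyshev: on the deviation event the squared quotient is at least 1.
    have h1 : ∑ s : Fin n → S with ¬ |∑ t, f (s t) - n * m| < n * δ, ∏ t, q (s t)
        ≤ ∑ s : Fin n → S, (∏ t, q (s t)) * ((∑ t, (f (s t) - m)) ^ 2 / (n * δ) ^ 2) := by
      rw [Finset.sum_filter]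
      refine Finset.sum_le_sum fun s _ => ?_
      have hp : 0 ≤ ∏ t, q (s t) := Finset.prod_nonneg fun t _ => hq0 _
      split_ifs with hs
      · exact mul_nonneg hp (by positivity)
      · refine le_mul_of_one_le_right hp ?_
        rw [one_le_div (by positivity)]
        have : ∑ t, (f (s t) - m) = ∑ t, f (s t) - n * m := by
          simp [Finset.sum_sub_distrib]
        rw [this, ← sq_abs (∑ t, f (s t) - n * m)]
        exact pow_le_pow_left₀ (by positivity) (not_lt.1 hs) 2
    refine h1.trans (le_of_eq ?_)
    simp only [← mul_div_assoc, ← Finset.sum_div]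
    rw [sum_prod_mul_sum_sq (f := fun a => f a - m) hq hcent]
    rw [← hv]
    field_simp
  refine squeeze_zero' (Eventually.of_forall fun n => Finset.sum_nonneg fun s _ =>
    Finset.prod_nonneg fun t _ => hq0 _) ((eventually_gt_atTop 0).mono hbound) ?_
  exact tendsto_const_div_atTop_nhds_zero_nat _

end LawOfLargeNumbers

/-! ### Random superposition codebooks. -/

section RandomCodebook

/-- The generation law of superposition codebooks: `val j u` is the conditional probability of the
symbol `u j` given the symbols `u i`, `i ∈ A j`. -/
structure SuperpositionKernel {ν : ℕ} (A : Fin ν → Finset (Fin ν)) (𝒰 : Fin ν → Type*)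
    [∀ j, Fintype (𝒰 j)] where
  /-- The conditional probabilities. -/
  val : Fin ν → (∀ i, 𝒰 i) → ℝ
  nonneg : ∀ j u, 0 ≤ val j u
  sum_update : ∀ j u, ∑ a, val j (Function.update u j a) = 1
  congr : ∀ j u u', (∀ i ∈ A j, u i = u' i) → u j = u' j → val j u = val j u'

variable {μ ν : ℕ} (Γ : Fin ν → Finset (Fin μ)) (I : Fin μ → Type*)

/-- The positions of all codewords: a codebook `j` and values of the indices in `Γ j`. -/
abbrev Position := Σ j : Fin ν, ((i : Γ j) → I i)

variable {Γ I} {A : Fin ν → Finset (Fin ν)} {𝒰 : Fin ν → Type*}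

variable (Γ) in
/-- The values in `L` of the indices in `Γ j`. -/
def indexRestrict (L : ∀ i, I i) (j : Fin ν) : (i : Γ j) → I i := fun i => L i

/-- The codewords selected by the index tuple `L`. -/
def codewords (c : ∀ p : Position Γ I, 𝒰 p.1) (L : ∀ i, I i) (j : Fin ν) : 𝒰 j :=
  c ⟨j, indexRestrict Γ L j⟩

theorem codewords_congr (c : ∀ p : Position Γ I, 𝒰 p.1) {L L' : ∀ i, I i} {j : Fin ν}
    (h : ∀ i ∈ Γ j, L i = L' i) : codewords c L j = codewords c L' j := by
  have : indexRestrict Γ L j = indexRestrict Γ L' j := funext fun i => h i i.2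
  rw [codewords, codewords, this]

open Classical in
theorem prod_position_filter [∀ i, Fintype (I i)] (L : ∀ i, I i) (Q : Finset (Fin ν)) (F : Position Γ I → ℝ) :
    ∏ p with p.1 ∈ Q ∧ p.2 = indexRestrict Γ L p.1, F p = ∏ j ∈ Q, F ⟨j, indexRestrict Γ L j⟩ := by
  refine Finset.prod_nbij' (fun p => p.1) (fun j => ⟨j, indexRestrict Γ L j⟩) ?_ ?_ ?_ ?_ ?_
  · simp +contextual
  · simp
  · rintro ⟨j, l⟩ h
    have h' := (Finset.mem_filter.1 h).2.2
    simp only at h'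
    rw [h']
  · simp
  · rintro ⟨j, l⟩ h
    have h' := (Finset.mem_filter.1 h).2.2
    simp only at h'
    rw [h']

variable [∀ i, Nonempty (I i)]

open Classical in
/-- An index tuple through a given position. -/
def extend (p : Position Γ I) (i : Fin μ) : I i :=
  if h : i ∈ Γ p.1 then p.2 ⟨i, h⟩ else Classical.arbitrary _

theorem extend_of_mem (p : Position Γ I) {i : Fin μ} (h : i ∈ Γ p.1) :
    extend p i = p.2 ⟨i, h⟩ := dif_pos h

theorem codewords_extend_self (c : ∀ p : Position Γ I, 𝒰 p.1) (p : Position Γ I) :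
    codewords c (extend p) p.1 = c p := by
  obtain ⟨j, l⟩ := p
  have : indexRestrict Γ (extend (⟨j, l⟩ : Position Γ I)) j = l :=
    funext fun i => extend_of_mem ⟨j, l⟩ i.2
  rw [codewords, this]

variable [∀ j, Fintype (𝒰 j)]

/-- The probability of generating the codeword at position `p` of the codebook `c`. -/
def positionProb (g : SuperpositionKernel A 𝒰) (p : Position Γ I)
    (c : ∀ p : Position Γ I, 𝒰 p.1) : ℝ :=
  g.val p.1 (codewords c (extend p))

theorem positionProb_nonneg (g : SuperpositionKernel A 𝒰) (p : Position Γ I)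
    (c : ∀ p : Position Γ I, 𝒰 p.1) : 0 ≤ positionProb g p c := g.nonneg _ _

/-- The filler values of `extend` drop out: the kernel reads only codebook `j` and those in `A j`,
whose indices all lie in `Γ j`. -/
theorem positionProb_eq (hΓ : ∀ j, ∀ i ∈ A j, Γ i ⊆ Γ j) (g : SuperpositionKernel A 𝒰)
    (c : ∀ p : Position Γ I, 𝒰 p.1) (L : ∀ i, I i) (j : Fin ν) :
    positionProb g ⟨j, indexRestrict Γ L j⟩ c = g.val j (codewords c L) := by
  have h : ∀ i ∈ Γ j, extend (⟨j, indexRestrict Γ L j⟩ : Position Γ I) i = L i :=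
    fun i hi => extend_of_mem (⟨j, indexRestrict Γ L j⟩ : Position Γ I) hi
  exact g.congr j _ _ (fun j' hj' => codewords_congr c fun i hi => h i (hΓ j j' hj' hi))
    (codewords_congr c h)

/-- Codebooks in `A j` have numbers below `j`, so changing the word at `p` leaves the words it is
conditioned on fixed. -/
theorem sum_positionProb_update [DecidableEq (Position Γ I)]
    (hA : ∀ j, ∀ i ∈ A j, i < j) (g : SuperpositionKernel A 𝒰)
    (p : Position Γ I) (c : ∀ p : Position Γ I, 𝒰 p.1) :
    ∑ a, positionProb g p (Function.update c p a) = 1 := by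
  rw [← g.sum_update p.1 (codewords c (extend p))]
  refine Finset.sum_congr rfl fun a _ => g.congr _ _ _ (fun i hi => ?_) ?_
  · have hne : i ≠ p.1 := (hA _ _ hi).ne
    rw [Function.update_of_ne hne]
    exact Function.update_of_ne (fun h => hne (congrArg Sigma.fst h)) _ _
  · rw [codewords_extend_self]; simp

theorem positionProb_congr (g : SuperpositionKernel A 𝒰) (p : Position Γ I)
    (c c' : ∀ p : Position Γ I, 𝒰 p.1) (h : c p = c' p)
    (h' : ∀ i ∈ A p.1, codewords c (extend p) i = codewords c' (extend p) i) :
    positionProb g p c = positionProb g p c' :=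
  g.congr _ _ _ h' (by rw [codewords_extend_self, codewords_extend_self, h])

variable [∀ i, Fintype (I i)]

/-- The probability of a codebook. -/
def codebookProb (g : SuperpositionKernel A 𝒰) (c : ∀ p : Position Γ I, 𝒰 p.1) : ℝ :=
  ∏ p, positionProb g p c

theorem codebookProb_nonneg (g : SuperpositionKernel A 𝒰) (c : ∀ p : Position Γ I, 𝒰 p.1) :
    0 ≤ codebookProb g c := Finset.prod_nonneg fun p _ => positionProb_nonneg g p c

open Classical in
/-- The conditional probability of a codebook given the codewords selected by `L`. -/
def restProb (g : SuperpositionKernel A 𝒰) (L : ∀ i, I i) (c : ∀ p : Position Γ I, 𝒰 p.1) : ℝ :=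
  ∏ p with ¬ (p.2 = indexRestrict Γ L p.1), positionProb g p c

theorem restProb_nonneg (g : SuperpositionKernel A 𝒰) (L : ∀ i, I i)
    (c : ∀ p : Position Γ I, 𝒰 p.1) :
    0 ≤ restProb g L c := Finset.prod_nonneg fun p _ => positionProb_nonneg g p c

/-- Isolating the selected words is what permits the change of measure: their generation
probability, multiplied by the encoder weights and the channel, becomes the intended law, while the
rest of the codebook keeps its conditional law. -/
theorem codebookProb_eq (hΓ : ∀ j, ∀ i ∈ A j, Γ i ⊆ Γ j) (g : SuperpositionKernel A 𝒰)
    (L : ∀ i, I i) (c : ∀ p : Position Γ I, 𝒰 p.1) :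
    codebookProb g c = restProb g L c * ∏ j, g.val j (codewords c L) := by
  classical
  rw [codebookProb, ← Finset.prod_filter_mul_prod_filter_not _ (fun p => p.2 = indexRestrict Γ L p.1),
    mul_comm]
  congr 1
  · have := prod_position_filter (Γ := Γ) L Finset.univ fun p => positionProb g p c
    simp only [Finset.mem_univ, true_and] at this
    simp only [positionProb_eq hΓ] at this
    rw [← this]

open Classical in
theorem sum_codebookProb [∀ j, Nonempty (𝒰 j)] (hA : ∀ j, ∀ i ∈ A j, i < j)
    (g : SuperpositionKernel A 𝒰) :
    ∑ c : ∀ p : Position Γ I, 𝒰 p.1, codebookProb g c = 1 := by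
  classical
  have c₀ : ∀ p : Position Γ I, 𝒰 p.1 := fun p => Classical.arbitrary _
  have := sum_prod_elim_pi (fun p : Position Γ I => (p.1 : ℕ)) (fun p c => positionProb g p c) c₀
    (sum_positionProb_update hA g) (fun p c c' h h' => positionProb_congr g p c c' h
      fun i hi => h' _ (hA _ _ hi)) ∅ (by simp) (fun _ => 1) (by simp)
  simp only [one_mul, Finset.notMem_empty, not_false_eq_true, forall_const,
    Finset.prod_empty] at this
  rw [show (∑ c : ∀ p : Position Γ I, 𝒰 p.1, codebookProb g c) = _ from this,
    Finset.sum_eq_single c₀]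
  · intro c hc hne
    exact absurd (funext (Finset.mem_filter.1 hc).2) hne
  · simp

open Classical in
/-- The law of the codewords at the index tuple `l`, in the codebooks of the superposition-closed
set `Q`, given that the codewords at `L` are `u`. -/
theorem sum_restProb_mul (hA : ∀ j, ∀ i ∈ A j, i < j) (hΓ : ∀ j, ∀ i ∈ A j, Γ i ⊆ Γ j)
    (g : SuperpositionKernel A 𝒰) (L l : ∀ i, I i) (u : ∀ j, 𝒰 j) (Q : Finset (Fin ν))
    (hQ : ∀ j ∈ Q, A j ⊆ Q) (φ : (∀ j, 𝒰 j) → ℝ)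
    (hφ : ∀ u u', (∀ j ∈ Q, u j = u' j) → φ u = φ u') :
    ∑ c : (∀ p : Position Γ I, 𝒰 p.1) with codewords c L = u, restProb g L c * φ (codewords c l)
      = ∑ u' with ∀ j ∉ Q.filter (fun j => ∃ i ∈ Γ j, L i ≠ l i), u' j = u j,
          (∏ j ∈ Q with ∃ i ∈ Γ j, L i ≠ l i, g.val j u') * φ u' := by
  -- Pinning the words at `L` to `u` turns the conditional law of the codebook into a Bayesian
  -- network of its own, to which elimination applies.
  set gt : Position Γ I → (∀ p : Position Γ I, 𝒰 p.1) → ℝ := fun p c =>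
    if p.2 = indexRestrict Γ L p.1 then (if c p = u p.1 then 1 else 0) else positionProb g p c with hgt
  -- Only the positions that `l` selects in `Q` survive elimination; they are ancestor-closed
  -- because `Q` is closed under superposition.
  set K : Finset (Position Γ I) := {p | p.1 ∈ Q ∧ p.2 = indexRestrict Γ l p.1} with hKdef
  have memK : ∀ p : Position Γ I, p ∈ K ↔ p.1 ∈ Q ∧ p.2 = indexRestrict Γ l p.1 := by
    intro p; simp [hKdef]
  have prodgt : ∀ c : ∀ p : Position Γ I, 𝒰 p.1,
      ∏ p, gt p c = (if codewords c L = u then 1 else 0) * restProb g L c := by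
    intro c
    rw [hgt, Finset.prod_ite]
    congr 1
    · rw [Finset.prod_ite_zero]
      simp only [Finset.prod_const_one]
      refine if_congr ⟨fun h => ?_, fun h p hp => ?_⟩ rfl rfl
      · ext j
        exact h ⟨j, indexRestrict Γ L j⟩ (by simp)
      · obtain ⟨j, m⟩ := p
        simp only [Finset.mem_filter, Finset.mem_univ, true_and] at hp
        rw [hp, ← h, codewords]
  have step : ∑ c : (∀ p : Position Γ I, 𝒰 p.1), φ (codewords c l) * ∏ p, gt p c
      = ∑ c with ∀ p ∉ K, c p = u p.1, φ (codewords c l) * ∏ p ∈ K, gt p c := by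
    refine sum_prod_elim_pi (fun p => (p.1 : ℕ)) gt (fun p => u p.1) ?_ ?_ K ?_ _ ?_
    · intro p c
      by_cases hp : p.2 = indexRestrict Γ L p.1
      · simp [hgt, hp]
      · simp only [hgt, hp, if_false]
        exact sum_positionProb_update hA g p c
    · intro p c c' h h'
      by_cases hp : p.2 = indexRestrict Γ L p.1
      · simp [hgt, hp, h]
      · simp only [hgt, hp, if_false]
        exact positionProb_congr g p c c' h fun i hi => h' _ (hA _ _ hi)
    · intro p hp c c' h
      by_cases hp' : p.2 = indexRestrict Γ L p.1
      · simp [hgt, hp', h p hp]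
      · simp only [hgt, hp', if_false]
        refine positionProb_congr g p c c' (h p hp) fun j hj => h _ ((memK _).2 ?_)
        have hp := (memK p).1 hp
        refine ⟨hQ _ hp.1 hj, funext fun i => ?_⟩
        have hi := hΓ _ _ hj i.2
        change extend p i = l i
        rw [extend_of_mem p hi, hp.2]
        rfl
    · intro c c' h
      exact hφ _ _ fun j hj => h _ ((memK _).2 ⟨hj, rfl⟩)
  -- A codebook on whose indices `l` and `L` agree supplies the same word to both tuples, hence the
  -- pinned one; every other codebook supplies a fresh word.
  have reindex : ∑ c with ∀ p ∉ K, c p = u p.1, φ (codewords c l) * ∏ p ∈ K, gt p c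
      = ∑ u' with ∀ j ∉ Q, u' j = u j, φ u' * ∏ j ∈ Q,
        if ∃ i ∈ Γ j, L i ≠ l i then g.val j u' else if u' j = u j then 1 else 0 := by
    refine Finset.sum_nbij' (fun c => codewords c l)
      (fun u' p => if p.2 = indexRestrict Γ l p.1 then u' p.1 else u p.1) ?_ ?_ ?_ ?_ ?_
    · intro c hc
      simp only [Finset.mem_filter, Finset.mem_univ, true_and] at hc ⊢
      intro j hj
      exact hc ⟨j, indexRestrict Γ l j⟩ fun h => hj ((memK _).1 h).1
    · intro u' hu'
      simp only [Finset.mem_filter, Finset.mem_univ, true_and] at hu' ⊢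
      intro p hp
      split_ifs with h
      · exact hu' _ fun hQ => hp ((memK p).2 ⟨hQ, h⟩)
      · rfl
    · intro c hc
      simp only [Finset.mem_filter, Finset.mem_univ, true_and] at hc
      ext ⟨j, m⟩
      by_cases h : m = indexRestrict Γ l j
      · subst h; simp [codewords]
      · simp only [h, if_false]
        exact (hc ⟨j, m⟩ fun hk => h ((memK _).1 hk).2).symm
    · intro u' _
      ext j
      simp [codewords]
    · intro c hc
      congr 1
      rw [hKdef, prod_position_filter l Q fun p => gt p c]
      refine Finset.prod_congr rfl fun j _ => ?_
      simp only [hgt]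
      by_cases h : ∃ i ∈ Γ j, L i ≠ l i
      · rw [if_neg, if_pos h, positionProb_eq hΓ]
        intro h'
        obtain ⟨i, hi, hne⟩ := h
        exact hne (congrFun h' ⟨i, hi⟩).symm
      · rw [if_pos, if_neg h]
        · rfl
        · push Not at h
          exact funext fun i => (h i i.2).symm
  calc _ = ∑ c : (∀ p : Position Γ I, 𝒰 p.1), φ (codewords c l) * ∏ p, gt p c := by
        rw [Finset.sum_filter]
        refine Finset.sum_congr rfl fun c _ => ?_
        rw [prodgt]
        split_ifs <;> ring
    _ = _ := by
        rw [step, reindex, Finset.sum_filter, Finset.sum_filter]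
        refine Finset.sum_congr rfl fun u' _ => ?_
        rw [Finset.prod_ite, Finset.prod_ite_zero]
        simp only [Finset.prod_const_one, Finset.mem_filter, not_and, and_imp]
        by_cases h1 : ∀ j ∉ Q, u' j = u j
        · rw [if_pos h1]
          by_cases h2 : ∀ j ∈ Q, ¬ (∃ i ∈ Γ j, L i ≠ l i) → u' j = u j
          · rw [if_pos h2, if_pos]
            · ring
            · intro j hj
              by_cases hjQ : j ∈ Q
              · exact h2 j hjQ (hj hjQ)
              · exact h1 j hjQ
          · rw [if_neg h2, if_neg]
            · ring
            · intro H
              exact h2 fun j _ hj' => H j fun _ => hj'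
        · rw [if_neg h1, if_neg]
          intro H
          exact h1 fun j hj => H j fun h => absurd h hj

open Classical in
theorem sum_restProb (hA : ∀ j, ∀ i ∈ A j, i < j) (hΓ : ∀ j, ∀ i ∈ A j, Γ i ⊆ Γ j)
    (g : SuperpositionKernel A 𝒰) (L : ∀ i, I i) (u : ∀ j, 𝒰 j) :
    ∑ c : (∀ p : Position Γ I, 𝒰 p.1) with codewords c L = u, restProb g L c = 1 := by
  have := sum_restProb_mul hA hΓ g L L u ∅ (by simp) (fun _ => 1) (by simp)
  simp only [mul_one, Finset.filter_empty, Finset.notMem_empty, not_false_eq_true, forall_const,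
    Finset.prod_empty] at this
  rw [this, Finset.sum_const, nsmul_one]
  norm_cast
  rw [Finset.card_eq_one]
  exact ⟨u, by ext u'; simp [funext_iff]⟩

end RandomCodebook

/-! ### The one-shot bound: likelihood encoders and threshold decoders. -/

section OneShot

set_option linter.unusedSectionVars false

/-- Data of a one-shot coding problem over arbitrary finite alphabets, with the index and
superposition structure of `ω`. -/
structure OneShot {N : ℕ} {X : Fin N → Type u} {Y : Fin N → Type v}
    (ω : CodingParams.{u, v, w} N X Y) (𝒰 : Fin ω.ν → Type w) (𝒳 : Fin N → Type u)
    (𝒴 : Fin N → Type v) [∀ j, Fintype (𝒰 j)] where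
  /-- Codebook generation. -/
  gen : SuperpositionKernel ω.A 𝒰
  /-- The compression kernels. -/
  cov : ∀ k, (∀ j, 𝒰 j) → 𝒴 k → ℝ
  cov_nonneg : ∀ k u y, 0 ≤ cov k u y
  cov_congr : ∀ k u u' y, (∀ j ∈ ω.D k ∪ ω.W k, u j = u' j) → cov k u y = cov k u' y
  /-- The channel inputs. -/
  sym : ∀ k, (∀ j, 𝒰 j) → 𝒴 k → 𝒳 k
  sym_congr : ∀ k u u' y, (∀ j ∈ ω.D k ∪ ω.W k, u j = u' j) → sym k u y = sym k u' y
  /-- The channel. -/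
  ch : Fin N → (∀ k, 𝒴 k) → (∀ k, 𝒳 k) → ℝ
  ch_nonneg : ∀ k y x, 0 ≤ ch k y x
  /-- The decoding tests. -/
  test : ∀ k, (∀ j, 𝒰 j) → 𝒴 k → Prop
  test_congr : ∀ k u u' y, (∀ j ∈ ω.D k ∪ ω.B k, u j = u' j) → test k u y → test k u' y
  support : ∀ u y,
    (∏ k, ch k y (fun i => sym i u (y i)) * cov k u (y k)) ≠ 0 → ∀ j, gen.val j u ≠ 0

namespace OneShot

variable {N : ℕ} {X : Fin N → Type u} {Y : Fin N → Type v} {ω : CodingParams.{u, v, w} N X Y}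
  {𝒰 : Fin ω.ν → Type w} {𝒳 : Fin N → Type u} {𝒴 : Fin N → Type v} [∀ j, Fintype (𝒰 j)]
  (P : OneShot ω 𝒰 𝒳 𝒴)

/-- The intended joint law of codewords and channel outputs. -/
def law (u : ∀ j, 𝒰 j) (y : ∀ k, 𝒴 k) : ℝ :=
  (∏ k, P.ch k y (fun i => P.sym i u (y i)) * P.cov k u (y k))
    * ∏ j ∈ Finset.univ \ Finset.univ.biUnion ω.W, P.gen.val j u

theorem law_nonneg (u : ∀ j, 𝒰 j) (y : ∀ k, 𝒴 k) : 0 ≤ P.law u y :=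
  mul_nonneg (Finset.prod_nonneg fun _ _ => mul_nonneg (P.ch_nonneg _ _ _) (P.cov_nonneg _ _ _))
    (Finset.prod_nonneg fun _ _ => P.gen.nonneg _ _)

/-- The likelihood ratio according to which node `k` selects its compression indices. -/
def weight (k : Fin N) (u : ∀ j, 𝒰 j) (y : 𝒴 k) : ℝ :=
  P.cov k u y / ∏ j ∈ ω.W k, P.gen.val j u

theorem weight_nonneg (k : Fin N) (u : ∀ j, 𝒰 j) (y : 𝒴 k) : 0 ≤ P.weight k u y :=
  div_nonneg (P.cov_nonneg _ _ _) (Finset.prod_nonneg fun _ _ => P.gen.nonneg _ _)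

theorem weight_congr (k : Fin N) {u u' : ∀ j, 𝒰 j} (y : 𝒴 k)
    (h : ∀ j ∈ ω.D k ∪ ω.W k, u j = u' j) : P.weight k u y = P.weight k u' y := by
  rw [weight, weight, P.cov_congr k u u' y h]
  congr 1
  refine Finset.prod_congr rfl fun j hj => P.gen.congr j u u' (fun i hi => h i ?_) (h j ?_)
  · have := ω.A_W k (Finset.mem_biUnion.2 ⟨j, hj, hi⟩)
    rwa [Finset.union_comm]
  · exact Finset.mem_union_right _ hj

theorem pairwise_disjoint_W {k k' : Fin N} (h : k ≠ k') : Disjoint (ω.W k) (ω.W k') := by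
  rcases lt_or_gt_of_ne h with h | h
  · exact (Finset.disjoint_of_subset_right (Finset.subset_biUnion_of_mem ω.W (Finset.mem_Iio.2 h))
      (ω.W_disjoint k')).symm
  · exact Finset.disjoint_of_subset_right (Finset.subset_biUnion_of_mem ω.W (Finset.mem_Iio.2 h))
      (ω.W_disjoint k)

/-- The weights are the densities of the compression kernels against codebook generation. The `W k`
are disjoint, so each generation factor cancels once; codebooks outside all `W k` have their
generation kernel on both sides. -/
theorem law_eq {u : ∀ j, 𝒰 j} (y : ∀ k, 𝒴 k) (h : ∀ j, P.gen.val j u ≠ 0) :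
    P.law u y = (∏ j, P.gen.val j u) * (∏ k, P.weight k u (y k))
      * ∏ k, P.ch k y (fun i => P.sym i u (y i)) := by
  have h1 : (∏ j, P.gen.val j u) = (∏ k, ∏ j ∈ ω.W k, P.gen.val j u)
      * ∏ j ∈ Finset.univ \ Finset.univ.biUnion ω.W, P.gen.val j u := by
    rw [← Finset.prod_biUnion fun k _ k' _ hk => pairwise_disjoint_W hk, mul_comm,
      Finset.prod_sdiff (Finset.subset_univ _)]
  have h2 : (∏ k, ∏ j ∈ ω.W k, P.gen.val j u) * ∏ k, P.weight k u (y k)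
      = ∏ k, P.cov k u (y k) := by
    rw [← Finset.prod_mul_distrib]
    refine Finset.prod_congr rfl fun k _ => ?_
    rw [weight, mul_div_cancel₀]
    exact Finset.prod_ne_zero_iff.2 fun j _ => h j
  rw [law, h1, Finset.prod_mul_distrib, ← h2]
  ring

variable {I : Fin ω.μ → Type} [∀ i, Fintype (I i)] [∀ i, Nonempty (I i)]

theorem superposition_subset (j : Fin ω.ν) : ∀ i ∈ ω.A j, ω.Γ i ⊆ ω.Γ j := fun _ hi =>
  (Finset.subset_biUnion_of_mem ω.Γ hi).trans (ω.Γ_superposition j)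

theorem subset_barD {k : Fin N} {j : Fin ω.ν} (hj : j ∈ ω.D k) : ω.Γ j ⊆ ω.barD k :=
  Finset.subset_biUnion_of_mem ω.Γ hj

theorem subset_barD_union_barW {k : Fin N} {j : Fin ω.ν} (hj : j ∈ ω.D k ∪ ω.W k) :
    ω.Γ j ⊆ ω.barD k ∪ ω.barW k := by
  intro i hi
  rcases Finset.mem_union.1 hj with hj | hj
  · exact Finset.mem_union_left _ (subset_barD hj hi)
  · by_cases h : i ∈ ω.barD k
    · exact Finset.mem_union_left _ h
    · exact Finset.mem_union_right _
        (Finset.mem_sdiff.2 ⟨Finset.mem_biUnion.2 ⟨j, hj, hi⟩, h⟩)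

theorem subset_barD_union_barB {k : Fin N} {j : Fin ω.ν} (hj : j ∈ ω.D k ∪ ω.B k) :
    ω.Γ j ⊆ ω.barD k ∪ ω.barB k := by
  intro i hi
  rcases Finset.mem_union.1 hj with hj | hj
  · exact Finset.mem_union_left _ (subset_barD hj hi)
  · by_cases h : i ∈ ω.barD k
    · exact Finset.mem_union_left _ h
    · exact Finset.mem_union_right _
        (Finset.mem_sdiff.2 ⟨Finset.mem_biUnion.2 ⟨j, hj, hi⟩, h⟩)

theorem disjoint_barD_barW (k : Fin N) : Disjoint (ω.barD k) (ω.barW k) :=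
  Finset.disjoint_sdiff

/-- The normalization of the compression kernel of node `k`, as an average over the indices. -/
def norm (c : ∀ p : Position ω.Γ I, 𝒰 p.1) (k : Fin N) (L : ∀ i, I i) (y : 𝒴 k) : ℝ :=
  (∑ m : ∀ i, I i, P.weight k (codewords c ((ω.barW k).piecewise m L)) y)
    / Fintype.card (∀ i, I i)

theorem norm_nonneg (c : ∀ p : Position ω.Γ I, 𝒰 p.1) (k : Fin N) (L : ∀ i, I i) (y : 𝒴 k) :
    0 ≤ P.norm c k L y :=
  div_nonneg (Finset.sum_nonneg fun _ _ => P.weight_nonneg _ _ _) (Nat.cast_nonneg _)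

/-- All indices of the codebooks in `D k ∪ W k` lie in `barD k ∪ barW k`, so what node k decodes and
what it chooses determine every word it uses. -/
theorem codewords_piecewise_congr (c : ∀ p : Position ω.Γ I, 𝒰 p.1) {k : Fin N}
    {L L' m m' : ∀ i, I i} (h : ∀ i ∈ ω.barD k, L i = L' i) (h' : ∀ i ∈ ω.barW k, m i = m' i) :
    ∀ j ∈ ω.D k ∪ ω.W k, codewords c ((ω.barW k).piecewise m L) j
      = codewords c ((ω.barW k).piecewise m' L') j := by
  intro j hj
  refine codewords_congr c fun i hi => ?_
  by_cases hW : i ∈ ω.barW k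
  · simp [hW, h' i hW]
  · rcases Finset.mem_union.1 (subset_barD_union_barW hj hi) with hD | hD
    · simp [hW, h i hD]
    · exact absurd hD hW

theorem norm_congr (c : ∀ p : Position ω.Γ I, 𝒰 p.1) {k : Fin N} {L L' : ∀ i, I i} (y : 𝒴 k)
    (h : ∀ i ∈ ω.barD k, L i = L' i) : P.norm c k L y = P.norm c k L' y := by
  rw [norm, norm]
  congr 1
  exact Finset.sum_congr rfl fun m _ => P.weight_congr k y
    (codewords_piecewise_congr c h fun _ _ => rfl)

/-- The decoder of node `k`: an index tuple passing the test, whose indices in `barD k` are those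
of every tuple passing the test. -/
def dec (c : ∀ p : Position ω.Γ I, 𝒰 p.1) (k : Fin N) (y : 𝒴 k) : ∀ i, I i :=
  Classical.epsilon fun l => P.test k (codewords c l) y ∧
    ∀ l', P.test k (codewords c l') y → ∀ i ∈ ω.barD k, l' i = l i

open Classical in
/-- The stochastic encoder of node `k`. -/
def enc (c : ∀ p : Position ω.Γ I, 𝒰 p.1) (k : Fin N) (y : 𝒴 k) (m : ∀ i, I i) : ℝ :=
  -- The uniform branch only keeps this a probability vector when all weights vanish. The encoder
  -- draws a full index tuple, although only the coordinates in `barW k` matter, so that every node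
  -- has the same normalizing count.
  if P.norm c k (P.dec c k y) y = 0 then (Fintype.card (∀ i, I i) : ℝ)⁻¹
  else P.weight k (codewords c ((ω.barW k).piecewise m (P.dec c k y))) y
    / (Fintype.card (∀ i, I i) * P.norm c k (P.dec c k y) y)

theorem enc_nonneg (c : ∀ p : Position ω.Γ I, 𝒰 p.1) (k : Fin N) (y : 𝒴 k) (m : ∀ i, I i) :
    0 ≤ P.enc c k y m := by
  rw [enc]
  split_ifs
  · positivity
  · exact div_nonneg (P.weight_nonneg _ _ _) (mul_nonneg (Nat.cast_nonneg _) (P.norm_nonneg _ _ _ _))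

theorem sum_enc (c : ∀ p : Position ω.Γ I, 𝒰 p.1) (k : Fin N) (y : 𝒴 k) :
    ∑ m, P.enc c k y m = 1 := by
  have hM : (Fintype.card (∀ i, I i) : ℝ) ≠ 0 := Nat.cast_ne_zero.2 Fintype.card_ne_zero
  by_cases h : P.norm c k (P.dec c k y) y = 0
  · simp only [enc, h, if_true, Finset.sum_const, Finset.card_univ, nsmul_eq_mul]
    exact mul_inv_cancel₀ hM
  · simp only [enc, h, if_false]
    rw [← Finset.sum_div, div_eq_one_iff_eq (mul_ne_zero hM h), norm, mul_div_cancel₀ _ hM]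

open Classical in
/-- The index tuple whose indices in `barW k` are those chosen by node `k`. -/
def glue (ω : CodingParams.{u, v, w} N X Y) {I : Fin ω.μ → Type} [∀ i, Nonempty (I i)]
    (m : Fin N → ∀ i, I i) (i : Fin ω.μ) : I i :=
  if h : ∃ k, i ∈ ω.barW k then m h.choose i else Classical.arbitrary _

/-- No index is fresh at two nodes, so the node picked by choice is the only candidate. -/
theorem glue_of_mem (m : Fin N → ∀ i, I i) {i : Fin ω.μ} {k : Fin N} (hk : i ∈ ω.barW k) :
    glue ω m i = m k i := by
  have h : ∃ k, i ∈ ω.barW k := ⟨k, hk⟩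
  have : h.choose = k := by
    by_contra hne
    exact Finset.disjoint_left.1 (ω.fresh_disjoint _ _ hne) h.choose_spec hk
  rw [glue, dif_pos h, this]

/-- All nodes decode correctly. -/
def DecodesAt (c : ∀ p : Position ω.Γ I, 𝒰 p.1) (L : ∀ i, I i) (y : ∀ k, 𝒴 k) : Prop :=
  ∀ k, ∀ i ∈ ω.barD k, P.dec c k (y k) i = L i

/-- Combines log z ≤ z - 1 with 1 + x ≤ exp x. The lower bound is affine in the normalizations, so
after averaging over codebooks only their means are needed, with no independence or second moments.
-/
theorem one_sub_sum_le_prod_inv {ι : Type*} (s : Finset ι) (z : ι → ℝ) (hz : ∀ k ∈ s, 0 < z k) :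
    1 - ∑ k ∈ s, (z k - 1) ≤ ∏ k ∈ s, (z k)⁻¹ := by
  have h : ∏ k ∈ s, (z k)⁻¹ = Real.exp (-∑ k ∈ s, Real.log (z k)) := by
    rw [← Finset.sum_neg_distrib, Real.exp_sum]
    refine Finset.prod_congr rfl fun k hk => ?_
    rw [Real.exp_neg, Real.exp_log (hz k hk)]
  have h1 : ∑ k ∈ s, Real.log (z k) ≤ ∑ k ∈ s, (z k - 1) :=
    Finset.sum_le_sum fun k hk => Real.log_le_sub_one_of_pos (hz k hk)
  have h2 := Real.add_one_le_exp (-∑ k ∈ s, Real.log (z k))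
  rw [h]; linarith

open Classical in
/-- Contribution of a codebook and of encoder choices `m`, by comparison with the intended law. -/
theorem le_codebookProb_mul_prod_enc (c : ∀ p : Position ω.Γ I, 𝒰 p.1) (m : Fin N → ∀ i, I i)
    (y : ∀ k, 𝒴 k) (Good : (∀ k, 𝒳 k) → (∀ k, 𝒴 k) → Prop)
    (hGood : Good (fun k => P.sym k (codewords c (glue ω m)) (y k)) y) :
    restProb P.gen (glue ω m) c * P.law (codewords c (glue ω m)) y
        * (1 - ∑ k, (P.norm c k (glue ω m) (y k) - 1)
          - (1 + N) * (if P.DecodesAt c (glue ω m) y then 0 else 1))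
      ≤ codebookProb P.gen c * ((Fintype.card (∀ i, I i) : ℝ) ^ N * ∏ k, P.enc c k (y k) (m k))
        * ((∏ k, P.ch k y (fun i =>
            P.sym i (codewords c ((ω.barW i).piecewise (m i) (P.dec c i (y i)))) (y i)))
          * if Good (fun i =>
            P.sym i (codewords c ((ω.barW i).piecewise (m i) (P.dec c i (y i)))) (y i)) y
            then 1 else 0) := by
  set L := glue ω m with hL
  have hM : (0 : ℝ) < Fintype.card (∀ i, I i) := Nat.cast_pos.2 Fintype.card_pos
  have rhs_nonneg : 0 ≤ codebookProb P.gen c *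
        ((Fintype.card (∀ i, I i) : ℝ) ^ N * ∏ k, P.enc c k (y k) (m k))
        * ((∏ k, P.ch k y (fun i =>
            P.sym i (codewords c ((ω.barW i).piecewise (m i) (P.dec c i (y i)))) (y i)))
          * if Good (fun i =>
            P.sym i (codewords c ((ω.barW i).piecewise (m i) (P.dec c i (y i)))) (y i)) y
            then 1 else 0) := by
    refine mul_nonneg (mul_nonneg (codebookProb_nonneg _ _) (mul_nonneg (by positivity)
      (Finset.prod_nonneg fun _ _ => P.enc_nonneg _ _ _ _))) (mul_nonneg
      (Finset.prod_nonneg fun _ _ => P.ch_nonneg _ _ _) (by split_ifs <;> norm_num))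
  have hrest := restProb_nonneg P.gen L c
  have hlaw := P.law_nonneg (codewords c L) y
  by_cases h0 : P.law (codewords c L) y = 0
  · rw [h0, mul_zero, zero_mul]; exact rhs_nonneg
  by_cases hdec : P.DecodesAt c L y
  swap
  · refine le_trans (mul_nonpos_of_nonneg_of_nonpos (mul_nonneg hrest hlaw) ?_) rhs_nonneg
    -- The coefficient `1 + N` is chosen so that, when decoding fails, the bracket becomes minus the
    -- sum of the normalizations, hence nonpositive.
    have : ∑ k, (P.norm c k L (y k) - 1) = ∑ k, P.norm c k L (y k) - N := by
      simp [Finset.sum_sub_distrib]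
    have h2 : 0 ≤ ∑ k, P.norm c k L (y k) := Finset.sum_nonneg fun _ _ => P.norm_nonneg _ _ _ _
    rw [this, if_neg hdec]; linarith
  have hg : ∀ j, P.gen.val j (codewords c L) ≠ 0 :=
    P.support _ y fun h => h0 (by rw [law, h, zero_mul])
  -- With correct decoding, the words each node acts on are those selected by the common tuple `L`.
  have hcw : ∀ k, ∀ j ∈ ω.D k ∪ ω.W k,
      codewords c ((ω.barW k).piecewise (m k) (P.dec c k (y k))) j = codewords c L j := by
    intro k j hj
    rw [codewords_piecewise_congr c (hdec k) (fun i hi => (glue_of_mem m hi).symm) j hj]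
    rw [hL, Finset.piecewise_same]
  have hsym : (fun i => P.sym i (codewords c ((ω.barW i).piecewise (m i) (P.dec c i (y i)))) (y i))
      = fun i => P.sym i (codewords c L) (y i) :=
    funext fun i => P.sym_congr i _ _ _ (hcw i)
  have hw : ∀ k, P.weight k (codewords c L) (y k) ≠ 0 := by
    intro k hk
    apply h0
    rw [P.law_eq y hg, Finset.prod_eq_zero (i := k) (Finset.mem_univ k) hk]
    ring
  have hnorm : ∀ k, 0 < P.norm c k L (y k) := by
    intro k
    refine div_pos ?_ hM
    -- The choice `m = L` itself contributes the weight of the transmitted words, nonzero because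
    -- the law is.
    refine Finset.sum_pos' (fun _ _ => P.weight_nonneg _ _ _) ⟨L, Finset.mem_univ _, ?_⟩
    rw [Finset.piecewise_same]
    exact (P.weight_nonneg _ _ _).lt_of_ne' (hw k)
  have henc : ∀ k, P.enc c k (y k) (m k) = P.weight k (codewords c L) (y k)
      * ((Fintype.card (∀ i, I i) : ℝ)⁻¹ * (P.norm c k L (y k))⁻¹) := by
    intro k
    rw [enc, P.norm_congr c (y k) (hdec k), if_neg (hnorm k).ne',
      P.weight_congr k (y k) (hcw k), div_eq_mul_inv, mul_inv]
  rw [hsym, if_pos hGood, if_pos hdec, codebookProb_eq superposition_subset P.gen L c]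
  simp only [henc]
  rw [Finset.prod_mul_distrib, Finset.prod_mul_distrib, Finset.prod_const, Finset.card_univ,
    Fintype.card_fin, P.law_eq y hg]
  have e : ∀ a b d f p : ℝ, a * b * ((Fintype.card (∀ i, I i) : ℝ) ^ N *
      (d * ((Fintype.card (∀ i, I i) : ℝ)⁻¹ ^ N * p))) * (f * 1) = a * (b * d * f) * p := by
    intro a b d f p
    rw [inv_pow]
    field_simp
  rw [e]
  refine mul_le_mul_of_nonneg_left ?_ (mul_nonneg hrest (by rwa [P.law_eq y hg] at hlaw))
  have := one_sub_sum_le_prod_inv Finset.univ (fun k => P.norm c k L (y k)) fun k _ => hnorm k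
  linarith

open Classical in
theorem card_agree (L : ∀ i, I i) (T : Finset (Fin ω.μ)) :
    ((Finset.univ.filter fun m : ∀ i, I i => ∀ i ∈ T, m i = L i).card : ℝ)
      / Fintype.card (∀ i, I i) = (∏ i ∈ T, (Fintype.card (I i) : ℝ))⁻¹ := by
  have h : (Finset.univ.filter fun m : ∀ i, I i => ∀ i ∈ T, m i = L i)
      = Fintype.piFinset fun i => if i ∈ T then {L i} else Finset.univ := by
    ext m
    simp only [Finset.mem_filter, Finset.mem_univ, true_and, Fintype.mem_piFinset]
    refine forall_congr' fun i => ?_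
    split_ifs with hi <;> simp [hi]
  have hpos : ∀ i, (Fintype.card (I i) : ℝ) ≠ 0 := fun i => Nat.cast_ne_zero.2 Fintype.card_ne_zero
  rw [h, Fintype.card_piFinset, Fintype.card_pi]
  push_cast
  rw [← Finset.prod_div_distrib, ← Finset.prod_inv_distrib, ← Finset.prod_subset
    (Finset.subset_univ T)]
  · refine Finset.prod_congr rfl fun i hi => ?_
    simp [hi]
  · intro i _ hi
    simp [hi, hpos i]

open Classical in
theorem card_agree_off (L : ∀ i, I i) (S : Finset (Fin ω.μ)) :
    ((Finset.univ.filter fun m : ∀ i, I i => ∀ i ∉ S, m i = L i).card : ℝ)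
      = ∏ i ∈ S, (Fintype.card (I i) : ℝ) := by
  have h : (Finset.univ.filter fun m : ∀ i, I i => ∀ i ∉ S, m i = L i)
      = Fintype.piFinset fun i => if i ∈ S then Finset.univ else {L i} := by
    ext m
    simp only [Finset.mem_filter, Finset.mem_univ, true_and, Fintype.mem_piFinset]
    refine forall_congr' fun i => ?_
    split_ifs with hi <;> simp [hi]
  rw [h, Fintype.card_piFinset]
  push_cast
  rw [← Finset.prod_subset (Finset.subset_univ S)]
  · refine Finset.prod_congr rfl fun i hi => ?_
    simp [hi]
  · intro i _ hi
    simp [hi]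

open Classical in
/-- The expected normalization of node `k` given the transmitted codewords. -/
theorem sum_restProb_mul_norm_le (k : Fin N) (L : ∀ i, I i) (u : ∀ j, 𝒰 j) (y : 𝒴 k)
    (γ : Finset (Fin ω.μ) → ℝ) (hγ0 : ∀ T, 0 ≤ γ T)
    (hγ : ∀ T ⊆ ω.barW k, ∑ u' with ∀ j ∉ ω.W k \ ω.coverSet k T, u' j = u j,
      (∏ j ∈ ω.W k \ ω.coverSet k T, P.gen.val j u') * P.weight k u' y ≤ γ T) :
    ∑ c : (∀ p : Position ω.Γ I, 𝒰 p.1) with codewords c L = u,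
        restProb P.gen L c * P.norm c k L y
      ≤ ∑ T ∈ (ω.barW k).powerset, γ T * (∏ i ∈ T, (Fintype.card (I i) : ℝ))⁻¹ := by
  have hM : (0 : ℝ) < Fintype.card (∀ i, I i) := Nat.cast_pos.2 Fintype.card_pos
  -- Competitors are classified by the fresh indices on which they agree with `L`. A codebook of `W
  -- k` outside `coverSet k (τ m)` has an index where they differ, so its word is redrawn
  -- independently.
  set τ : (∀ i, I i) → Finset (Fin ω.μ) := fun m => (ω.barW k).filter fun i => m i = L i with hτ
  have hone : ∀ m : ∀ i, I i, ∑ c : (∀ p : Position ω.Γ I, 𝒰 p.1) with codewords c L = u,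
      restProb P.gen L c * P.weight k (codewords c ((ω.barW k).piecewise m L)) y ≤ γ (τ m) := by
    intro m
    rw [sum_restProb_mul ω.A_lt superposition_subset P.gen L _ u (ω.D k ∪ ω.W k) ?_
      (fun u => P.weight k u y) fun u u' h => P.weight_congr k y h]
    · have hset : (ω.D k ∪ ω.W k).filter
          (fun j => ∃ i ∈ ω.Γ j, L i ≠ (ω.barW k).piecewise m L i)
          = ω.W k \ ω.coverSet k (τ m) := by
        ext j
        have hnot : ∀ i, L i ≠ (ω.barW k).piecewise m L i ↔ i ∈ ω.barW k ∧ i ∉ τ m := by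
          intro i
          by_cases hi : i ∈ ω.barW k <;> simp [hτ, hi, eq_comm]
        simp only [Finset.mem_filter, hnot, Finset.mem_sdiff, CodingParams.coverSet, not_and]
        constructor
        · rintro ⟨hj, i, hi, hiW, hiτ⟩
          have hjD : j ∉ ω.D k := fun hjD =>
            Finset.disjoint_left.1 (disjoint_barD_barW k) (subset_barD hjD hi) hiW
          refine ⟨(Finset.mem_union.1 hj).resolve_left hjD, fun _ hsub => ?_⟩
          rcases Finset.mem_union.1 (hsub hi) with h | h
          · exact hiτ h
          · exact Finset.disjoint_left.1 (disjoint_barD_barW k) h hiW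
        · rintro ⟨hj, hsub⟩
          refine ⟨Finset.mem_union_right _ hj, ?_⟩
          obtain ⟨i, hi, hi'⟩ := Finset.not_subset.1 (hsub hj)
          simp only [Finset.mem_union, not_or] at hi'
          exact ⟨i, hi, (Finset.mem_union.1 (subset_barD_union_barW
            (Finset.mem_union_right _ hj) hi)).resolve_left hi'.2, hi'.1⟩
      rw [hset]
      exact hγ _ (Finset.filter_subset _ _)
    · intro j hj
      rcases Finset.mem_union.1 hj with hj | hj
      · exact (Finset.subset_biUnion_of_mem ω.A hj).trans
          ((ω.A_D k).trans Finset.subset_union_left)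
      · exact (Finset.subset_biUnion_of_mem ω.A hj).trans
          ((ω.A_W k).trans (Finset.union_comm _ _).subset)
  calc _ = (∑ m : ∀ i, I i, ∑ c : (∀ p : Position ω.Γ I, 𝒰 p.1) with codewords c L = u,
      restProb P.gen L c * P.weight k (codewords c ((ω.barW k).piecewise m L)) y)
        / Fintype.card (∀ i, I i) := by
        rw [Finset.sum_comm, Finset.sum_div]
        refine Finset.sum_congr rfl fun c _ => ?_
        rw [norm, mul_div_assoc', Finset.mul_sum]
    _ ≤ (∑ m : ∀ i, I i, γ (τ m)) / Fintype.card (∀ i, I i) := by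
        gcongr with m
        exact hone m
    _ = (∑ T ∈ (ω.barW k).powerset, ∑ m : ∀ i, I i with τ m = T, γ (τ m))
          / Fintype.card (∀ i, I i) := by
        rw [Finset.sum_fiberwise_of_maps_to]
        exact fun m _ => Finset.mem_powerset.2 (Finset.filter_subset _ _)
    _ ≤ _ := by
        -- Agreement exactly on `T` is relaxed to agreement at least on `T`, whose proportion among
        -- all tuples is the inverse product of the sizes.
        rw [Finset.sum_div]
        refine Finset.sum_le_sum fun T _ => ?_
        rw [← card_agree L T, mul_div_assoc']
        gcongr
        rw [Finset.sum_congr rfl (g := fun _ => γ T)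
          fun m hm => by rw [(Finset.mem_filter.1 hm).2], Finset.sum_const, nsmul_eq_mul, mul_comm]
        refine mul_le_mul_of_nonneg_left ?_ (hγ0 T)
        norm_cast
        refine Finset.card_le_card fun m hm => ?_
        simp only [Finset.mem_filter, Finset.mem_univ, true_and] at hm ⊢
        subst hm
        intro i hi
        exact (Finset.mem_filter.1 hi).2

open Classical in
/-- The probability of a decoding error given the transmitted codewords. -/
theorem sum_restProb_not_decodesAt_le (L : ∀ i, I i) (u : ∀ j, 𝒰 j) (y : ∀ k, 𝒴 k)
    (htest : ∀ k, P.test k u (y k)) (β : Fin N → Finset (Fin ω.μ) → ℝ) (hβ0 : ∀ k S, 0 ≤ β k S)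
    (hβ : ∀ k, ∀ S ⊆ ω.barD k ∪ ω.barB k, (S ∩ ω.barD k).Nonempty →
      ∑ u' with ∀ j ∉ ω.packSet k S, u' j = u j,
        (∏ j ∈ ω.packSet k S, P.gen.val j u') * (if P.test k u' (y k) then 1 else 0) ≤ β k S) :
    ∑ c : (∀ p : Position ω.Γ I, 𝒰 p.1) with codewords c L = u,
        restProb P.gen L c * (if P.DecodesAt c L y then 0 else 1)
      ≤ ∑ k, ∑ S ∈ (ω.barD k ∪ ω.barB k).powerset with (S ∩ ω.barD k).Nonempty,
          β k S * ∏ i ∈ S, (Fintype.card (I i) : ℝ) := by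
  set Bad : Fin N → Finset (∀ i, I i) := fun k => Finset.univ.filter fun l =>
    (∀ i ∉ ω.barD k ∪ ω.barB k, l i = L i) ∧ ∃ i ∈ ω.barD k, l i ≠ L i with hBad
  set σ : Fin N → (∀ i, I i) → Finset (Fin ω.μ) := fun k l =>
    (ω.barD k ∪ ω.barB k).filter fun i => l i ≠ L i with hσ
  -- If no tuple passing the test were wrong on `barD k`, then `L` would meet the requirement
  -- defining the decoder, which would therefore agree with `L` there. Hence a failure produces a
  -- wrong tuple that passes.
  have hunion : ∀ c : (∀ p : Position ω.Γ I, 𝒰 p.1), codewords c L = u →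
      (if P.DecodesAt c L y then (0 : ℝ) else 1)
        ≤ ∑ k, ∑ l ∈ Bad k, if P.test k (codewords c l) (y k) then 1 else 0 := by
    intro c hc
    have nn : 0 ≤ ∑ k, ∑ l ∈ Bad k,
        if P.test k (codewords c l) (y k) then (1 : ℝ) else 0 :=
      Finset.sum_nonneg fun _ _ => Finset.sum_nonneg fun _ _ => by split_ifs <;> norm_num
    split_ifs with hdec
    · exact nn
    simp only [DecodesAt, not_forall] at hdec
    obtain ⟨k, i, hi, hne⟩ := hdec
    have hex : ∃ l, P.test k (codewords c l) (y k) ∧ ∃ i ∈ ω.barD k, l i ≠ L i := by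
      by_contra! hno
      have hspec := Classical.epsilon_spec (p := fun l => P.test k (codewords c l) (y k) ∧
        ∀ l', P.test k (codewords c l') (y k) → ∀ i ∈ ω.barD k, l' i = l i)
        ⟨L, by rw [hc]; exact htest k, fun l' hl' i hi => hno l' hl' i hi⟩
      exact hne (hspec.2 L (by rw [hc]; exact htest k) i hi).symm
    obtain ⟨l, hl, i', hi', hne'⟩ := hex
    -- Resetting the competitor to `L` outside `barD k ∪ barB k` does not affect the test and keeps
    -- the union bound to the indices the test depends on.
    have hmem : (ω.barD k ∪ ω.barB k).piecewise l L ∈ Bad k := by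
      simp only [hBad, Finset.mem_filter, Finset.mem_univ, true_and]
      refine ⟨fun i hi => by simp [hi], i', hi', ?_⟩
      rw [Finset.piecewise_eq_of_mem _ _ _ (Finset.mem_union_left _ hi')]
      exact hne'
    have htst : P.test k (codewords c ((ω.barD k ∪ ω.barB k).piecewise l L)) (y k) := by
      refine P.test_congr k _ _ _ (fun j hj => codewords_congr c fun i hi => ?_) hl
      rw [Finset.piecewise_eq_of_mem _ _ _ (subset_barD_union_barB hj hi)]
    refine le_trans ?_ (Finset.single_le_sum (f := fun k => ∑ l ∈ Bad k,
      if P.test k (codewords c l) (y k) then (1 : ℝ) else 0) (fun _ _ => Finset.sum_nonneg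
      fun _ _ => by split_ifs <;> norm_num) (Finset.mem_univ k))
    refine le_trans ?_ (Finset.single_le_sum (f := fun l =>
      if P.test k (codewords c l) (y k) then (1 : ℝ) else 0)
      (fun _ _ => by split_ifs <;> norm_num) hmem)
    simp [htst]
  have hone : ∀ k, ∀ l ∈ Bad k, ∑ c : (∀ p : Position ω.Γ I, 𝒰 p.1) with codewords c L = u,
      restProb P.gen L c * (if P.test k (codewords c l) (y k) then 1 else 0) ≤ β k (σ k l) := by
    intro k l hl
    simp only [hBad, Finset.mem_filter, Finset.mem_univ, true_and] at hl
    rw [sum_restProb_mul ω.A_lt superposition_subset P.gen L l u (ω.D k ∪ ω.B k) ?_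
      (fun u => if P.test k u (y k) then 1 else 0) fun u u' h => if_congr
        ⟨P.test_congr k u u' _ h, P.test_congr k u' u _ fun j hj => (h j hj).symm⟩ rfl rfl]
    · have hset : (ω.D k ∪ ω.B k).filter (fun j => ∃ i ∈ ω.Γ j, L i ≠ l i)
          = ω.packSet k (σ k l) := by
        refine Finset.filter_congr fun j hj => ?_
        constructor
        · rintro ⟨i, hi, hne⟩
          exact ⟨i, Finset.mem_inter.2 ⟨hi, Finset.mem_filter.2
            ⟨subset_barD_union_barB hj hi, hne.symm⟩⟩⟩
        · rintro ⟨i, hi⟩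
          rw [Finset.mem_inter, hσ, Finset.mem_filter] at hi
          exact ⟨i, hi.1, hi.2.2.symm⟩
      rw [hset]
      refine hβ k _ (Finset.filter_subset _ _) ?_
      obtain ⟨i, hi, hne⟩ := hl.2
      exact ⟨i, Finset.mem_inter.2 ⟨Finset.mem_filter.2 ⟨Finset.mem_union_left _ hi, hne⟩, hi⟩⟩
    · intro j hj
      rcases Finset.mem_union.1 hj with hj | hj
      · exact (Finset.subset_biUnion_of_mem ω.A hj).trans
          ((ω.A_D k).trans Finset.subset_union_left)
      · exact (Finset.subset_biUnion_of_mem ω.A hj).trans (ω.A_B k)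
  calc _ ≤ ∑ c : (∀ p : Position ω.Γ I, 𝒰 p.1) with codewords c L = u, restProb P.gen L c *
        ∑ k, ∑ l ∈ Bad k, (if P.test k (codewords c l) (y k) then 1 else 0) := by
        refine Finset.sum_le_sum fun c hc => mul_le_mul_of_nonneg_left
          (hunion c (Finset.mem_filter.1 hc).2) (restProb_nonneg _ _ _)
    _ = ∑ k, ∑ l ∈ Bad k, ∑ c : (∀ p : Position ω.Γ I, 𝒰 p.1) with codewords c L = u,
        restProb P.gen L c * (if P.test k (codewords c l) (y k) then 1 else 0) := by
        simp only [Finset.mul_sum]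
        rw [Finset.sum_comm]
        exact Finset.sum_congr rfl fun k _ => Finset.sum_comm
    _ ≤ ∑ k, ∑ l ∈ Bad k, β k (σ k l) :=
        Finset.sum_le_sum fun k _ => Finset.sum_le_sum fun l hl => hone k l hl
    _ ≤ _ := by
        refine Finset.sum_le_sum fun k _ => ?_
        rw [← Finset.sum_fiberwise_of_maps_to (g := σ k)
          (t := (ω.barD k ∪ ω.barB k).powerset.filter fun S => (S ∩ ω.barD k).Nonempty)]
        · refine Finset.sum_le_sum fun S _ => ?_
          rw [Finset.sum_congr rfl (g := fun _ => β k S)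
            fun m hm => by rw [(Finset.mem_filter.1 hm).2], Finset.sum_const, nsmul_eq_mul,
            mul_comm, ← card_agree_off L S]
          refine mul_le_mul_of_nonneg_left ?_ (hβ0 k S)
          norm_cast
          refine Finset.card_le_card fun l hl => ?_
          simp only [hBad, hσ, Finset.mem_filter, Finset.mem_univ, true_and] at hl ⊢
          obtain ⟨⟨hl1, -⟩, rfl⟩ := hl
          intro i hi
          by_contra hne
          refine hi (Finset.mem_filter.2 ⟨?_, hne⟩)
          by_contra hout
          exact hne (hl1 i hout)
        · intro l hl
          simp only [hBad, Finset.mem_filter, Finset.mem_univ, true_and] at hl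
          obtain ⟨i, hi, hne⟩ := hl.2
          refine Finset.mem_filter.2 ⟨Finset.mem_powerset.2 (Finset.filter_subset _ _), i,
            Finset.mem_inter.2 ⟨Finset.mem_filter.2 ⟨Finset.mem_union_left _ hi, hne⟩, hi⟩⟩

/-- The loss of the one-shot bound. -/
def loss (ω : CodingParams.{u, v, w} N X Y) (M : Fin ω.μ → ℝ) (γ β : Fin N → Finset (Fin ω.μ) → ℝ) :
    ℝ :=
  -- The term of the empty `T` is `γ k ∅`; when it equals 1 it cancels the subtracted 1.
  ∑ k, (∑ T ∈ (ω.barW k).powerset, γ k T * (∏ i ∈ T, M i)⁻¹ - 1)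
    + (1 + N) * ∑ k, ∑ S ∈ (ω.barD k ∪ ω.barB k).powerset with (S ∩ ω.barD k).Nonempty,
        β k S * ∏ i ∈ S, M i

open Classical in
/-- One-shot unified coding bound. -/
theorem exists_maps [∀ k, Fintype (𝒴 k)] [∀ j, Nonempty (𝒰 j)]
    (Good : (∀ k, 𝒳 k) → (∀ k, 𝒴 k) → Prop) (A : (∀ j, 𝒰 j) → (∀ k, 𝒴 k) → Prop)
    (hGood : ∀ u y, A u y → Good (fun k => P.sym k u (y k)) y)
    (htest : ∀ u y, A u y → ∀ k, P.test k u (y k))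
    (γ β : Fin N → Finset (Fin ω.μ) → ℝ) (hγ0 : ∀ k T, 0 ≤ γ k T) (hβ0 : ∀ k S, 0 ≤ β k S)
    (hγ : ∀ u y, A u y → ∀ k, ∀ T ⊆ ω.barW k,
      ∑ u' with ∀ j ∉ ω.W k \ ω.coverSet k T, u' j = u j,
        (∏ j ∈ ω.W k \ ω.coverSet k T, P.gen.val j u') * P.weight k u' (y k) ≤ γ k T)
    (hβ : ∀ k (u : ∀ j, 𝒰 j) (y : 𝒴 k), ∀ S ⊆ ω.barD k ∪ ω.barB k, (S ∩ ω.barD k).Nonempty →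
      ∑ u' with ∀ j ∉ ω.packSet k S, u' j = u j,
        (∏ j ∈ ω.packSet k S, P.gen.val j u') * (if P.test k u' y then 1 else 0) ≤ β k S) :
    ∃ f : ∀ k, 𝒴 k → 𝒳 k,
      (1 - loss ω (fun i => (Fintype.card (I i) : ℝ)) γ β) * ∑ y, ∑ u, (if A u y then P.law u y else 0)
        ≤ ∑ y, (∏ k, P.ch k y fun i => f i (y i)) *
            if Good (fun i => f i (y i)) y then 1 else 0 := by
  set e := loss ω (fun i => (Fintype.card (I i) : ℝ)) γ β with he
  set M : ℝ := (Fintype.card (∀ i, I i) : ℝ) with hMdef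
  have hM : 0 < M := Nat.cast_pos.2 Fintype.card_pos
  set F : (∀ p : Position ω.Γ I, 𝒰 p.1) → (∀ k, 𝒴 k) → (Fin N → ∀ i, I i) → ℝ := fun c y m =>
    (∏ k, P.ch k y (fun i =>
      P.sym i (codewords c ((ω.barW i).piecewise (m i) (P.dec c i (y i)))) (y i)))
    * if Good (fun i =>
      P.sym i (codewords c ((ω.barW i).piecewise (m i) (P.dec c i (y i)))) (y i)) y
      then 1 else 0 with hF
  have hdet := fun c : (∀ p : Position ω.Γ I, 𝒰 p.1) =>
    exists_deterministic (P.enc c) (P.enc_nonneg c) (P.sum_enc c) (F c)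
  choose φ hφ using hdet
  -- The best codebook, with its best deterministic encoders, does at least as well as the average
  -- over the random codebook.
  obtain ⟨c, hc⟩ := Finite.exists_max fun c => ∑ y, F c y fun k => φ c k (y k)
  refine ⟨fun k y => P.sym k (codewords c ((ω.barW k).piecewise (φ c k y) (P.dec c k y))) y, ?_⟩
  change _ ≤ ∑ y, F c y fun k => φ c k (y k)
  have havg : ∑ c, codebookProb P.gen c * ∑ y, ∑ m, (∏ k, P.enc c k (y k) (m k)) * F c y m
      ≤ ∑ y, F c y fun k => φ c k (y k) := by
    calc _ ≤ ∑ c', codebookProb P.gen c' * ∑ y, F c y fun k => φ c k (y k) :=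
          Finset.sum_le_sum fun c' _ => mul_le_mul_of_nonneg_left ((hφ c').trans (hc c'))
            (codebookProb_nonneg _ _)
      _ = _ := by rw [← Finset.sum_mul, sum_codebookProb ω.A_lt, one_mul]
  refine le_trans ?_ havg
  -- `M ^ N` counts the joint encoder choices `m`; the bound `hinner` holds for each of them
  -- separately and is then summed.
  refine le_of_mul_le_mul_left ?_ (pow_pos hM N)
  have hinner : ∀ (m : Fin N → ∀ i, I i) (y : ∀ k, 𝒴 k),
      (1 - e) * ∑ u, (if A u y then P.law u y else 0)
        ≤ ∑ c, codebookProb P.gen c * (M ^ N * ∏ k, P.enc c k (y k) (m k)) * F c y m := by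
    intro m y
    -- Codebooks are grouped by the words `u` at the glued tuple, so that the conditional estimates
    -- given `u` apply to each group.
    rw [← Finset.sum_fiberwise (s := Finset.univ) (g := fun c => codewords c (glue ω m)),
      Finset.mul_sum]
    refine Finset.sum_le_sum fun u _ => ?_
    have hF0 : ∀ c, 0 ≤ F c y m := fun c => mul_nonneg
      (Finset.prod_nonneg fun _ _ => P.ch_nonneg _ _ _) (by split_ifs <;> norm_num)
    split_ifs with hA
    swap
    · rw [mul_zero]
      exact Finset.sum_nonneg fun c _ => mul_nonneg (mul_nonneg (codebookProb_nonneg _ _)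
        (mul_nonneg (by positivity) (Finset.prod_nonneg fun _ _ => P.enc_nonneg _ _ _ _))) (hF0 c)
    have h1 : ∀ c ∈ Finset.univ.filter fun c : (∀ p : Position ω.Γ I, 𝒰 p.1) =>
        codewords c (glue ω m) = u,
        P.law u y * (restProb P.gen (glue ω m) c
          - ∑ k, (restProb P.gen (glue ω m) c * P.norm c k (glue ω m) (y k)
            - restProb P.gen (glue ω m) c)
          - (1 + N) * (restProb P.gen (glue ω m) c *
            if P.DecodesAt c (glue ω m) y then 0 else 1))
          ≤ codebookProb P.gen c * (M ^ N * ∏ k, P.enc c k (y k) (m k)) * F c y m := by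
      intro c hc
      have hc := (Finset.mem_filter.1 hc).2
      have := P.le_codebookProb_mul_prod_enc c m y Good (by rw [hc]; exact hGood u y hA)
      refine le_trans (le_of_eq ?_) this
      rw [hc]
      have : ∑ k, (restProb P.gen (glue ω m) c * P.norm c k (glue ω m) (y k)
            - restProb P.gen (glue ω m) c)
          = restProb P.gen (glue ω m) c * ∑ k, (P.norm c k (glue ω m) (y k) - 1) := by
        rw [Finset.mul_sum]
        exact Finset.sum_congr rfl fun _ _ => by ring
      rw [this]
      ring
    refine le_trans ?_ (Finset.sum_le_sum h1)
    rw [← Finset.mul_sum, mul_comm]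
    refine mul_le_mul_of_nonneg_left ?_ (P.law_nonneg u y)
    have hrest := sum_restProb ω.A_lt superposition_subset P.gen (glue ω m) u
    rw [Finset.sum_sub_distrib, Finset.sum_sub_distrib, ← Finset.mul_sum, hrest, Finset.sum_comm]
    have hnorm : ∀ k, ∑ c : (∀ p : Position ω.Γ I, 𝒰 p.1) with codewords c (glue ω m) = u,
        (restProb P.gen (glue ω m) c * P.norm c k (glue ω m) (y k)
          - restProb P.gen (glue ω m) c)
        ≤ ∑ T ∈ (ω.barW k).powerset, γ k T * (∏ i ∈ T, (Fintype.card (I i) : ℝ))⁻¹ - 1 := by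
      intro k
      rw [Finset.sum_sub_distrib, hrest]
      exact sub_le_sub_right (P.sum_restProb_mul_norm_le k (glue ω m) u (y k) (γ k) (hγ0 k)
        (hγ u y hA k)) 1
    have hdec := P.sum_restProb_not_decodesAt_le (glue ω m) u y (htest u y hA) β hβ0
      fun k S hS hS' => hβ k u (y k) S hS hS'
    have h2 := Finset.sum_le_sum fun k (_ : k ∈ Finset.univ) => hnorm k
    have h3 := mul_le_mul_of_nonneg_left hdec (by positivity : (0 : ℝ) ≤ 1 + N)
    rw [he, loss]
    linarith
  calc M ^ N * ((1 - e) * ∑ y, ∑ u, (if A u y then P.law u y else 0))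
      = ∑ m : Fin N → ∀ i, I i, ∑ y, (1 - e) * ∑ u, (if A u y then P.law u y else 0) := by
        rw [Finset.sum_const, Finset.card_univ, Fintype.card_fun, Fintype.card_fin, nsmul_eq_mul,
          Finset.mul_sum]
        push_cast
        rfl
    _ ≤ ∑ m : Fin N → ∀ i, I i, ∑ y,
        ∑ c, codebookProb P.gen c * (M ^ N * ∏ k, P.enc c k (y k) (m k)) * F c y m :=
        Finset.sum_le_sum fun m _ => Finset.sum_le_sum fun y _ => hinner m y
    _ = _ := by
        rw [Finset.sum_comm, Finset.mul_sum]
        simp only [Finset.mul_sum]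
        rw [Finset.sum_congr rfl fun y _ => Finset.sum_comm, Finset.sum_comm]
        refine Finset.sum_congr rfl fun c _ => Finset.sum_congr rfl fun y _ =>
          Finset.sum_congr rfl fun m _ => ?_
        ring

end OneShot

end OneShot

/-! ### The single-letter law, its likelihood ratios and the chain rule. -/

theorem prod_telescope {ν : ℕ} (φ : Finset (Fin ν) → ℝ) (hφ : ∀ Q, φ Q ≠ 0)
    (S R : Finset (Fin ν)) :
    ∏ j ∈ S, φ (insert j (S.filter (· < j) ∪ R)) / φ (S.filter (· < j) ∪ R) = φ (S ∪ R) / φ R := by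
  -- Adding the largest element last leaves the initial segments of the earlier elements unchanged.
  induction S using Finset.induction_on_max with
  | empty => simp [hφ]
  | insert a S ha ih =>
    have haS : a ∉ S := fun h => lt_irrefl _ (ha a h)
    rw [Finset.prod_insert haS]
    have h1 : (insert a S).filter (· < a) = S := by
      ext i
      simp only [Finset.mem_filter, Finset.mem_insert]
      exact ⟨fun h => h.1.resolve_left h.2.ne, fun h => ⟨Or.inr h, ha i h⟩⟩
    have h2 : ∀ j ∈ S, (insert a S).filter (· < j) = S.filter (· < j) := by
      intro j hj
      rw [Finset.filter_insert, if_neg (not_lt.2 (ha j hj).le)]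
    rw [h1, Finset.prod_congr rfl fun j hj => by rw [h2 j hj], ih, Finset.insert_union]
    field_simp [hφ]

open Classical in
-- Pinning the coordinates outside `T` by point masses makes this a Bayesian network in the order of
-- the codebooks, and elimination removes every vertex. `T` need not be closed under superposition.
theorem sum_prod_kernel_fiber {ν : ℕ} {A : Fin ν → Finset (Fin ν)} {𝒰 : Fin ν → Type*}
    [∀ j, Fintype (𝒰 j)] (g : SuperpositionKernel A 𝒰) (hA : ∀ j, ∀ i ∈ A j, i < j)
    (T : Finset (Fin ν)) (u : ∀ j, 𝒰 j) :
    ∑ u' with ∀ j ∉ T, u' j = u j, ∏ j ∈ T, g.val j u' = 1 := by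
  have := sum_prod_elim_pi (fun j : Fin ν => (j : ℕ))
    (fun j u' => if j ∈ T then g.val j u' else if u' j = u j then 1 else 0) u ?_ ?_ ∅ (by simp)
    (fun _ => 1) (by simp)
  · simp only [one_mul, Finset.notMem_empty, not_false_eq_true, forall_const,
      Finset.prod_empty] at this
    have h2 : ∑ u' : (∀ j, 𝒰 j) with ∀ j, u' j = u j, (1 : ℝ) = 1 := by
      rw [Finset.sum_eq_single u]
      · intro c hc hne
        exact absurd (funext (Finset.mem_filter.1 hc).2) hne
      · simp
    rw [h2] at this
    rw [← this, Finset.sum_filter]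
    refine Finset.sum_congr rfl fun u' _ => ?_
    rw [Finset.prod_ite, Finset.prod_ite_zero]
    simp only [Finset.prod_const_one, Finset.mem_filter, Finset.mem_univ, true_and,
      Finset.filter_mem_eq_inter, Finset.univ_inter]
    split_ifs <;> simp
  · intro j c
    by_cases hj : j ∈ T
    · simp only [hj, if_true]; exact g.sum_update j c
    · simp [hj]
  · intro j c c' h h'
    by_cases hj : j ∈ T
    · simp only [hj, if_true]
      exact g.congr j c c' (fun i hi => h' i (hA j i hi)) h
    · simp [hj, h]

namespace CodingParams

set_option linter.unusedSectionVars false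

variable {N : ℕ} {X : Fin N → Type u} {Y : Fin N → Type v} (ω : CodingParams.{u, v, w} N X Y)

/-- `p(u_{W_k} | u_{D_k}, y_k)` read off from full tuples. -/
def covProb (k : Fin N) (u : ∀ j, ω.U j) (y : Y k) : ℝ :=
  ω.cover k (fun j => u j) y (fun j => u j)

theorem covProb_nonneg (k : Fin N) (u : ∀ j, ω.U j) (y : Y k) : 0 ≤ ω.covProb k u y :=
  (ω.cover k (fun j => u j) y).2.1 _

theorem covProb_congr (k : Fin N) (u u' : ∀ j, ω.U j) (y : Y k)
    (h : ∀ j ∈ ω.D k ∪ ω.W k, u j = u' j) : ω.covProb k u y = ω.covProb k u' y := by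
  have h1 : (fun j : ω.D k => u j) = fun j : ω.D k => u' j :=
    funext fun j => h j (Finset.mem_union_left _ j.2)
  have h2 : (fun j : ω.W k => u j) = fun j : ω.W k => u' j :=
    funext fun j => h j (Finset.mem_union_right _ j.2)
  rw [covProb, covProb, h1, h2]

/-- The channel input at node `k`. -/
def symbol (k : Fin N) (u : ∀ j, ω.U j) (y : Y k) : X k :=
  ω.symbolMap k (fun j => u j) (fun j => u j) y

theorem symbol_congr (k : Fin N) (u u' : ∀ j, ω.U j) (y : Y k)
    (h : ∀ j ∈ ω.D k ∪ ω.W k, u j = u' j) : ω.symbol k u y = ω.symbol k u' y := by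
  have h1 : (fun j : ω.D k => u j) = fun j : ω.D k => u' j :=
    funext fun j => h j (Finset.mem_union_left _ j.2)
  have h2 : (fun j : ω.W k => u j) = fun j : ω.W k => u' j :=
    funext fun j => h j (Finset.mem_union_right _ j.2)
  rw [symbol, symbol, h1, h2]

theorem disjoint_D_W {k l : Fin N} (h : k ≤ l) : Disjoint (ω.D k) (ω.W l) := by
  refine (Finset.disjoint_of_subset_right (ω.D_subset k) ?_).symm
  refine Finset.disjoint_of_subset_right (Finset.biUnion_subset_biUnion_of_subset_left _
    fun i hi => ?_) (ω.W_disjoint l)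
  exact Finset.mem_Iio.2 ((Finset.mem_Iio.1 hi).trans_le h)

open Classical in
theorem sum_covProb (k : Fin N) (u : ∀ j, ω.U j) (y : Y k) :
    ∑ u' with ∀ j ∉ ω.W k, u' j = u j, ω.covProb k u' y = 1 := by
  rw [← (ω.cover k (fun j => u j) y).2.2]
  refine Finset.sum_nbij' (fun u' (j : ω.W k) => u' j)
    (fun a j => if h : j ∈ ω.W k then a ⟨j, h⟩ else u j) ?_ ?_ ?_ ?_ ?_
  · simp
  · intro a _
    simp +contextual
  · intro u' hu'
    ext j
    by_cases hj : j ∈ ω.W k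
    · simp [hj]
    · simp [hj, (Finset.mem_filter.1 hu').2 j hj]
  · intro a _
    ext j
    simp
  · intro u' hu'
    have : (fun j : ω.D k => u' j) = fun j : ω.D k => u j := funext fun j =>
      (Finset.mem_filter.1 hu').2 j (Finset.disjoint_left.1 (ω.disjoint_D_W le_rfl) j.2)
    rw [covProb, this]
    rfl

variable [∀ k, Fintype (X k)] [∀ k, Fintype (Y k)] (net : ADMN N X Y)

theorem prob_nonneg (k : Fin N) (y : ∀ i, Y i) (x : ∀ i, X i) : 0 ≤ net.prob k y x :=
  (net.channel k _ _).2.1 _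

theorem prob_congr (k : Fin N) {y y' : ∀ i, Y i} {x x' : ∀ i, X i} (hy : ∀ i ≤ k, y i = y' i)
    (hx : ∀ i < k, x i = x' i) : net.prob k y x = net.prob k y' x' := by
  have h1 : (fun i : Set.Iio k => y i) = fun i : Set.Iio k => y' i :=
    funext fun i => hy i (le_of_lt i.2)
  have h2 : (fun i : Set.Iio k => x i) = fun i : Set.Iio k => x' i :=
    funext fun i => hx i i.2
  rw [ADMN.prob, ADMN.prob, h1, h2, hy k le_rfl]

theorem sum_prob_update (k : Fin N) (y : ∀ i, Y i) (x : ∀ i, X i) :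
    ∑ b, net.prob k (Function.update y k b) x = 1 := by
  rw [← (net.channel k (fun i => y i) (fun i => x i)).2.2]
  refine Finset.sum_congr rfl fun b _ => ?_
  have h1 : (fun i : Set.Iio k => Function.update y k b i) = fun i : Set.Iio k => y i :=
    funext fun i => Function.update_of_ne (ne_of_lt i.2) _ _
  rw [ADMN.prob, h1, Function.update_self]
  rfl

/-- The joint law of `(U, Y)`. -/
def law (u : ∀ j, ω.U j) (y : ∀ k, Y k) : ℝ :=
  ω.joint net (u, (fun k => ω.symbol k u (y k)), y)

theorem law_eq (u : ∀ j, ω.U j) (y : ∀ k, Y k) : ω.law net u y =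
    (∏ k, net.prob k y (fun i => ω.symbol i u (y i)) * ω.covProb k u (y k))
      * ∏ j ∈ Finset.univ \ Finset.univ.biUnion ω.W, ((Fintype.card (ω.U j) : ℝ))⁻¹ := by
  simp [law, joint, symbol, covProb]

theorem law_nonneg (u : ∀ j, ω.U j) (y : ∀ k, Y k) : 0 ≤ ω.law net u y := by
  rw [law_eq]
  exact mul_nonneg (Finset.prod_nonneg fun _ _ => mul_nonneg (prob_nonneg _ _ _ _)
    (ω.covProb_nonneg _ _ _)) (Finset.prod_nonneg fun _ _ => by positivity)

theorem sum_joint_mul (F : ω.Sample → ℝ) : ∑ s, ω.joint net s * F s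
    = ∑ u, ∑ y, ω.law net u y * F (u, (fun k => ω.symbol k u (y k)), y) := by
  rw [Fintype.sum_prod_type]
  refine Finset.sum_congr rfl fun u _ => ?_
  rw [Fintype.sum_prod_type, Finset.sum_comm]
  refine Finset.sum_congr rfl fun y _ => ?_
  rw [Finset.sum_eq_single fun k => ω.symbol k u (y k)]
  · rfl
  · intro x _ hx
    obtain ⟨k, hk⟩ : ∃ k, x k ≠ ω.symbol k u (y k) := by
      by_contra! h; exact hx (funext h)
    have : ω.joint net (u, x, y) = 0 := by
      rw [joint, Finset.prod_eq_zero (Finset.mem_univ k), zero_mul]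
      exact mul_eq_zero_of_right _ (if_neg hk)
    rw [this, zero_mul]
  · simp

open Classical in
/-- The probability that `U_Q = u_Q` and `Y_k = y`. -/
def cyl (k : Fin N) (Q : Finset (Fin ω.ν)) (u : ∀ j, ω.U j) (y : Y k) : ℝ :=
  ∑ u', ∑ y', ω.law net u' y' * if (∀ j ∈ Q, u' j = u j) ∧ y' k = y then 1 else 0

open Classical in
/-- The probability that `U_Q = u_Q`. -/
def cylU (Q : Finset (Fin ω.ν)) (u : ∀ j, ω.U j) : ℝ :=
  ∑ u', ∑ y', ω.law net u' y' * if ∀ j ∈ Q, u' j = u j then 1 else 0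

theorem cyl_nonneg (k : Fin N) (Q : Finset (Fin ω.ν)) (u : ∀ j, ω.U j) (y : Y k) :
    0 ≤ ω.cyl net k Q u y :=
  Finset.sum_nonneg fun _ _ => Finset.sum_nonneg fun _ _ =>
    mul_nonneg (ω.law_nonneg net _ _) (by split_ifs <;> norm_num)

theorem cylU_nonneg (Q : Finset (Fin ω.ν)) (u : ∀ j, ω.U j) :
    0 ≤ ω.cylU net Q u :=
  Finset.sum_nonneg fun _ _ => Finset.sum_nonneg fun _ _ =>
    mul_nonneg (ω.law_nonneg net _ _) (by split_ifs <;> norm_num)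

theorem cyl_pos (k : Fin N) (Q : Finset (Fin ω.ν)) {u : ∀ j, ω.U j} {y : ∀ k, Y k}
    (h : ω.law net u y ≠ 0) : 0 < ω.cyl net k Q u (y k) := by
  refine Finset.sum_pos' (fun _ _ => Finset.sum_nonneg fun _ _ =>
    mul_nonneg (ω.law_nonneg net _ _) (by split_ifs <;> norm_num)) ⟨u, Finset.mem_univ _, ?_⟩
  refine Finset.sum_pos' (fun _ _ =>
    mul_nonneg (ω.law_nonneg net _ _) (by split_ifs <;> norm_num)) ⟨y, Finset.mem_univ _, ?_⟩
  simpa using (ω.law_nonneg net u y).lt_of_ne' h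

theorem cylU_pos (Q : Finset (Fin ω.ν)) {u : ∀ j, ω.U j} {y : ∀ k, Y k}
    (h : ω.law net u y ≠ 0) : 0 < ω.cylU net Q u := by
  refine Finset.sum_pos' (fun _ _ => Finset.sum_nonneg fun _ _ =>
    mul_nonneg (ω.law_nonneg net _ _) (by split_ifs <;> norm_num)) ⟨u, Finset.mem_univ _, ?_⟩
  refine Finset.sum_pos' (fun _ _ =>
    mul_nonneg (ω.law_nonneg net _ _) (by split_ifs <;> norm_num)) ⟨y, Finset.mem_univ _, ?_⟩
  simpa using (ω.law_nonneg net u y).lt_of_ne' h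

theorem cyl_congr (k : Fin N) (Q : Finset (Fin ω.ν)) {u v : ∀ j, ω.U j} (y : Y k)
    (h : ∀ j ∈ Q, u j = v j) : ω.cyl net k Q u y = ω.cyl net k Q v y := by
  classical
  have : ∀ u' : (∀ j, ω.U j), (∀ j ∈ Q, u' j = u j) ↔ ∀ j ∈ Q, u' j = v j := fun u' =>
    forall₂_congr fun j hj => by rw [h j hj]
  refine Finset.sum_congr rfl fun u' _ => Finset.sum_congr rfl fun y' _ => ?_
  exact congrArg _ (if_congr (and_congr_left' (this u')) rfl rfl)

theorem cylU_congr (Q : Finset (Fin ω.ν)) {u v : ∀ j, ω.U j}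
    (h : ∀ j ∈ Q, u j = v j) : ω.cylU net Q u = ω.cylU net Q v := by
  classical
  have : ∀ u' : (∀ j, ω.U j), (∀ j ∈ Q, u' j = u j) ↔ ∀ j ∈ Q, u' j = v j := fun u' =>
    forall₂_congr fun j hj => by rw [h j hj]
  refine Finset.sum_congr rfl fun u' _ => Finset.sum_congr rfl fun y' _ => ?_
  exact congrArg _ (if_congr (this u') rfl rfl)

open Classical in
-- Only `S.piecewise u' u` survives both constraints. This one computation serves to marginalize
-- cylinder probabilities and to expand a function over its values.
theorem sum_agree {ι : Type*} [Fintype ι] [DecidableEq ι] {α : ι → Type*} [∀ i, Fintype (α i)]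
    (S R : Finset ι) (hSR : Disjoint S R) (u u' : ∀ i, α i) (F : (∀ i, α i) → ℝ)
    (hF : ∀ v v', (∀ i ∈ S ∪ R, v i = v' i) → (∀ i ∉ S, v i = u i) → F v = F v') :
    ∑ v with ∀ i ∉ S, v i = u i, (if ∀ i ∈ S ∪ R, u' i = v i then 1 else 0) * F v
      = (if ∀ i ∈ R, u' i = u i then 1 else 0) * F u' := by
  rw [Finset.sum_eq_single (S.piecewise u' u)]
  · by_cases h : ∀ i ∈ R, u' i = u i
    · have h' : ∀ i ∈ S ∪ R, u' i = S.piecewise u' u i := by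
        intro i hi
        by_cases hS : i ∈ S
        · simp [hS]
        · simp only [hS, not_false_eq_true, Finset.piecewise_eq_of_notMem]
          exact h i ((Finset.mem_union.1 hi).resolve_left hS)
      rw [if_pos h, if_pos h', hF (S.piecewise u' u) u' (fun i hi => (h' i hi).symm)
        fun i hi => Finset.piecewise_eq_of_notMem _ _ _ hi]
    · rw [if_neg h, if_neg]
      · simp
      · intro h'
        apply h
        intro i hi
        rw [h' i (Finset.mem_union_right _ hi),
          Finset.piecewise_eq_of_notMem _ _ _ (Finset.disjoint_right.1 hSR hi)]
  · intro v hv hne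
    rw [if_neg, zero_mul]
    intro h
    apply hne
    ext i
    by_cases hS : i ∈ S
    · simp [hS, h i (Finset.mem_union_left _ hS)]
    · simp [hS, (Finset.mem_filter.1 hv).2 i hS]
  · intro h
    refine absurd (Finset.mem_filter.2 ⟨Finset.mem_univ _, fun i hi => ?_⟩) h
    exact Finset.piecewise_eq_of_notMem _ _ _ hi

open Classical in
theorem sum_cyl (k : Fin N) (S R : Finset (Fin ω.ν)) (hSR : Disjoint S R) (u : ∀ j, ω.U j)
    (y : Y k) :
    ∑ v with ∀ j ∉ S, v j = u j, ω.cyl net k (S ∪ R) v y = ω.cyl net k R u y := by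
  simp only [cyl]
  rw [Finset.sum_comm]
  refine Finset.sum_congr rfl fun u' _ => ?_
  rw [Finset.sum_comm]
  refine Finset.sum_congr rfl fun y' _ => ?_
  rw [← Finset.mul_sum]
  congr 1
  have := sum_agree S R hSR u u' (fun _ => if y' k = y then 1 else 0) (fun _ _ _ _ => rfl)
  simp only [ite_and, ite_mul, one_mul, zero_mul] at this ⊢
  convert this

open Classical in
-- Pinning the coordinates outside `Q` to `u₀` makes each value of u_Q occur once, so this is
-- integration against the marginal law of (U_Q, Y_k).
theorem sum_law_mul (k : Fin N) (Q : Finset (Fin ω.ν)) (u₀ : ∀ j, ω.U j)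
    (φ : (∀ j, ω.U j) → Y k → ℝ) (hφ : ∀ u u' y, (∀ j ∈ Q, u j = u' j) → φ u y = φ u' y) :
    ∑ u, ∑ y, ω.law net u y * φ u (y k)
      = ∑ v with ∀ j ∉ Q, v j = u₀ j, ∑ b, ω.cyl net k Q v b * φ v b := by
  have h1 : ∀ v b, ω.cyl net k Q v b * φ v b = ∑ u', ∑ y', ω.law net u' y' *
      ((if ∀ j ∈ Q, u' j = v j then 1 else 0) * if y' k = b then φ v b else 0) := by
    intro v b
    rw [cyl, Finset.sum_mul]
    refine Finset.sum_congr rfl fun u' _ => ?_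
    rw [Finset.sum_mul]
    refine Finset.sum_congr rfl fun y' _ => ?_
    rw [ite_and]
    split_ifs <;> simp
  have h2 : ∀ u' (y' : ∀ k, Y k), ∑ v with ∀ j ∉ Q, v j = u₀ j,
      (if ∀ j ∈ Q, u' j = v j then 1 else 0) * φ v (y' k) = φ u' (y' k) := by
    intro u' y'
    have := sum_agree Q ∅ (by simp) u₀ u' (fun v => φ v (y' k))
      (fun v v' h _ => hφ v v' _ (by simpa using h))
    simp only [Finset.union_empty, Finset.notMem_empty, false_implies, implies_true, if_true,
      one_mul] at this
    rw [← this]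
    congr!
  calc _ = ∑ u', ∑ y', ω.law net u' y' * ∑ v with ∀ j ∉ Q, v j = u₀ j,
      (if ∀ j ∈ Q, u' j = v j then 1 else 0) * φ v (y' k) := by simp only [h2]
    _ = ∑ u', ∑ y', ∑ v with ∀ j ∉ Q, v j = u₀ j, ∑ b, ω.law net u' y' *
      ((if ∀ j ∈ Q, u' j = v j then 1 else 0) * if y' k = b then φ v b else 0) := by
        refine Finset.sum_congr rfl fun u' _ => Finset.sum_congr rfl fun y' _ => ?_
        rw [Finset.mul_sum]
        refine Finset.sum_congr rfl fun v _ => ?_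
        rw [← Finset.mul_sum, ← Finset.mul_sum]
        simp
    _ = _ := by
        simp only [h1]
        rw [Finset.sum_congr rfl fun u' _ => Finset.sum_comm, Finset.sum_comm]
        refine Finset.sum_congr rfl fun v _ => ?_
        rw [Finset.sum_congr rfl fun u' _ => Finset.sum_comm, Finset.sum_comm]

open Classical in
/-- The codeword symbol kernels `p(u_j | u_{A_j})`. -/
def genVal (j : Fin ω.ν) (u : ∀ j, ω.U j) : ℝ :=
  if j ∈ Finset.univ.biUnion ω.W ∧ ω.cylU net (ω.A j) u ≠ 0 then
    ω.cylU net (insert j (ω.A j)) u / ω.cylU net (ω.A j) u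
  -- For codebooks outside all `W k` the uniform value matches the joint pmf; on null conditioning
  -- events it only keeps the kernel normalized.
  else (Fintype.card (ω.U j) : ℝ)⁻¹

open Classical in
/-- The superposition kernel associated with the coding parameters. -/
def gen : SuperpositionKernel ω.A ω.U where
  val := ω.genVal net
  nonneg j u := by
    rw [genVal]
    split_ifs
    · exact div_nonneg (ω.cylU_nonneg net _ _) (ω.cylU_nonneg net _ _)
    · positivity
  sum_update j u := by
    have hA : ∀ a, ω.cylU net (ω.A j) (Function.update u j a) = ω.cylU net (ω.A j) u := fun a =>
      ω.cylU_congr net _ fun i hi => Function.update_of_ne (ω.A_lt j i hi).ne _ _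
    simp only [genVal, hA]
    split_ifs with h
    · rw [← Finset.sum_div, div_eq_one_iff_eq h.2]
      simp only [cylU]
      rw [Finset.sum_comm]
      refine Finset.sum_congr rfl fun u' _ => ?_
      rw [Finset.sum_comm]
      refine Finset.sum_congr rfl fun y' _ => ?_
      rw [← Finset.mul_sum]
      congr 1
      have : ∀ a, (∀ i ∈ insert j (ω.A j), u' i = Function.update u j a i)
          ↔ (a = u' j ∧ ∀ i ∈ ω.A j, u' i = u i) := by
        intro a
        rw [Finset.forall_mem_insert, Function.update_self, eq_comm]
        refine and_congr_right fun _ => forall₂_congr fun i hi => ?_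
        rw [Function.update_of_ne (ω.A_lt j i hi).ne]
      simp only [this, ite_and, Finset.sum_ite_eq', Finset.mem_univ, if_true]
    · have : Nonempty (ω.U j) := ⟨u j⟩
      simp
  congr j u u' h h' := by
    have hi : ∀ i ∈ insert j (ω.A j), u i = u' i := by
      intro i hi
      rcases Finset.mem_insert.1 hi with rfl | hi
      exacts [h', h i hi]
    rw [genVal, genVal, ω.cylU_congr net _ h, ω.cylU_congr net _ hi]

theorem gen_pos {u : ∀ j, ω.U j} {y : ∀ k, Y k} (h : ω.law net u y ≠ 0) (j : Fin ω.ν) :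
    0 < (ω.gen net).val j u := by
  have : Nonempty (ω.U j) := ⟨u j⟩
  change 0 < ω.genVal net j u
  rw [genVal]
  split_ifs
  · exact div_pos (ω.cylU_pos net _ h) (ω.cylU_pos net _ h)
  · positivity

theorem gen_eq {u : ∀ j, ω.U j} {y : ∀ k, Y k} (h : ω.law net u y ≠ 0) {j : Fin ω.ν}
    (hj : j ∈ Finset.univ.biUnion ω.W) : (ω.gen net).val j u
      = ω.cylU net (insert j (ω.A j)) u / ω.cylU net (ω.A j) u :=
  if_pos ⟨hj, (ω.cylU_pos net _ h).ne'⟩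

theorem gen_eq_of_notMem (u : ∀ j, ω.U j) {j : Fin ω.ν}
    (hj : j ∉ Finset.univ.biUnion ω.W) : (ω.gen net).val j u = (Fintype.card (ω.U j) : ℝ)⁻¹ :=
  if_neg fun h => hj h.1

theorem marginal_joint {α : Type*} (V : ω.Sample → α) (s : ω.Sample)
    (R : (∀ j, ω.U j) → (∀ k, Y k) → Prop) [∀ u y, Decidable (R u y)]
    (hR : ∀ t : ω.Sample, V t = V s ↔ R t.1 t.2.2) :
    marginal (ω.joint net) V (V s) = ∑ u, ∑ y, ω.law net u y * if R u y then 1 else 0 := by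
  have := ω.sum_joint_mul net fun t => if R t.1 t.2.2 then 1 else 0
  rw [← this, marginal, Finset.sum_filter]
  refine Finset.sum_congr rfl fun t _ => ?_
  simp only [hR, mul_ite, mul_one, mul_zero]

/-- The likelihood ratio between `U_S` given `(U_R, Y_k)` and the codebook generation. -/
def ratio (k : Fin N) (S R : Finset (Fin ω.ν)) (u : ∀ j, ω.U j) (y : Y k) : ℝ :=
  ω.cyl net k (S ∪ R) u y / (ω.cyl net k R u y * ∏ j ∈ S, (ω.gen net).val j u)

theorem ratio_pos (k : Fin N) (S R : Finset (Fin ω.ν)) {u : ∀ j, ω.U j} {y : ∀ k, Y k}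
    (h : ω.law net u y ≠ 0) : 0 < ω.ratio net k S R u (y k) :=
  div_pos (ω.cyl_pos net k _ h) (mul_pos (ω.cyl_pos net k _ h)
    (Finset.prod_pos fun j _ => ω.gen_pos net h j))

open Classical in
-- Since `A j ⊆ S`, conditioning on U_{A_j} adds nothing to (U_S, Y_k), and the information density
-- is log p(u_j | u_S, y_k) / p(u_j | u_{A_j}), whose denominator is the generation kernel.
theorem info_eq (k : Fin N) {j : Fin ω.ν} (hj : j ∈ Finset.univ.biUnion ω.W)
    {S : Finset (Fin ω.ν)} (hS : ω.A j ⊆ S) :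
    ω.info net k j S = ∑ u, ∑ y, ω.law net u y * Real.logb 2
      (ω.cyl net k (insert j S) u (y k) / ω.cyl net k S u (y k) / (ω.gen net).val j u) := by
  rw [info, condMutualInfo, ω.sum_joint_mul net]
  refine Finset.sum_congr rfl fun u _ => Finset.sum_congr rfl fun y _ => ?_
  by_cases h : ω.law net u y = 0
  · rw [h, zero_mul, zero_mul]
  congr 2
  set s : ω.Sample := (u, (fun k => ω.symbol k u (y k)), y) with hs
  have e1 := ω.marginal_joint net (fun t : ω.Sample =>
      (t.1 j, ((fun i : S => t.1 i), t.2.2 k), (fun i : ω.A j => t.1 i))) s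
    (fun u' y' => (∀ i ∈ insert j S, u' i = u i) ∧ y' k = y k) (by
      intro t
      simp only [Prod.mk.injEq, funext_iff, Subtype.forall, Finset.forall_mem_insert, hs]
      constructor
      · rintro ⟨h1, ⟨h2, h3⟩, h4⟩; exact ⟨⟨h1, h2⟩, h3⟩
      · rintro ⟨⟨h1, h2⟩, h3⟩; exact ⟨h1, ⟨h2, h3⟩, fun i hi => h2 i (hS hi)⟩)
  have e2 := ω.marginal_joint net (fun t : ω.Sample => (fun i : ω.A j => t.1 i)) s
    (fun u' y' => ∀ i ∈ ω.A j, u' i = u i) (by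
      intro t
      simp only [funext_iff, Subtype.forall, hs])
  have e3 := ω.marginal_joint net (fun t : ω.Sample => (t.1 j, (fun i : ω.A j => t.1 i))) s
    (fun u' y' => ∀ i ∈ insert j (ω.A j), u' i = u i) (by
      intro t
      simp only [Prod.mk.injEq, funext_iff, Subtype.forall, Finset.forall_mem_insert, hs])
  have e4 := ω.marginal_joint net (fun t : ω.Sample =>
      (((fun i : S => t.1 i), t.2.2 k), (fun i : ω.A j => t.1 i))) s
    (fun u' y' => (∀ i ∈ S, u' i = u i) ∧ y' k = y k) (by
      intro t
      simp only [Prod.mk.injEq, funext_iff, Subtype.forall, hs]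
      constructor
      · rintro ⟨⟨h2, h3⟩, h4⟩; exact ⟨h2, h3⟩
      · rintro ⟨h2, h3⟩; exact ⟨⟨h2, h3⟩, fun i hi => h2 i (hS hi)⟩)
  rw [e1, e2, e3, e4, ω.gen_eq net h hj]
  change ω.cyl net k (insert j S) u (y k) * ω.cylU net (ω.A j) u
    / (ω.cylU net (insert j (ω.A j)) u * ω.cyl net k S u (y k)) = _
  have p1 := (ω.cylU_pos net (ω.A j) h).ne'
  have p2 := (ω.cylU_pos net (insert j (ω.A j)) h).ne'
  have p3 := (ω.cyl_pos net k S h).ne'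
  field_simp

/-- Chain rule for the information sums in the coding theorem. -/
theorem sum_info_eq (k : Fin N) (S R : Finset (Fin ω.ν)) (hS : S ⊆ Finset.univ.biUnion ω.W)
    (hA : ∀ j ∈ S, ω.A j ⊆ S.filter (· < j) ∪ R) :
    ∑ j ∈ S, ω.info net k j (S.filter (· < j) ∪ R)
      = ∑ u, ∑ y, ω.law net u y * Real.logb 2 (ω.ratio net k S R u (y k)) := by
  rw [Finset.sum_congr rfl fun j hj => ω.info_eq net k (hS hj) (hA j hj), Finset.sum_comm]
  refine Finset.sum_congr rfl fun u _ => ?_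
  rw [Finset.sum_comm]
  refine Finset.sum_congr rfl fun y _ => ?_
  rw [← Finset.mul_sum]
  by_cases h : ω.law net u y = 0
  · rw [h, zero_mul, zero_mul]
  congr 1
  rw [← Real.logb_prod]
  · congr 1
    rw [Finset.prod_div_distrib, prod_telescope (fun Q => ω.cyl net k Q u (y k))
      (fun Q => (ω.cyl_pos net k Q h).ne'), ratio, div_div]
  · intro j _
    exact (div_pos (div_pos (ω.cyl_pos net k _ h) (ω.cyl_pos net k _ h)) (ω.gen_pos net h j)).ne'

/-- A vanishing relative entropy forces the likelihood ratio to be one. -/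
theorem ratio_eq_one (k : Fin N) (S R : Finset (Fin ω.ν)) (hSR : Disjoint S R)
    (hA : ∀ j ∈ S, ω.A j ⊆ S ∪ R)
    (hlaw : ∑ u, ∑ y, ω.law net u y = 1)
    (hzero : ∑ u, ∑ y, ω.law net u y * Real.logb 2 (ω.ratio net k S R u (y k)) = 0)
    {u : ∀ j, ω.U j} {y : ∀ k, Y k} (h : ω.law net u y ≠ 0) :
    ω.ratio net k S R u (y k) = 1 := by
  classical
  have hrest : ∀ u u' (y : Y k), (∀ j ∈ S ∪ R, u j = u' j) →
      (ω.ratio net k S R u y)⁻¹ = (ω.ratio net k S R u' y)⁻¹ := by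
    intro u u' y h
    rw [ratio, ratio, ω.cyl_congr net k _ y h,
      ω.cyl_congr net k R y fun j hj => h j (Finset.mem_union_right _ hj),
      Finset.prod_congr rfl fun j hj => (ω.gen net).congr j u u'
        (fun i hi => h i (hA j hj hi)) (h j (Finset.mem_union_left _ hj))]
  -- Multiplying the law of (U_{S ∪ R}, Y_k) by the inverse ratio gives, on its support, the measure
  -- p(u_R, y) ∏_{j ∈ S} p(u_j | u_{A_j}), which has total mass 1.
  have hinv : ∑ u, ∑ y, ω.law net u y * (ω.ratio net k S R u (y k))⁻¹ ≤ 1 := by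
    rw [ω.sum_law_mul net k (S ∪ R) u (fun u y => (ω.ratio net k S R u y)⁻¹) hrest]
    calc _ ≤ ∑ v with ∀ j ∉ S ∪ R, v j = u j, ∑ b,
          ω.cyl net k R v b * ∏ j ∈ S, (ω.gen net).val j v := by
          refine Finset.sum_le_sum fun v _ => Finset.sum_le_sum fun b _ => ?_
          have hnn : 0 ≤ ω.cyl net k R v b * ∏ j ∈ S, (ω.gen net).val j v :=
            mul_nonneg (ω.cyl_nonneg net _ _ _ _)
              (Finset.prod_nonneg fun _ _ => (ω.gen net).nonneg _ _)
          by_cases h0 : ω.cyl net k (S ∪ R) v b = 0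
          · rw [h0, zero_mul]; exact hnn
          · rw [ratio, inv_div, mul_div_cancel₀ _ h0]
      _ = ∑ v, (∑ b, ω.cyl net k R v b * if ∀ j ∉ S ∪ R, v j = u j then 1 else 0)
            * ∏ j ∈ S, (ω.gen net).val j v := by
          rw [Finset.sum_filter]
          refine Finset.sum_congr rfl fun v _ => ?_
          split_ifs <;> simp [Finset.sum_mul]
      _ = ∑ v, (∑ b, ω.cyl net k R v b * if ∀ j ∉ S ∪ R, v j = u j then 1 else 0)
            * if ∀ j ∈ S, v j = u j then 1 else 0 := by
          -- Over the coordinates in `S` the generation kernels have total mass 1, as does the point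
          -- mass at `u`; the other factors ignore these coordinates.
          refine sum_mul_congr_fiber (fun v : (∀ j, ω.U j) => S.piecewise u v) ?_ ?_
          · intro v v' hv
            have hv' : ∀ j ∉ S, v j = v' j := by
              intro j hj
              have := congrFun hv j
              simpa [hj] using this
            have h1 : (∀ j ∉ S ∪ R, v j = u j) ↔ ∀ j ∉ S ∪ R, v' j = u j :=
              forall₂_congr fun j hj => by
                rw [hv' j fun h => hj (Finset.mem_union_left _ h)]
            simp only [h1, ω.cyl_congr net k R _ fun j hj => hv' j (Finset.disjoint_right.1 hSR hj)]
          · intro v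
            have hfib : ∀ v' : (∀ j, ω.U j), S.piecewise u v' = S.piecewise u v
                ↔ ∀ j ∉ S, v' j = v j := by
              intro v'
              rw [funext_iff]
              refine forall_congr' fun j => ?_
              by_cases hj : j ∈ S <;> simp [hj]
            simp only [hfib]
            rw [sum_prod_kernel_fiber _ ω.A_lt]
            have := sum_agree S ∅ (by simp) v u (fun _ => 1) (fun _ _ _ _ => rfl)
            simp only [Finset.union_empty, mul_one, Finset.notMem_empty, false_implies,
              implies_true, if_true] at this
            refine this.symm.trans (Finset.sum_congr (by congr!) fun v' _ => ?_)
            exact if_congr (forall₂_congr fun j _ => eq_comm) rfl rfl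
      _ = ∑ v with ∀ j ∉ R, v j = u j, ∑ b, ω.cyl net k R v b * 1 := by
          rw [Finset.sum_filter]
          refine Finset.sum_congr rfl fun v _ => ?_
          by_cases h1 : ∀ j ∉ R, v j = u j
          · have h2 : ∀ j ∉ S ∪ R, v j = u j := fun j hj =>
              h1 j fun h => hj (Finset.mem_union_right _ h)
            have h3 : ∀ j ∈ S, v j = u j := fun j hj => h1 j (Finset.disjoint_left.1 hSR hj)
            simp only [if_pos h1, if_pos h2, if_pos h3, mul_one]
          · rw [if_neg h1]
            by_cases h3 : ∀ j ∈ S, v j = u j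
            · have h2 : ¬ ∀ j ∉ S ∪ R, v j = u j := fun h2 => h1 fun j hj => by
                by_cases hS : j ∈ S
                · exact h3 j hS
                · exact h2 j (by simp [hS, hj])
              simp only [if_neg h2, mul_zero, Finset.sum_const_zero, zero_mul]
            · rw [if_neg h3, mul_zero]
      _ = 1 := by
          rw [← ω.sum_law_mul net k R u (fun _ _ => 1) (fun _ _ _ _ => rfl)]
          simpa using hlaw
  have hlog2 : (0 : ℝ) < Real.log 2 := Real.log_pos (by norm_num)
  -- Equality case of log x ≥ 1 - 1/x: the gap is pointwise nonnegative and its mean is at most 0,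
  -- so it vanishes on the support, and the strict inequality for x ≠ 1 forces x = 1.
  have hnn : ∀ u y, 0 ≤ ω.law net u y *
      (Real.log (ω.ratio net k S R u (y k)) - (1 - (ω.ratio net k S R u (y k))⁻¹)) := by
    intro u y
    by_cases h : ω.law net u y = 0
    · rw [h, zero_mul]
    · refine mul_nonneg (ω.law_nonneg net _ _) ?_
      have := Real.one_sub_inv_le_log_of_pos (ω.ratio_pos net k S R h)
      linarith
  have hlogzero : ∑ u, ∑ y, ω.law net u y * Real.log (ω.ratio net k S R u (y k)) = 0 := by
    have : ∑ u, ∑ y, ω.law net u y * Real.logb 2 (ω.ratio net k S R u (y k))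
        = (∑ u, ∑ y, ω.law net u y * Real.log (ω.ratio net k S R u (y k))) / Real.log 2 := by
      rw [Finset.sum_div]
      refine Finset.sum_congr rfl fun u _ => ?_
      rw [Finset.sum_div]
      refine Finset.sum_congr rfl fun y _ => ?_
      rw [Real.logb, mul_div_assoc]
    rw [this, div_eq_zero_iff] at hzero
    exact hzero.resolve_right hlog2.ne'
  have hsum : ∑ u, ∑ y, ω.law net u y *
      (Real.log (ω.ratio net k S R u (y k)) - (1 - (ω.ratio net k S R u (y k))⁻¹)) ≤ 0 := by
    have : ∀ u y, ω.law net u y *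
      (Real.log (ω.ratio net k S R u (y k)) - (1 - (ω.ratio net k S R u (y k))⁻¹))
        = ω.law net u y * Real.log (ω.ratio net k S R u (y k)) - ω.law net u y
          + ω.law net u y * (ω.ratio net k S R u (y k))⁻¹ := by
      intro u y; ring
    simp only [this, Finset.sum_add_distrib, Finset.sum_sub_distrib, hlogzero, hlaw]
    linarith
  have hz := (Finset.sum_eq_zero_iff_of_nonneg fun u _ => Finset.sum_nonneg fun y _ =>
    hnn u y).1 (le_antisymm hsum (Finset.sum_nonneg fun u _ => Finset.sum_nonneg fun y _ =>
    hnn u y)) u (Finset.mem_univ _)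
  have hz := (Finset.sum_eq_zero_iff_of_nonneg fun y _ => hnn u y).1 hz y (Finset.mem_univ _)
  have hz := (mul_eq_zero.1 hz).resolve_left h
  have hpos := ω.ratio_pos net k S R h
  by_contra hne
  have hlt := Real.log_lt_sub_one_of_pos (inv_pos.2 hpos) (by simpa using hne)
  rw [Real.log_inv] at hlt
  linarith

end CodingParams

/-! ### Causality of the joint law and the conditional law of U_{W_k} given (U_{D_k}, Y_k). -/

namespace CodingParams

set_option linter.unusedSectionVars false

variable {N : ℕ} {X : Fin N → Type u} {Y : Fin N → Type v} (ω : CodingParams.{u, v, w} N X Y)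
variable [∀ k, Fintype (X k)] [∀ k, Fintype (Y k)] (net : ADMN N X Y)

/-- The factor of node `k` in the joint law. -/
def nodeFactor (k : Fin N) (c : (∀ j, ω.U j) × (∀ k, Y k)) : ℝ :=
  net.prob k c.2 (fun i => ω.symbol i c.1 (c.2 i)) * ω.covProb k c.1 (c.2 k)

theorem prob_symbol_congr {k : Fin N} {u u' : ∀ j, ω.U j} {y y' : ∀ k, Y k}
    (hu : ∀ i < k, ∀ j ∈ ω.D i ∪ ω.W i, u j = u' j) (hy : ∀ i ≤ k, y i = y' i) :
    net.prob k y (fun i => ω.symbol i u (y i)) = net.prob k y' fun i => ω.symbol i u' (y' i) :=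
  prob_congr net k hy fun i hi => by
    rw [hy i hi.le]
    exact ω.symbol_congr i u u' _ (hu i hi)

/-- Overwriting the symbols generated at node `k`. -/
def overwrite (u₀ : ∀ j, ω.U j) (y₀ : ∀ k, Y k) (k : Fin N) (c : (∀ j, ω.U j) × (∀ k, Y k)) :
    (∀ j, ω.U j) × (∀ k, Y k) :=
  ((ω.W k).piecewise u₀ c.1, Function.update c.2 k (y₀ k))

theorem overwrite_fst {u₀ : ∀ j, ω.U j} {y₀ : ∀ k, Y k} {k l : Fin N} (h : l < k)
    (c : (∀ j, ω.U j) × (∀ k, Y k)) :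
    ∀ j ∈ ω.D l ∪ ω.W l, (ω.overwrite u₀ y₀ k c).1 j = c.1 j := by
  intro j hj
  refine (ω.W k).piecewise_eq_of_notMem _ _ ?_
  rcases Finset.mem_union.1 hj with hj | hj
  · exact Finset.disjoint_left.1 (ω.disjoint_D_W h.le) hj
  · exact Finset.disjoint_left.1 (OneShot.pairwise_disjoint_W h.ne) hj

theorem overwrite_snd {u₀ : ∀ j, ω.U j} {y₀ : ∀ k, Y k} {k l : Fin N} (h : l ≠ k)
    (c : (∀ j, ω.U j) × (∀ k, Y k)) : (ω.overwrite u₀ y₀ k c).2 l = c.2 l :=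
  Function.update_of_ne h _ _

theorem overwrite_eq_self_iff {u₀ : ∀ j, ω.U j} {y₀ : ∀ k, Y k} {k : Fin N}
    (c : (∀ j, ω.U j) × (∀ k, Y k)) :
    ω.overwrite u₀ y₀ k c = c ↔ (∀ j ∈ ω.W k, u₀ j = c.1 j) ∧ y₀ k = c.2 k := by
  rw [overwrite, Prod.ext_iff, Function.update_eq_self_iff, funext_iff]
  refine and_congr_left' (forall_congr' fun j => ?_)
  by_cases hj : j ∈ ω.W k <;> simp [hj]

theorem nodeFactor_overwrite {u₀ : ∀ j, ω.U j} {y₀ : ∀ k, Y k} {k l : Fin N} (h : l < k)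
    (c : (∀ j, ω.U j) × (∀ k, Y k)) :
    ω.nodeFactor net l (ω.overwrite u₀ y₀ k c) = ω.nodeFactor net l c := by
  rw [nodeFactor, nodeFactor, ω.overwrite_snd h.ne,
    ω.covProb_congr l _ _ _ (ω.overwrite_fst h c),
    ω.prob_symbol_congr net (fun i hi => ω.overwrite_fst (hi.trans h) c)
      fun i hi => ω.overwrite_snd (hi.trans_lt h).ne c]

open Classical in
-- Summing over U_{W_k} first removes the compression kernel, because the channel at node k sees
-- only symbols of earlier nodes; summing over y_k then removes the channel.
theorem sum_nodeFactor (u₀ : ∀ j, ω.U j) (y₀ : ∀ k, Y k) (k : Fin N)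
    (c : (∀ j, ω.U j) × (∀ k, Y k)) :
    ∑ c' with ω.overwrite u₀ y₀ k c' = ω.overwrite u₀ y₀ k c, ω.nodeFactor net k c' = 1 := by
  have hiff : ∀ c' : (∀ j, ω.U j) × (∀ k, Y k),
      ω.overwrite u₀ y₀ k c' = ω.overwrite u₀ y₀ k c ↔
        (∀ j ∉ ω.W k, c'.1 j = c.1 j) ∧
          Function.update c'.2 k (y₀ k) = Function.update c.2 k (y₀ k) := by
    intro c'
    rw [overwrite, overwrite, Prod.ext_iff, funext_iff]
    refine and_congr_left' (forall_congr' fun j => ?_)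
    by_cases hj : j ∈ ω.W k <;> simp [hj]
  simp only [hiff]
  have hprod : (Finset.univ.filter fun c' : (∀ j, ω.U j) × (∀ k, Y k) =>
      (∀ j ∉ ω.W k, c'.1 j = c.1 j) ∧
        Function.update c'.2 k (y₀ k) = Function.update c.2 k (y₀ k))
      = (Finset.univ.filter fun u' : (∀ j, ω.U j) => ∀ j ∉ ω.W k, u' j = c.1 j) ×ˢ
        (Finset.univ.filter fun y' : (∀ k, Y k) =>
          Function.update y' k (y₀ k) = Function.update c.2 k (y₀ k)) := by
    ext c'
    simp
  rw [hprod, Finset.sum_product_right]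
  have h1 : ∀ y' : (∀ k, Y k), ∑ u' with ∀ j ∉ ω.W k, u' j = c.1 j, ω.nodeFactor net k (u', y')
      = net.prob k y' fun i => ω.symbol i c.1 (y' i) := by
    intro y'
    rw [← mul_one (net.prob k y' fun i => ω.symbol i c.1 (y' i)), ← ω.sum_covProb k c.1 (y' k),
      Finset.mul_sum]
    refine Finset.sum_congr (by congr!) fun u' hu' => ?_
    rw [nodeFactor]
    congr 1
    refine ω.prob_symbol_congr net (fun i hi j hj => (Finset.mem_filter.1 hu').2 j ?_)
      fun _ _ => rfl
    rcases Finset.mem_union.1 hj with hj | hj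
    · exact Finset.disjoint_left.1 (ω.disjoint_D_W hi.le) hj
    · exact Finset.disjoint_left.1 (OneShot.pairwise_disjoint_W hi.ne) hj
  simp only [h1]
  refine ((sum_update_fiber c.2 y₀ k fun y' => net.prob k y' fun i =>
    ω.symbol i c.1 (y' i))).trans ?_
  rw [← sum_prob_update net k c.2 fun i => ω.symbol i c.1 (c.2 i)]
  refine Finset.sum_congr rfl fun b _ => prob_congr net k (fun _ _ => rfl) fun i hi => ?_
  rw [Function.update_of_ne hi.ne]

open Classical in
/-- The symbols `U_{W_k}` are generated from `(U_{D_k}, Y_k)` by the compression kernel. -/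
theorem cyl_union_W (k : Fin N) (u : ∀ j, ω.U j) (y : Y k) :
    ω.cyl net k (ω.W k ∪ ω.D k) u y = ω.cyl net k (ω.D k) u y * ω.covProb k u y := by
  rcases isEmpty_or_nonempty (∀ k, Y k) with hY | ⟨⟨y₀⟩⟩
  · simp [cyl]
  set C : ℝ := ∏ j ∈ Finset.univ \ Finset.univ.biUnion ω.W, ((Fintype.card (ω.U j) : ℝ))⁻¹ with hC
  set ind : (∀ j, ω.U j) × (∀ k, Y k) → ℝ := fun c =>
    if (∀ j ∈ ω.D k, c.1 j = u j) ∧ c.2 k = y then 1 else 0 with hind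
  -- Nodes after k generate nothing that the cylinder events depend on, so they are eliminated.
  set K : Finset (Fin N) := Finset.Iic k with hK
  have hind_over : ∀ a ∉ K, ∀ c, ind (ω.overwrite u y₀ a c) = ind c := by
    intro a ha c
    have ha : k < a := by simpa [hK] using ha
    simp only [hind]
    refine if_congr (and_congr (forall₂_congr fun j hj => ?_) ?_) rfl rfl
    · rw [ω.overwrite_fst ha c j (Finset.mem_union_left _ hj)]
    · rw [ω.overwrite_snd ha.ne]
  have elim : ∀ h : (∀ j, ω.U j) × (∀ k, Y k) → ℝ,
      (∀ a ∉ K, ∀ c, h (ω.overwrite u y₀ a c) = h c) →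
      ∑ c, h c * ∏ i, ω.nodeFactor net i c = ∑ c, h c * ((∏ i ∈ K, ω.nodeFactor net i c) *
        ∏ i ∈ Kᶜ, if ω.overwrite u y₀ i c = c then 1 else 0) := by
    intro h hh
    have hsum : ∀ i c, _ = _ := ω.sum_nodeFactor net u y₀
    convert sum_prod_elim (ω.overwrite u y₀) (fun i => (i : ℕ)) (ω.nodeFactor net) ?_ ?_
      ?_ ?_ K ?_ h hh
    · intro i c
      rw [overwrite_eq_self_iff]
      refine ⟨fun j hj => ?_, ?_⟩ <;> simp [overwrite, *]
    · intro a b hab c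
      rw [overwrite_eq_self_iff, overwrite_eq_self_iff]
      refine and_congr (forall₂_congr fun j hj => ?_) ?_
      · have : j ∉ ω.W b := Finset.disjoint_left.1 (OneShot.pairwise_disjoint_W hab) hj
        simp [overwrite, this]
      · rw [ω.overwrite_snd hab]
    · intro i c
      rw [← hsum i c]
      congr!
    · intro a b hab hle c
      exact ω.nodeFactor_overwrite net (lt_of_le_of_ne hle hab.symm) c
    · intro b hb a ha c
      have ha : k < a := by simpa [hK] using ha
      have hb : b ≤ k := by simpa [hK] using hb
      exact ω.nodeFactor_overwrite net (hb.trans_lt ha) c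
  have hKsplit : ∀ c, ∏ i ∈ K, ω.nodeFactor net i c
      = (∏ i ∈ Finset.Iio k, ω.nodeFactor net i c) * ω.nodeFactor net k c := by
    intro c
    rw [hK, ← Finset.Iio_insert, Finset.prod_insert (by simp), mul_comm]
  have hlaw : ∀ c : (∀ j, ω.U j) × (∀ k, Y k),
      ω.law net c.1 c.2 = (∏ i, ω.nodeFactor net i c) * C := fun c => ω.law_eq net c.1 c.2
  have lhs : ω.cyl net k (ω.W k ∪ ω.D k) u y
      = ∑ c, (C * ind c * if ∀ j ∈ ω.W k, c.1 j = u j then 1 else 0)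
          * ∏ i, ω.nodeFactor net i c := by
    rw [cyl, ← Fintype.sum_prod_type']
    refine Finset.sum_congr rfl fun c _ => ?_
    rw [hlaw c]
    have : ((∀ j ∈ ω.W k ∪ ω.D k, c.1 j = u j) ∧ c.2 k = y) ↔
        ((∀ j ∈ ω.D k, c.1 j = u j) ∧ c.2 k = y) ∧ ∀ j ∈ ω.W k, c.1 j = u j := by
      rw [Finset.forall_mem_union]; tauto
    rw [if_congr this rfl rfl, ite_and]
    simp only [hind]
    split_ifs <;> ring
  have rhs : ω.cyl net k (ω.D k) u y * ω.covProb k u y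
      = ∑ c, (C * ind c * ω.covProb k u y) * ∏ i, ω.nodeFactor net i c := by
    rw [cyl, ← Fintype.sum_prod_type', Finset.sum_mul]
    refine Finset.sum_congr rfl fun c _ => ?_
    rw [hlaw c]
    simp only [hind]
    ring
  rw [lhs, rhs, elim, elim]
  · set H : (∀ j, ω.U j) × (∀ k, Y k) → ℝ := fun c => C * ((∏ i ∈ Finset.Iio k, ω.nodeFactor net i c)
      * net.prob k c.2 fun i => ω.symbol i c.1 (c.2 i)) *
        ∏ i ∈ Kᶜ, if ω.overwrite u y₀ i c = c then 1 else 0 with hH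
    have := sum_mul_congr_fiber (fun c : (∀ j, ω.U j) × (∀ k, Y k) =>
        ((ω.W k).piecewise u c.1, c.2)) (h := H)
      (g := fun c => ind c * ω.covProb k c.1 (c.2 k) * if ∀ j ∈ ω.W k, c.1 j = u j then 1 else 0)
      (κ := fun c => ind c * ω.covProb k c.1 (c.2 k) * ω.covProb k u y) ?_ ?_
    · have e : ∀ c z, C * ind c * z * ((∏ i ∈ K, ω.nodeFactor net i c) *
          ∏ i ∈ Kᶜ, if ω.overwrite u y₀ i c = c then 1 else 0)
          = H c * (ind c * ω.covProb k c.1 (c.2 k) * z) := by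
        intro c z
        rw [hKsplit, hH, nodeFactor]
        ring
      simp only [e]
      exact this
    · rintro ⟨u₁, y₁⟩ ⟨u₂, y₂⟩ hc
      simp only [Prod.mk.injEq] at hc
      obtain ⟨hu, rfl⟩ := hc
      have hu' : ∀ j ∉ ω.W k, u₁ j = u₂ j := by
        intro j hj
        have := congrFun hu j
        simpa [hj] using this
      have hlow : ∀ i < k, ∀ j ∈ ω.D i ∪ ω.W i, u₁ j = u₂ j := by
        intro i hi j hj
        refine hu' j ?_
        rcases Finset.mem_union.1 hj with hj | hj
        · exact Finset.disjoint_left.1 (ω.disjoint_D_W hi.le) hj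
        · exact Finset.disjoint_left.1 (OneShot.pairwise_disjoint_W hi.ne) hj
      simp only [hH]
      congr 1
      · congr 1
        congr 1
        · refine Finset.prod_congr rfl fun i hi => ?_
          have hi := Finset.mem_Iio.1 hi
          rw [nodeFactor, nodeFactor, ω.covProb_congr i _ _ _ (hlow i hi),
            ω.prob_symbol_congr net (fun l hl => hlow l (hl.trans hi)) fun _ _ => rfl]
        · exact ω.prob_symbol_congr net hlow fun _ _ => rfl
      · refine Finset.prod_congr rfl fun i hi => if_congr ?_ rfl rfl
        have hi : k ≠ i := by
          rintro rfl
          simp [hK] at hi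
        rw [overwrite_eq_self_iff, overwrite_eq_self_iff]
        refine and_congr_left' (forall₂_congr fun j hj => ?_)
        simp only [hu' j (Finset.disjoint_right.1 (OneShot.pairwise_disjoint_W hi) hj)]
    · rintro ⟨u₁, y₁⟩
      have hsplit : ∀ F : (∀ j, ω.U j) × (∀ k, Y k) → ℝ,
          ∑ c' with ((ω.W k).piecewise u c'.1, c'.2) = ((ω.W k).piecewise u u₁, y₁), F c'
            = ∑ u' with ∀ j ∉ ω.W k, u' j = u₁ j, F (u', y₁) := by
        intro F
        refine Finset.sum_nbij' (fun c => c.1) (fun u' => (u', y₁)) ?_ ?_ ?_ ?_ ?_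
        · intro c hc
          simp only [Finset.mem_filter, Finset.mem_univ, true_and, Prod.mk.injEq] at hc ⊢
          intro j hj
          have := congrFun hc.1 j
          simpa [hj] using this
        · intro u' hu'
          simp only [Finset.mem_filter, Finset.mem_univ, true_and, Prod.mk.injEq, and_true] at hu' ⊢
          ext j
          by_cases hj : j ∈ ω.W k
          · simp [hj]
          · simp [hj, hu' j hj]
        · intro c hc
          simp only [Finset.mem_filter, Finset.mem_univ, true_and, Prod.mk.injEq] at hc
          rw [← hc.2]
        · intro _ _; rfl
        · intro c hc
          simp only [Finset.mem_filter, Finset.mem_univ, true_and, Prod.mk.injEq] at hc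
          rw [← hc.2]
      have hD : ∀ u' : (∀ j, ω.U j), (∀ j ∉ ω.W k, u' j = u₁ j) → ∀ j ∈ ω.D k, u' j = u₁ j :=
        fun u' h j hj => h j (Finset.disjoint_left.1 (ω.disjoint_D_W le_rfl) hj)
      -- On such a fibre the left sum picks the value of the compression kernel at `u`; the right
      -- sum multiplies that value by the kernel's total mass 1.
      suffices hs : ∑ u' with ∀ j ∉ ω.W k, u' j = u₁ j, ind (u', y₁) * ω.covProb k u' (y₁ k) *
          (if ∀ j ∈ ω.W k, u' j = u j then 1 else 0)
          = ∑ u' with ∀ j ∉ ω.W k, u' j = u₁ j,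
            ind (u', y₁) * ω.covProb k u' (y₁ k) * ω.covProb k u y by
        have := (hsplit fun c => ind c * ω.covProb k c.1 (c.2 k) *
          if ∀ j ∈ ω.W k, c.1 j = u j then 1 else 0).trans (hs.trans (hsplit fun c =>
            ind c * ω.covProb k c.1 (c.2 k) * ω.covProb k u y).symm)
        convert this
      have hindc : ∀ u' : (∀ j, ω.U j), (∀ j ∉ ω.W k, u' j = u₁ j) →
          ind (u', y₁) = ind (u₁, y₁) := by
        intro u' h
        simp only [hind]
        refine if_congr (and_congr_left' (forall₂_congr fun j hj => ?_)) rfl rfl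
        rw [hD u' h j hj]
      by_cases hI : (∀ j ∈ ω.D k, u₁ j = u j) ∧ y₁ k = y
      · obtain ⟨hI1, rfl⟩ := hI
        have hone : ind (u₁, y₁) = 1 := if_pos ⟨hI1, rfl⟩
        have h1 := sum_agree (ω.W k) (ω.D k) (ω.disjoint_D_W le_rfl).symm u₁ u
          (fun v => ω.covProb k v (y₁ k)) fun v v' h _ => ω.covProb_congr k v v' _ fun j hj =>
            h j (by rwa [Finset.union_comm])
        rw [if_pos fun j hj => (hI1 j hj).symm, one_mul] at h1
        have h1' : ∑ v with ∀ j ∉ ω.W k, v j = u₁ j,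
            (if ∀ j ∈ ω.W k ∪ ω.D k, u j = v j then 1 else 0) * ω.covProb k v (y₁ k)
              = ω.covProb k u (y₁ k) := by
          rw [← h1]; congr!
        have h2 := ω.sum_covProb k u₁ (y₁ k)
        have hl : ∑ u' with ∀ j ∉ ω.W k, u' j = u₁ j, ind (u', y₁) * ω.covProb k u' (y₁ k) *
            (if ∀ j ∈ ω.W k, u' j = u j then 1 else 0) = ω.covProb k u (y₁ k) := by
          refine (Finset.sum_congr rfl fun u' hu' => ?_).trans h1'
          have hu' := (Finset.mem_filter.1 hu').2
          rw [hindc u' hu', hone, one_mul, mul_comm]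
          refine congrArg (· * ω.covProb k u' (y₁ k)) (if_congr ?_ rfl rfl)
          rw [Finset.forall_mem_union]
          refine ⟨fun h => ⟨fun j hj => (h j hj).symm, fun j hj => ?_⟩,
            fun h j hj => (h.1 j hj).symm⟩
          rw [hD u' hu' j hj, hI1 j hj]
        have hr : ∑ u' with ∀ j ∉ ω.W k, u' j = u₁ j,
            ind (u', y₁) * ω.covProb k u' (y₁ k) * ω.covProb k u (y₁ k)
              = ω.covProb k u (y₁ k) := by
          rw [← Finset.sum_mul]
          refine (congrArg (· * ω.covProb k u (y₁ k)) ((Finset.sum_congr rfl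
            fun u' hu' => ?_).trans h2)).trans (one_mul _)
          rw [hindc u' (Finset.mem_filter.1 hu').2, hone, one_mul]
        exact hl.trans hr.symm
      · have hzero : ind (u₁, y₁) = 0 := by simp only [hind]; rw [if_neg hI]
        have hz : ∀ G : (∀ j, ω.U j) → ℝ, ∑ u' with ∀ j ∉ ω.W k, u' j = u₁ j,
            ind (u', y₁) * G u' = 0 := fun G => Finset.sum_eq_zero fun u' hu' => by
          rw [hindc u' (Finset.mem_filter.1 hu').2, hzero, zero_mul]
        simp only [mul_assoc]
        rw [hz, hz]
  · intro a ha c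
    rw [hind_over a ha]
  · intro a ha c
    rw [hind_over a ha]
    have ha : k < a := by simpa [hK] using ha
    congr 1
    refine if_congr (forall₂_congr fun j hj => ?_) rfl rfl
    rw [ω.overwrite_fst ha c j (Finset.mem_union_right _ hj)]

end CodingParams

/-! ### Memoryless blocks as one-shot problems. -/

/-- The `t`-th letters of a family of sequences. -/
def slice {ι T : Type*} {α : ι → Type*} (u : ∀ i, T → α i) (t : T) (i : ι) : α i := u i t

open Classical in
theorem sum_prod_slice {ι T : Type*} [Fintype ι] [Fintype T] [DecidableEq T] [DecidableEq ι]
    {α : ι → Type*}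
    [∀ i, Fintype (α i)] (F : Finset ι) (u : ∀ i, T → α i) (φ : T → (∀ i, α i) → ℝ) :
    ∑ u' with ∀ i ∉ F, u' i = u i, ∏ t, φ t (slice u' t)
      = ∏ t, ∑ v with ∀ i ∉ F, v i = u i t, φ t v := by
  rw [Finset.prod_univ_sum]
  refine Finset.sum_nbij' (fun u' t i => u' i t) (fun p i t => p t i) ?_ ?_ ?_ ?_ ?_
  · intro u' hu'
    simp only [Finset.mem_filter, Finset.mem_univ, true_and, Fintype.mem_piFinset] at hu' ⊢
    exact fun t i hi => congrFun (hu' i hi) t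
  · intro p hp
    simp only [Finset.mem_filter, Finset.mem_univ, true_and, Fintype.mem_piFinset] at hp ⊢
    exact fun i hi => funext fun t => hp t i hi
  · intro _ _; rfl
  · intro _ _; rfl
  · intro _ _; rfl

namespace CodingParams

set_option linter.unusedSectionVars false

variable {N : ℕ} {X : Fin N → Type u} {Y : Fin N → Type v} (ω : CodingParams.{u, v, w} N X Y)
variable [∀ k, Fintype (X k)] [∀ k, Fintype (Y k)] (net : ADMN N X Y)

theorem subset_biUnion_W (k : Fin N) : ω.W k ⊆ Finset.univ.biUnion ω.W :=
  Finset.subset_biUnion_of_mem ω.W (Finset.mem_univ k)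

theorem D_union_B_subset (k : Fin N) : ω.D k ∪ ω.B k ⊆ Finset.univ.biUnion ω.W :=
  (Finset.union_subset (ω.D_subset k) ((ω.B_subset k).trans Finset.sdiff_subset)).trans
    (Finset.biUnion_subset_biUnion_of_subset_left _ (Finset.subset_univ _))

theorem coverSet_subset (k : Fin N) (T : Finset (Fin ω.μ)) : ω.coverSet k T ⊆ ω.W k :=
  Finset.filter_subset _ _

theorem packSet_subset (k : Fin N) (S : Finset (Fin ω.μ)) : ω.packSet k S ⊆ ω.D k ∪ ω.B k :=
  Finset.filter_subset _ _

/-- A codebook below `j` in the superposition order has its indices inside `Γ j`, so if it lies in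
`W k` it lies in the same cover set. The inclusion is what the chain rule requires for its
conditioning to be redundant. -/
theorem A_subset_of_mem_coverSet {k : Fin N} {T : Finset (Fin ω.μ)} {j : Fin ω.ν}
    (hj : j ∈ ω.coverSet k T) :
    ω.A j ⊆ (ω.coverSet k T).filter (· < j) ∪ ω.D k := by
  intro i hi
  obtain ⟨hjW, hjΓ⟩ := Finset.mem_filter.1 hj
  rcases Finset.mem_union.1 (ω.A_W k (Finset.mem_biUnion.2 ⟨j, hjW, hi⟩)) with h | h
  · exact Finset.mem_union_left _ (Finset.mem_filter.2 ⟨Finset.mem_filter.2 ⟨h,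
      (OneShot.superposition_subset j i hi).trans hjΓ⟩, ω.A_lt j i hi⟩)
  · exact Finset.mem_union_right _ h

theorem A_subset_of_mem_packSet {k : Fin N} {S : Finset (Fin ω.μ)} {j : Fin ω.ν}
    (hj : j ∈ ω.packSet k S) :
    ω.A j ⊆ (ω.packSet k S).filter (· < j) ∪ ((ω.D k ∪ ω.B k) \ ω.packSet k S) := by
  intro i hi
  have hi' : i ∈ ω.D k ∪ ω.B k := by
    rcases Finset.mem_union.1 (ω.packSet_subset k S hj) with h | h
    · exact Finset.mem_union_left _ (ω.A_D k (Finset.mem_biUnion.2 ⟨j, h, hi⟩))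
    · exact ω.A_B k (Finset.mem_biUnion.2 ⟨j, h, hi⟩)
  by_cases h : i ∈ ω.packSet k S
  · exact Finset.mem_union_left _ (Finset.mem_filter.2 ⟨h, ω.A_lt j i hi⟩)
  · exact Finset.mem_union_right _ (Finset.mem_sdiff.2 ⟨hi', h⟩)

theorem packInfo_eq (k : Fin N) (S : Finset (Fin ω.μ)) :
    ω.packInfo net k S = ∑ u, ∑ y, ω.law net u y * Real.logb 2
      (ω.ratio net k (ω.packSet k S) ((ω.D k ∪ ω.B k) \ ω.packSet k S) u (y k)) :=
  ω.sum_info_eq net k _ _ ((ω.packSet_subset k S).trans (ω.D_union_B_subset k))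
    fun _ hj => ω.A_subset_of_mem_packSet hj

theorem coverInfo_eq (k : Fin N) (T : Finset (Fin ω.μ)) :
    ω.coverInfo net k T = ∑ u, ∑ y, ω.law net u y * Real.logb 2
      (ω.ratio net k (ω.coverSet k T) (ω.D k) u (y k)) :=
  ω.sum_info_eq net k _ _ ((ω.coverSet_subset k T).trans (ω.subset_biUnion_W k))
    fun _ hj => ω.A_subset_of_mem_coverSet hj

open Classical in
-- By `cyl_union_W` the compression kernel is a quotient of cylinder probabilities. The kernels of
-- the redrawn codebooks cancel against the denominator of the weight, and summing over those words
-- marginalizes the numerator to `coverSet k T ∪ D k`. It is an inequality because words of zero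
-- generation probability may be lost.
theorem sum_cover_le_ratio (k : Fin N) (T : Finset (Fin ω.μ)) {u : ∀ j, ω.U j} {y : ∀ k, Y k}
    (h : ω.law net u y ≠ 0) :
    ∑ v with ∀ j ∉ ω.W k \ ω.coverSet k T, v j = u j,
      (∏ j ∈ ω.W k \ ω.coverSet k T, (ω.gen net).val j v)
        * (ω.covProb k v (y k) / ∏ j ∈ ω.W k, (ω.gen net).val j v)
      ≤ ω.ratio net k (ω.coverSet k T) (ω.D k) u (y k) := by
  set C := ω.coverSet k T with hC
  -- Parents of the retained codebooks are themselves retained or lie in `D k`, so redrawing leaves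
  -- these kernels unchanged.
  have hgen : ∀ v : (∀ j, ω.U j), (∀ j ∉ ω.W k \ C, v j = u j) →
      ∏ j ∈ C, (ω.gen net).val j v = ∏ j ∈ C, (ω.gen net).val j u := by
    intro v hv
    refine Finset.prod_congr rfl fun j hj => (ω.gen net).congr j v u (fun i hi => hv i ?_)
      (hv j fun h => (Finset.mem_sdiff.1 h).2 hj)
    rintro hiW
    obtain ⟨hiW, hiC⟩ := Finset.mem_sdiff.1 hiW
    rcases Finset.mem_union.1 (ω.A_subset_of_mem_coverSet hj hi) with h | h
    · exact hiC (Finset.mem_filter.1 h).1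
    · exact Finset.disjoint_left.1 (ω.disjoint_D_W le_rfl) h hiW
  have hterm : ∀ v ∈ Finset.univ.filter fun v : (∀ j, ω.U j) => ∀ j ∉ ω.W k \ C, v j = u j,
      (∏ j ∈ ω.W k \ C, (ω.gen net).val j v)
        * (ω.covProb k v (y k) / ∏ j ∈ ω.W k, (ω.gen net).val j v)
      ≤ ω.cyl net k (ω.W k ∪ ω.D k) v (y k) /
        (ω.cyl net k (ω.D k) u (y k) * ∏ j ∈ C, (ω.gen net).val j u) := by
    intro v hv
    have hv := (Finset.mem_filter.1 hv).2
    rw [ω.cyl_union_W, ω.cyl_congr net k (ω.D k) (u := v) (v := u) (y k) fun j hj => hv j fun h =>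
      Finset.disjoint_left.1 (ω.disjoint_D_W le_rfl) hj (Finset.mem_sdiff.1 h).1,
      mul_div_mul_left _ _ (ω.cyl_pos net k _ h).ne', ← hgen v hv,
      ← Finset.prod_sdiff (ω.coverSet_subset k T)]
    by_cases h0 : ∏ j ∈ ω.W k \ C, (ω.gen net).val j v = 0
    · rw [h0, zero_mul]
      exact div_nonneg (ω.covProb_nonneg _ _ _)
        (Finset.prod_nonneg fun _ _ => (ω.gen net).nonneg _ _)
    · rw [← mul_div_assoc, mul_div_mul_left _ _ h0]
  refine (Finset.sum_le_sum hterm).trans (le_of_eq ?_)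
  have hdisj : Disjoint (ω.W k \ C) (C ∪ ω.D k) := by
    rw [Finset.disjoint_union_right]
    exact ⟨Finset.sdiff_disjoint, Finset.disjoint_of_subset_left Finset.sdiff_subset
      (ω.disjoint_D_W le_rfl).symm⟩
  have hun : ω.W k \ C ∪ (C ∪ ω.D k) = ω.W k ∪ ω.D k := by
    rw [← Finset.union_assoc, Finset.sdiff_union_of_subset (ω.coverSet_subset k T)]
  rw [← Finset.sum_div, ratio, ← ω.sum_cyl net k (ω.W k \ C) (C ∪ ω.D k) hdisj, hun]

/-- Memoryless extension of the superposition kernel. -/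
def blockGen (n : ℕ) : SuperpositionKernel ω.A fun j => Fin n → ω.U j where
  val j u := ∏ t, (ω.gen net).val j (slice u t)
  nonneg j u := Finset.prod_nonneg fun _ _ => (ω.gen net).nonneg _ _
  sum_update j u := by
    have : ∀ (a : Fin n → ω.U j) t, slice (Function.update u j a) t
        = Function.update (slice u t) j (a t) := by
      intro a t
      ext i
      by_cases hi : i = j
      · subst hi; simp [slice]
      · simp [slice, hi]
    simp only [this]
    rw [sum_pi_prod fun t a => (ω.gen net).val j (Function.update (slice u t) j a)]
    exact Finset.prod_eq_one fun t _ => (ω.gen net).sum_update j _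
  congr j u u' h h' := Finset.prod_congr rfl fun t _ =>
    (ω.gen net).congr j _ _ (fun i hi => congrFun (h i hi) t) (congrFun h' t)

/-- The admissible error patterns of the decoder at node `k`. -/
def ErrorPattern (k : Fin N) (S : Finset (Fin ω.μ)) : Prop :=
  S ⊆ ω.barD k ∪ ω.barB k ∧ (S ∩ ω.barD k).Nonempty

theorem law_ne_zero {u : ∀ j, ω.U j} {y : ∀ k, Y k}
    (h : ∀ k, net.prob k y (fun i => ω.symbol i u (y i)) * ω.covProb k u (y k) ≠ 0) :
    ω.law net u y ≠ 0 := by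
  have : ∀ j, Nonempty (ω.U j) := fun j => ⟨u j⟩
  rw [law_eq]
  exact mul_ne_zero (Finset.prod_ne_zero_iff.2 fun k _ => h k)
    (Finset.prod_ne_zero_iff.2 fun j _ => inv_ne_zero (Nat.cast_ne_zero.2 Fintype.card_ne_zero))

/-- The one-shot problem for blocks of length `n`, with decoding thresholds `τ`. -/
def block (n : ℕ) (τ : Fin N → Finset (Fin ω.μ) → ℝ) :
    OneShot ω (fun j => Fin n → ω.U j) (fun k => Fin n → X k) (fun k => Fin n → Y k) where
  gen := ω.blockGen net n
  cov k u y := ∏ t, ω.covProb k (slice u t) (y t)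
  cov_nonneg k u y := Finset.prod_nonneg fun _ _ => ω.covProb_nonneg _ _ _
  cov_congr k u u' y h := Finset.prod_congr rfl fun t _ => ω.covProb_congr k _ _ _ fun j hj =>
    congrFun (h j hj) t
  sym k u y t := ω.symbol k (slice u t) (y t)
  sym_congr k u u' y h := funext fun t => ω.symbol_congr k _ _ _ fun j hj => congrFun (h j hj) t
  ch k y x := ∏ t, net.prob k (slice y t) (slice x t)
  ch_nonneg k y x := Finset.prod_nonneg fun _ _ => prob_nonneg _ _ _ _
  test k u y := 0 < ∏ t, ω.cyl net k (ω.D k ∪ ω.B k) (slice u t) (y t) ∧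
    ∀ S, ω.ErrorPattern k S → τ k S ≤ ∏ t, ω.ratio net k (ω.packSet k S)
      ((ω.D k ∪ ω.B k) \ ω.packSet k S) (slice u t) (y t)
  test_congr k u u' y h := by
    have hcyl : ∀ Q ⊆ ω.D k ∪ ω.B k, ∀ t,
        ω.cyl net k Q (slice u t) (y t) = ω.cyl net k Q (slice u' t) (y t) := fun Q hQ t =>
      ω.cyl_congr net k Q _ fun j hj => congrFun (h j (hQ hj)) t
    have hratio : ∀ S t, ω.ratio net k (ω.packSet k S)
        ((ω.D k ∪ ω.B k) \ ω.packSet k S) (slice u t) (y t) = ω.ratio net k (ω.packSet k S)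
        ((ω.D k ∪ ω.B k) \ ω.packSet k S) (slice u' t) (y t) := by
      intro S t
      have hgen : ∀ j ∈ ω.packSet k S, (ω.gen net).val j (slice u t)
          = (ω.gen net).val j (slice u' t) := by
        intro j hj
        refine (ω.gen net).congr j _ _ (fun i hi => congrFun (h i ?_) t)
          (congrFun (h j (ω.packSet_subset k S hj)) t)
        rcases Finset.mem_union.1 (ω.A_subset_of_mem_packSet hj hi) with h | h
        · exact ω.packSet_subset k S (Finset.mem_filter.1 h).1
        · exact (Finset.mem_sdiff.1 h).1
      rw [ratio, ratio, hcyl _ (Finset.union_subset (ω.packSet_subset k S) Finset.sdiff_subset),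
        hcyl _ Finset.sdiff_subset, Finset.prod_congr rfl hgen]
    rintro ⟨h1, h2⟩
    refine ⟨?_, fun S hS => ?_⟩
    · simpa only [hcyl _ subset_rfl] using h1
    · simpa only [hratio] using h2 S hS
  support u y h j := by
    change ∏ t, (ω.gen net).val j (slice u t) ≠ 0
    refine Finset.prod_ne_zero_iff.2 fun t _ => ?_
    refine (ω.gen_pos net (u := slice u t) (y := slice y t) (ω.law_ne_zero net fun k => ?_) j).ne'
    have hk : (∏ t, net.prob k (slice y t)
        (slice (fun i t => ω.symbol i (slice u t) (y i t)) t))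
        * ∏ t, ω.covProb k (slice u t) (y k t) ≠ 0 :=
      (Finset.prod_ne_zero_iff (M₀ := ℝ)).1 h k (Finset.mem_univ k)
    exact mul_ne_zero
      ((Finset.prod_ne_zero_iff (M₀ := ℝ)).1 (left_ne_zero_of_mul hk) t (Finset.mem_univ t))
      ((Finset.prod_ne_zero_iff (M₀ := ℝ)).1 (right_ne_zero_of_mul hk) t (Finset.mem_univ t))

theorem block_law (n : ℕ) (τ : Fin N → Finset (Fin ω.μ) → ℝ) (u : ∀ j, Fin n → ω.U j)
    (y : ∀ k, Fin n → Y k) :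
    (ω.block net n τ).law u y = ∏ t, ω.law net (slice u t) (slice y t) := by
  simp only [law_eq, OneShot.law, block, blockGen]
  rw [Finset.prod_mul_distrib, Finset.prod_mul_distrib]
  congr 1
  · rw [Finset.prod_comm, Finset.prod_comm (s := Finset.univ (α := Fin N)),
      ← Finset.prod_mul_distrib]
    refine Finset.prod_congr rfl fun t _ => ?_
    rw [Finset.prod_mul_distrib]
    rfl
  · rw [Finset.prod_comm]
    refine Finset.prod_congr rfl fun t _ => Finset.prod_congr rfl fun j hj => ?_
    exact ω.gen_eq_of_notMem net _ (Finset.mem_sdiff.1 hj).2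

open Classical in
theorem block_cover_le (n : ℕ) (τ : Fin N → Finset (Fin ω.μ) → ℝ) (k : Fin N)
    (T : Finset (Fin ω.μ)) {u : ∀ j, Fin n → ω.U j} {y : ∀ k, Fin n → Y k}
    (h : ∀ t, ω.law net (slice u t) (slice y t) ≠ 0) :
    ∑ u' with ∀ j ∉ ω.W k \ ω.coverSet k T, u' j = u j,
      (∏ j ∈ ω.W k \ ω.coverSet k T, (ω.block net n τ).gen.val j u')
        * (ω.block net n τ).weight k u' (y k)
      ≤ ∏ t, ω.ratio net k (ω.coverSet k T) (ω.D k) (slice u t) (y k t) := by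
  have e : ∀ u' : (∀ j, Fin n → ω.U j),
      (∏ j ∈ ω.W k \ ω.coverSet k T, (ω.block net n τ).gen.val j u')
        * (ω.block net n τ).weight k u' (y k)
      = ∏ t, (fun t v => (∏ j ∈ ω.W k \ ω.coverSet k T, (ω.gen net).val j v)
        * (ω.covProb k v (y k t) / ∏ j ∈ ω.W k, (ω.gen net).val j v)) t (slice u' t) := by
    intro u'
    simp only [OneShot.weight, block, blockGen]
    rw [Finset.prod_mul_distrib, Finset.prod_div_distrib, Finset.prod_comm,
      Finset.prod_comm (s := ω.W k)]
  have hsum := sum_prod_slice (ω.W k \ ω.coverSet k T) u fun t v =>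
    (∏ j ∈ ω.W k \ ω.coverSet k T, (ω.gen net).val j v)
      * (ω.covProb k v (y k t) / ∏ j ∈ ω.W k, (ω.gen net).val j v)
  refine (le_of_eq (Eq.trans ?_ hsum)).trans ?_
  · refine Finset.sum_congr (by congr!) fun u' _ => e u'
  refine Finset.prod_le_prod (fun t _ => Finset.sum_nonneg fun v _ => ?_) fun t _ => ?_
  · exact mul_nonneg (Finset.prod_nonneg fun _ _ => (ω.gen net).nonneg _ _)
      (div_nonneg (ω.covProb_nonneg _ _ _) (Finset.prod_nonneg fun _ _ => (ω.gen net).nonneg _ _))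
  · exact (le_of_eq (Finset.sum_congr (by congr!) fun _ _ => rfl)).trans
      (ω.sum_cover_le_ratio net k T (h t))

open Classical in
-- Passing the test bounds the generation probability of the competing words by the inverse
-- threshold times their conditional probability given U_R and Y_k. These conditional probabilities
-- sum to 1, or to 0 when the conditioning event is null.
theorem block_pack_le (n : ℕ) (τ : Fin N → Finset (Fin ω.μ) → ℝ) (hτ : ∀ k S, 0 < τ k S)
    (k : Fin N) {S : Finset (Fin ω.μ)} (hS : ω.ErrorPattern k S) (u : ∀ j, Fin n → ω.U j)
    (y : Fin n → Y k) :
    ∑ u' with ∀ j ∉ ω.packSet k S, u' j = u j,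
      (∏ j ∈ ω.packSet k S, (ω.block net n τ).gen.val j u')
        * (if (ω.block net n τ).test k u' y then 1 else 0) ≤ (τ k S)⁻¹ := by
  set P := ω.packSet k S with hP
  set R := (ω.D k ∪ ω.B k) \ P with hR
  have hPR : P ∪ R = ω.D k ∪ ω.B k := Finset.union_sdiff_of_subset (ω.packSet_subset k S)
  have hterm : ∀ u' ∈ Finset.univ.filter fun u' : (∀ j, Fin n → ω.U j) => ∀ j ∉ P, u' j = u j,
      (∏ j ∈ P, (ω.block net n τ).gen.val j u')
        * (if (ω.block net n τ).test k u' y then 1 else 0)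
      ≤ (τ k S)⁻¹ * ∏ t, (fun t v => ω.cyl net k (P ∪ R) v (y t) *
        (ω.cyl net k R (slice u t) (y t))⁻¹) t (slice u' t) := by
    intro u' hu'
    have hu' := (Finset.mem_filter.1 hu').2
    split_ifs with htest
    swap
    · rw [mul_zero]
      exact mul_nonneg (inv_nonneg.2 (hτ k S).le) (Finset.prod_nonneg fun t _ =>
        mul_nonneg (ω.cyl_nonneg net _ _ _ _) (inv_nonneg.2 (ω.cyl_nonneg net _ _ _ _)))
    have hle : τ k S ≤ ∏ t, ω.ratio net k P R (slice u' t) (y t) := htest.2 S hS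
    have hRu : ∀ t, ω.cyl net k R (slice u' t) (y t) = ω.cyl net k R (slice u t) (y t) :=
      fun t => ω.cyl_congr net k R _ fun j hj => congrFun (hu' j (Finset.mem_sdiff.1 hj).2) t
    simp only [ratio, hRu, Finset.prod_div_distrib, Finset.prod_mul_distrib] at hle
    have hG : ∏ j ∈ P, (ω.block net n τ).gen.val j u'
        = ∏ t, ∏ j ∈ P, (ω.gen net).val j (slice u' t) := by
      simp only [block, blockGen]
      exact Finset.prod_comm
    rw [mul_one, hG, Finset.prod_mul_distrib, Finset.prod_inv_distrib]
    set G := ∏ t, ∏ j ∈ P, (ω.gen net).val j (slice u' t) with hGdef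
    set E := ∏ t, ω.cyl net k R (slice u t) (y t) with hE
    set F := ∏ t, ω.cyl net k (P ∪ R) (slice u' t) (y t) with hF
    have hpos := (hτ k S).trans_le hle
    have hne : E * G ≠ 0 := by
      intro h0; rw [h0, div_zero] at hpos; exact lt_irrefl _ hpos
    have hE0 : 0 ≤ E := Finset.prod_nonneg fun t _ => ω.cyl_nonneg net _ _ _ _
    have hG0 : 0 ≤ G := Finset.prod_nonneg fun t _ => Finset.prod_nonneg fun _ _ =>
      (ω.gen net).nonneg _ _
    have hEG : 0 < E * G := (mul_nonneg hE0 hG0).lt_of_ne' hne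
    have hEpos : 0 < E := hE0.lt_of_ne' (left_ne_zero_of_mul hne)
    rw [le_div_iff₀ hEG] at hle
    rw [← div_eq_mul_inv, inv_mul_eq_div, le_div_iff₀ (hτ k S), le_div_iff₀ hEpos]
    linarith
  refine (Finset.sum_le_sum hterm).trans ?_
  have hsum := sum_prod_slice P u fun t v => ω.cyl net k (P ∪ R) v (y t) *
    (ω.cyl net k R (slice u t) (y t))⁻¹
  rw [← Finset.mul_sum]
  refine (le_of_eq (congrArg _ (Eq.trans (Finset.sum_congr (by congr!) fun _ _ => rfl)
    hsum))).trans ?_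
  refine mul_le_of_le_one_right (inv_nonneg.2 (hτ k S).le) ?_
  refine Finset.prod_le_one (fun t _ => Finset.sum_nonneg fun v _ =>
    mul_nonneg (ω.cyl_nonneg net _ _ _ _) (inv_nonneg.2 (ω.cyl_nonneg net _ _ _ _))) fun t _ => ?_
  rw [← Finset.sum_mul]
  refine (le_of_eq (congrArg (· * _) (Eq.trans (Finset.sum_congr (by congr!) fun _ _ => rfl)
    (ω.sum_cyl net k P R Finset.disjoint_sdiff (slice u t) (y t))))).trans ?_
  exact mul_inv_le_one

/-- The channel output law of deterministic node maps has total mass one. -/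
theorem sum_outputLaw [∀ k, Nonempty (Y k)] {n : ℕ} (f : ∀ k, (Fin n → Y k) → (Fin n → X k)) :
    ∑ y, net.outputLaw f y = 1 := by
  classical
  have y₀ : ∀ k, Fin n → Y k := fun _ _ => Classical.arbitrary _
  set g : Fin N → (∀ k, Fin n → Y k) → ℝ := fun k y =>
    ∏ t, net.prob k (slice y t) (fun i => f i (y i) t) with hg
  have hout : ∀ y, net.outputLaw f y = 1 * ∏ k, g k y := by
    intro y
    rw [one_mul, hg, Finset.prod_comm]
    rfl
  simp only [hout]
  rw [sum_prod_elim_pi (fun k : Fin N => (k : ℕ)) g y₀ ?_ ?_ ∅ (by simp) (fun _ => 1) (by simp)]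
  · simp only [Finset.prod_empty, mul_one, Finset.notMem_empty, not_false_eq_true, forall_const]
    rw [Finset.sum_eq_single y₀]
    · intro c hc hne
      exact absurd (funext (Finset.mem_filter.1 hc).2) hne
    · simp
  · intro k y
    have : ∀ a : Fin n → Y k, g k (Function.update y k a)
        = ∏ t, net.prob k (Function.update (slice y t) k (a t)) (fun i => f i (y i) t) := by
      intro a
      refine Finset.prod_congr rfl fun t _ => prob_congr net k (fun i _ => ?_) fun i hi => ?_
      · by_cases hik : i = k
        · subst hik; simp [slice]
        · simp [slice, hik]
      · rw [Function.update_of_ne hi.ne]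
    simp only [this]
    rw [sum_pi_prod fun t a => net.prob k (Function.update (slice y t) k a) fun i => f i (y i) t]
    exact Finset.prod_eq_one fun t _ => sum_prob_update net k _ _
  · intro k y y' h h'
    have hle : ∀ i ≤ k, y i = y' i := by
      intro i hi
      rcases eq_or_lt_of_le hi with rfl | hi
      exacts [h, h' i hi]
    refine Finset.prod_congr rfl fun t _ => prob_congr net k (fun i hi => ?_) fun i hi => ?_
    · exact congrFun (hle i hi) t
    · rw [hle i hi.le]

end CodingParams

/-! ### Simultaneous deviations and diagonal choice of codes. -/

open Classical in
/-- Simultaneous weak law of large numbers for finitely many statistics. -/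
theorem tendsto_deviations {S ι : Type*} [Fintype S] [Fintype ι] {q : S → ℝ} (hq0 : ∀ s, 0 ≤ q s)
    (hq : ∑ s, q s = 1) (f : ι → S → ℝ) {δ : ι → ℝ} (hδ : ∀ i, 0 < δ i) :
    Tendsto (fun n : ℕ => ∑ s : Fin n → S with
        ¬ ∀ i, |∑ t, f i (s t) - n * ∑ a, q a * f i a| < n * δ i, ∏ t, q (s t))
      atTop (𝓝 0) := by
  have hsum := tendsto_finsetSum Finset.univ fun i _ => tendsto_deviation hq0 hq (f i) (hδ i)
  rw [Finset.sum_const_zero] at hsum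
  have hnn : ∀ {n : ℕ} (s : Fin n → S), 0 ≤ ∏ t, q (s t) := fun s =>
    Finset.prod_nonneg fun t _ => hq0 _
  refine squeeze_zero (fun n => Finset.sum_nonneg fun s _ => hnn s) (fun n => ?_) hsum
  simp only [Finset.sum_filter]
  rw [Finset.sum_comm]
  refine Finset.sum_le_sum fun s _ => ?_
  have hterm : ∀ i, 0 ≤ if ¬|∑ t, f i (s t) - n * ∑ a, q a * f i a| < n * δ i
      then ∏ t, q (s t) else 0 := fun i => by
    split_ifs
    exacts [le_rfl, hnn s]
  split_ifs with hs
  · exact Finset.sum_nonneg fun i _ => hterm i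
  · obtain ⟨i, hi⟩ := not_forall.1 hs
    refine le_trans ?_ (Finset.single_le_sum (fun i _ => hterm i) (Finset.mem_univ i))
    rw [if_pos hi]

/-- A single sequence of codes that works for every tolerance. -/
theorem exists_diagonal {F : ℕ → Type*} (err : ∀ n, ℝ → F n → ℝ) (h0 : ∀ n ε g, 0 ≤ err n ε g)
    (hanti : ∀ n g, Antitone fun ε => err n ε g)
    (h : ∀ ε, 0 < ε → ∃ g : ∀ n, F n, Tendsto (fun n => err n ε (g n)) atTop (𝓝 0)) :
    ∃ g : ∀ n, F n, ∀ ε, 0 < ε → Tendsto (fun n => err n ε (g n)) atTop (𝓝 0) := by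
  classical
  obtain ⟨g₁, -⟩ := h 1 one_pos
  set P : ℕ → ℕ → Prop := fun n m => ∃ g : F n, err n (1 / (m + 1)) g ≤ 1 / (m + 1) with hP
  have hev : ∀ m, ∀ᶠ n in atTop, P n m := by
    intro m
    have hm : (0 : ℝ) < 1 / (m + 1) := Nat.one_div_pos_of_nat
    obtain ⟨g, hg⟩ := h _ hm
    filter_upwards [hg.eventually (ge_mem_nhds hm)] with n hn using ⟨g n, hn⟩
  -- At length n use the best precision 1/(m+1) with m ≤ n that some code attains both as tolerance
  -- and as error. Each fixed m is eventually attained, so the precision tends to 0; `g₁` only fills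
  -- the lengths where none is.
  refine ⟨fun n => if hn : P n (Nat.findGreatest (P n) n) then hn.choose else g₁ n,
    fun ε hε => tendsto_order.2 ⟨fun a ha => Eventually.of_forall fun n => ha.trans_le (h0 _ _ _),
      fun η hη => ?_⟩⟩
  obtain ⟨m, hm⟩ := exists_nat_one_div_lt (lt_min hε hη)
  filter_upwards [hev m, eventually_ge_atTop m] with n hn hmn
  have hspec : P n (Nat.findGreatest (P n) n) := Nat.findGreatest_spec hmn hn
  have hle : m ≤ Nat.findGreatest (P n) n := Nat.le_findGreatest hmn hn
  have hinv : (1 : ℝ) / ((Nat.findGreatest (P n) n : ℕ) + 1) ≤ 1 / (m + 1) := by gcongr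
  rw [dif_pos hspec]
  calc err n ε hspec.choose ≤ err n (1 / ((Nat.findGreatest (P n) n : ℕ) + 1)) hspec.choose :=
        hanti n _ (hinv.trans (hm.le.trans (min_le_left _ _)))
    _ ≤ 1 / ((Nat.findGreatest (P n) n : ℕ) + 1) := hspec.choose_spec
    _ ≤ 1 / (m + 1) := hinv
    _ < η := hm.trans_le (min_le_right _ _)

theorem prod_eq_rpow_sum_logb {T : Type*} [Fintype T] {a : T → ℝ} (ha : ∀ t, 0 < a t) :
    ∏ t, a t = (2 : ℝ) ^ ∑ t, Real.logb 2 (a t) := by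
  rw [Real.rpow_sum_of_pos two_pos]
  exact Finset.prod_congr rfl fun t _ => (Real.rpow_logb two_pos (by norm_num) (ha t)).symm

/-- A positive tolerance, equal to `g` when `g` is positive. -/
def tol (g : ℝ) : ℝ := open Classical in if 0 < g then g else 1

theorem tol_pos (g : ℝ) : 0 < tol g := by
  unfold tol; split_ifs with h
  exacts [h, one_pos]

theorem tol_of_pos {g : ℝ} (h : 0 < g) : tol g = g := if_pos h

theorem IsTypical.mono {α : Type*} {p : α → ℝ} (hp : ∀ a, 0 ≤ p a) {ε ε' : ℝ} (h : ε ≤ ε') {n : ℕ}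
    {z : Fin n → α} (hz : IsTypical p ε z) : IsTypical p ε' z := fun a =>
  (hz a).trans (mul_le_mul_of_nonneg_right h (hp a))

/-! ### Rates, thresholds and the vanishing of the loss. -/

namespace CodingParams

set_option linter.unusedSectionVars false

variable {N : ℕ} {X : Fin N → Type u} {Y : Fin N → Type v} (ω : CodingParams.{u, v, w} N X Y)
variable [∀ k, Fintype (X k)] [∀ k, Fintype (Y k)] (net : ADMN N X Y)

theorem outputLaw_nonneg {n : ℕ} (f : ∀ k, (Fin n → Y k) → (Fin n → X k))
    (y : ∀ k, Fin n → Y k) : 0 ≤ net.outputLaw f y :=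
  Finset.prod_nonneg fun _ _ => Finset.prod_nonneg fun _ _ => prob_nonneg _ _ _ _

theorem errorProb_nonneg (p : (∀ k, X k) × (∀ k, Y k) → ℝ) (ε : ℝ) {n : ℕ}
    (f : ∀ k, (Fin n → Y k) → (Fin n → X k)) : 0 ≤ net.errorProb p ε f :=
  Finset.sum_nonneg fun _ _ => outputLaw_nonneg net f _

theorem errorProb_antitone {p : (∀ k, X k) × (∀ k, Y k) → ℝ} (hp : ∀ a, 0 ≤ p a) {n : ℕ}
    (f : ∀ k, (Fin n → Y k) → (Fin n → X k)) : Antitone fun ε => net.errorProb p ε f := by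
  classical
  intro ε ε' h
  refine Finset.sum_le_sum_of_subset_of_nonneg (fun y hy => ?_) fun y _ _ =>
    outputLaw_nonneg net f y
  rw [Finset.mem_filter] at hy ⊢
  exact ⟨hy.1, fun ht => hy.2 (ht.mono hp h)⟩

theorem sum_pair_law_mul (F : (∀ j, ω.U j) × (∀ k, Y k) → ℝ) :
    ∑ s : (∀ j, ω.U j) × (∀ k, Y k), ω.law net s.1 s.2 * F s
      = ∑ u, ∑ y, ω.law net u y * F (u, y) := Fintype.sum_prod_type _

open Classical in
theorem sum_law_letter {p : (∀ k, X k) × (∀ k, Y k) → ℝ} (hp : ω.Induces net p)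
    (a : (∀ k, X k) × (∀ k, Y k)) :
    ∑ u, ∑ y, ω.law net u y * (if ((fun k => ω.symbol k u (y k)), y) = a then 1 else 0) = p a := by
  rw [← ω.sum_joint_mul net fun s => if s.2 = a then 1 else 0, Fintype.sum_prod_type, ← hp]
  refine Finset.sum_congr rfl fun u _ => ?_
  simp

theorem sum_law {p : (∀ k, X k) × (∀ k, Y k) → ℝ} (hp : ω.Induces net p) :
    ∑ u, ∑ y, ω.law net u y = ∑ a, p a := by
  have := ω.sum_joint_mul net fun _ => 1
  simp only [mul_one] at this
  rw [← this, Fintype.sum_prod_type, Finset.sum_comm]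
  exact Finset.sum_congr rfl fun a _ => hp a.1 a.2

theorem law_le {p : (∀ k, X k) × (∀ k, Y k) → ℝ} (hp : ω.Induces net p) (u : ∀ j, ω.U j)
    (y : ∀ k, Y k) : ω.law net u y ≤ p ((fun k => ω.symbol k u (y k)), y) := by
  classical
  rw [← ω.sum_law_letter net hp]
  have hnn : ∀ u' y', 0 ≤ ω.law net u' y' * (if ((fun k => ω.symbol k u' (y' k)), y')
      = ((fun k => ω.symbol k u (y k)), y) then 1 else 0) := fun u' y' =>
    mul_nonneg (ω.law_nonneg net _ _) (by split_ifs <;> norm_num)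
  refine le_trans ?_ (Finset.single_le_sum (fun u' _ => Finset.sum_nonneg fun y' _ => hnn u' y')
    (Finset.mem_univ u))
  refine le_trans ?_ (Finset.single_le_sum (fun y' _ => hnn u y') (Finset.mem_univ y))
  simp

/-- Size of the index set of rate `r i` at block length `n`. -/
def indexCard (n : ℕ) (i : Fin ω.μ) : ℕ := ⌈(2 : ℝ) ^ (n * ω.r i)⌉₊

theorem rpow_le_indexCard (n : ℕ) (i : Fin ω.μ) : (2 : ℝ) ^ (n * ω.r i) ≤ ω.indexCard n i :=
  Nat.le_ceil _

theorem indexCard_pos (n : ℕ) (i : Fin ω.μ) : 0 < ω.indexCard n i :=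
  Nat.ceil_pos.2 (Real.rpow_pos_of_pos two_pos _)

/-- Rates are nonnegative, so the power is at least 1 and rounding up at most doubles it. -/
theorem indexCard_le (n : ℕ) (i : Fin ω.μ) :
    (ω.indexCard n i : ℝ) ≤ 2 * (2 : ℝ) ^ (n * ω.r i) := by
  have h1 : (1 : ℝ) ≤ (2 : ℝ) ^ (n * ω.r i) :=
    Real.one_le_rpow one_le_two (mul_nonneg n.cast_nonneg (ω.r_nonneg i))
  have := Nat.ceil_lt_add_one (zero_le_one.trans h1)
  rw [indexCard]; linarith

/-- Decoding threshold. -/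
def packThreshold (n : ℕ) (k : Fin N) (S : Finset (Fin ω.μ)) : ℝ :=
  -- The exponent is midway between information and rate sum: half the gap absorbs empirical
  -- deviations, the other half beats the number of competitors.
  (2 : ℝ) ^ (n * ((ω.packInfo net k S + ∑ i ∈ S, ω.r i) / 2))

/-- Bound on the likelihood ratios of the encoder. -/
def coverThreshold (n : ℕ) (k : Fin N) (T : Finset (Fin ω.μ)) : ℝ :=
  -- With no index in `T` there is no rate gap to absorb deviations, so the bound must be exactly 1.
  if T = ∅ then 1 else (2 : ℝ) ^ (n * ((ω.coverInfo net k T + ∑ i ∈ T, ω.r i) / 2))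

theorem packThreshold_pos (n : ℕ) (k : Fin N) (S : Finset (Fin ω.μ)) :
    0 < ω.packThreshold net n k S := Real.rpow_pos_of_pos two_pos _

theorem coverThreshold_nonneg (n : ℕ) (k : Fin N) (T : Finset (Fin ω.μ)) :
    0 ≤ ω.coverThreshold net n k T := by
  unfold coverThreshold
  split_ifs
  exacts [zero_le_one, (Real.rpow_pos_of_pos two_pos _).le]

theorem rpow_mul_sum (n : ℕ) (T : Finset (Fin ω.μ)) :
    (2 : ℝ) ^ (n * ∑ i ∈ T, ω.r i) = ∏ i ∈ T, (2 : ℝ) ^ (n * ω.r i) := by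
  rw [Finset.mul_sum, Real.rpow_sum_of_pos two_pos]

theorem tendsto_two_rpow_neg {g : ℝ} (hg : 0 < g) :
    Tendsto (fun n : ℕ => (2 : ℝ) ^ (-(n * g))) atTop (𝓝 0) := by
  have h := tendsto_pow_atTop_nhds_zero_of_lt_one (r := (2 : ℝ) ^ (-g))
    (Real.rpow_pos_of_pos two_pos _).le (Real.rpow_lt_one_of_one_lt_of_neg one_lt_two (neg_lt_zero.2 hg))
  refine h.congr fun n => ?_
  rw [← Real.rpow_natCast, ← Real.rpow_mul two_pos.le]
  congr 1; ring

/-- Nonempty sets decay exponentially at half the rate gap; the limit 1 of the empty set is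
cancelled by the 1 subtracted in the loss. -/
theorem tendsto_cover_term {k : Fin N} {T : Finset (Fin ω.μ)}
    (h : T.Nonempty → ω.coverInfo net k T < ∑ i ∈ T, ω.r i) :
    Tendsto (fun n => ω.coverThreshold net n k T * (∏ i ∈ T, (ω.indexCard n i : ℝ))⁻¹) atTop
      (𝓝 (if T = ∅ then 1 else 0)) := by
  split_ifs with hT
  · subst hT
    simp [coverThreshold]
  have hlt := h (Finset.nonempty_iff_ne_empty.2 hT)
  refine squeeze_zero (fun n => mul_nonneg (ω.coverThreshold_nonneg net n k T)
    (inv_nonneg.2 (Finset.prod_nonneg fun _ _ => Nat.cast_nonneg _))) (fun n => ?_)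
    (tendsto_two_rpow_neg (g := (∑ i ∈ T, ω.r i - ω.coverInfo net k T) / 2) (by linarith))
  have hprod : (2 : ℝ) ^ (n * ∑ i ∈ T, ω.r i) ≤ ∏ i ∈ T, (ω.indexCard n i : ℝ) := by
    rw [rpow_mul_sum]
    exact Finset.prod_le_prod (fun _ _ => (Real.rpow_pos_of_pos two_pos _).le)
      fun i _ => ω.rpow_le_indexCard n i
  have hpos : (0 : ℝ) < 2 ^ (n * ∑ i ∈ T, ω.r i) := Real.rpow_pos_of_pos two_pos _
  rw [coverThreshold, if_neg hT]
  refine (mul_le_mul_of_nonneg_left (inv_anti₀ hpos hprod)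
    (Real.rpow_pos_of_pos two_pos _).le).trans (le_of_eq ?_)
  rw [← Real.rpow_neg two_pos.le, ← Real.rpow_add two_pos]
  congr 1; ring

theorem tendsto_pack_term {k : Fin N} {S : Finset (Fin ω.μ)}
    (h : ∑ i ∈ S, ω.r i < ω.packInfo net k S) :
    Tendsto (fun n => (ω.packThreshold net n k S)⁻¹ * ∏ i ∈ S, (ω.indexCard n i : ℝ)) atTop
      (𝓝 0) := by
  -- The constant `2 ^ S.card` pays for rounding the index set sizes up.
  have hlim := (tendsto_two_rpow_neg (g := (ω.packInfo net k S - ∑ i ∈ S, ω.r i) / 2)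
    (by linarith)).const_mul ((2 : ℝ) ^ S.card)
  rw [mul_zero] at hlim
  refine squeeze_zero (fun n => mul_nonneg (inv_nonneg.2 (ω.packThreshold_pos net n k S).le)
    (Finset.prod_nonneg fun _ _ => Nat.cast_nonneg _)) (fun n => ?_) hlim
  have hprod : ∏ i ∈ S, (ω.indexCard n i : ℝ) ≤ 2 ^ S.card * (2 : ℝ) ^ (n * ∑ i ∈ S, ω.r i) := by
    rw [rpow_mul_sum, ← Finset.prod_const, ← Finset.prod_mul_distrib]
    exact Finset.prod_le_prod (fun _ _ => Nat.cast_nonneg _) fun i _ => ω.indexCard_le n i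
  refine (mul_le_mul_of_nonneg_left hprod
    (inv_nonneg.2 (ω.packThreshold_pos net n k S).le)).trans (le_of_eq ?_)
  rw [packThreshold, ← Real.rpow_neg two_pos.le, mul_left_comm, ← Real.rpow_add two_pos]
  congr 2; ring

/-- The loss at block length `n`. -/
def blockLoss (n : ℕ) : ℝ :=
  OneShot.loss ω (fun i => (Fintype.card (Fin (ω.indexCard n i)) : ℝ)) (ω.coverThreshold net n)
    fun k S => (ω.packThreshold net n k S)⁻¹

theorem tendsto_blockLoss
    (hpack : ∀ k, ∀ S ⊆ ω.barD k ∪ ω.barB k, (S ∩ ω.barD k).Nonempty →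
      ∑ i ∈ S, ω.r i < ω.packInfo net k S)
    (hcover : ∀ k, ∀ T ⊆ ω.barW k, T.Nonempty → ω.coverInfo net k T < ∑ i ∈ T, ω.r i) :
    Tendsto (ω.blockLoss net) atTop (𝓝 0) := by
  have h1 : ∀ k, Tendsto (fun n => ∑ T ∈ (ω.barW k).powerset,
      ω.coverThreshold net n k T * (∏ i ∈ T, (ω.indexCard n i : ℝ))⁻¹ - 1) atTop (𝓝 0) := by
    intro k
    have := (tendsto_finsetSum (ω.barW k).powerset fun T hT =>
      ω.tendsto_cover_term net (k := k) (hcover k T (Finset.mem_powerset.1 hT))).sub_const 1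
    simpa using this
  have h2 : ∀ k, Tendsto (fun n => ∑ S ∈ (ω.barD k ∪ ω.barB k).powerset with
      (S ∩ ω.barD k).Nonempty,
      (ω.packThreshold net n k S)⁻¹ * ∏ i ∈ S, (ω.indexCard n i : ℝ)) atTop (𝓝 0) := by
    intro k
    have := tendsto_finsetSum ((ω.barD k ∪ ω.barB k).powerset.filter fun S =>
      (S ∩ ω.barD k).Nonempty) fun S hS => ω.tendsto_pack_term net (k := k)
        (hpack k S (Finset.mem_powerset.1 (Finset.mem_filter.1 hS).1) (Finset.mem_filter.1 hS).2)
    simpa using this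
  have h3 := (tendsto_finsetSum Finset.univ fun k _ => h1 k).add
    ((tendsto_finsetSum Finset.univ fun k _ => h2 k).const_mul (1 + (N : ℝ)))
  simp only [Finset.sum_const_zero, mul_zero, add_zero] at h3
  refine h3.congr fun n => ?_
  simp only [blockLoss, OneShot.loss, Fintype.card_fin]

end CodingParams

/-! ### Concentration of the single-letter statistics and existence of good codes. -/

namespace CodingParams

set_option linter.unusedSectionVars false

variable {N : ℕ} {X : Fin N → Type u} {Y : Fin N → Type v} (ω : CodingParams.{u, v, w} N X Y)
variable [∀ k, Fintype (X k)] [∀ k, Fintype (Y k)] (net : ADMN N X Y)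

/-- Index set of the single-letter statistics: decoding patterns, encoding patterns, letters. -/
abbrev StatIndex : Type (max u v) :=
  (Fin N × Finset (Fin ω.μ)) ⊕ (Fin N × Finset (Fin ω.μ)) ⊕ ((∀ k, X k) × (∀ k, Y k))

open Classical in
/-- Log-likelihood ratios of the decoders and encoders, and letter indicators. -/
def stat : ω.StatIndex → (∀ j, ω.U j) × (∀ k, Y k) → ℝ
  | .inl (k, S), s => Real.logb 2
      (ω.ratio net k (ω.packSet k S) ((ω.D k ∪ ω.B k) \ ω.packSet k S) s.1 (s.2 k))
  | .inr (.inl (k, T)), s => Real.logb 2 (ω.ratio net k (ω.coverSet k T) (ω.D k) s.1 (s.2 k))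
  | .inr (.inr a), s => if ((fun k => ω.symbol k s.1 (s.2 k)), s.2) = a then 1 else 0

/-- Tolerances for the statistics. -/
def statTol (p : (∀ k, X k) × (∀ k, Y k) → ℝ) (ε : ℝ) : ω.StatIndex → ℝ
  -- Half the gap carries the mean exactly to the threshold exponent. For sets not constrained by
  -- the hypotheses the gap may be nonpositive; `tol` keeps the tolerance positive so that one law
  -- of large numbers covers all indices.
  | .inl (k, S) => tol ((ω.packInfo net k S - ∑ i ∈ S, ω.r i) / 2)
  | .inr (.inl (k, T)) => tol ((∑ i ∈ T, ω.r i - ω.coverInfo net k T) / 2)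
  | .inr (.inr a) => tol (ε * p a)

theorem statTol_pos (p : (∀ k, X k) × (∀ k, Y k) → ℝ) (ε : ℝ) (i : ω.StatIndex) :
    0 < ω.statTol net p ε i := by
  rcases i with ⟨k, S⟩ | ⟨k, T⟩ | a <;> exact tol_pos _

/-- All empirical statistics are within tolerance of their means. -/
def Concentrated (p : (∀ k, X k) × (∀ k, Y k) → ℝ) (ε : ℝ) {n : ℕ}
    (s : Fin n → (∀ j, ω.U j) × (∀ k, Y k)) : Prop :=
  ∀ i, |∑ t, ω.stat net i (s t) - n * ∑ a : (∀ j, ω.U j) × (∀ k, Y k),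
    ω.law net a.1 a.2 * ω.stat net i a| < n * ω.statTol net p ε i

variable {ω net}

theorem Concentrated.isTypical {p : (∀ k, X k) × (∀ k, Y k) → ℝ} (hp : ω.Induces net p)
    (hp0 : ∀ a, 0 ≤ p a) {ε : ℝ} (hε : 0 < ε) {n : ℕ} {s : Fin n → (∀ j, ω.U j) × (∀ k, Y k)}
    (hs : ω.Concentrated net p ε s) (hlaw : ∀ t, ω.law net (s t).1 (s t).2 ≠ 0) :
    IsTypical p ε fun t => ((fun k => ω.symbol k (s t).1 ((s t).2 k)), (s t).2) := by
  classical
  intro a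
  -- A letter of target probability zero must not occur at all. Concentration cannot give this; it
  -- follows because every position has positive law, which `law_le` bounds by the target.
  rcases (hp0 a).eq_or_lt with ha | ha
  · have : IsEmpty {t : Fin n // ((fun k => ω.symbol k (s t).1 ((s t).2 k)), (s t).2) = a} := by
      refine ⟨fun t => hlaw t.1 (le_antisymm ?_ (ω.law_nonneg net _ _))⟩
      have := ω.law_le net hp (s t.1).1 (s t.1).2
      rwa [t.2, ← ha] at this
    simp [← ha]
  have h := hs (.inr (.inr a))
  -- The strict inequality in `Concentrated` fails for empty blocks.
  have hn : (0 : ℝ) < n := by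
    by_contra hn
    exact absurd h (not_lt.2 ((mul_nonpos_of_nonpos_of_nonneg (not_lt.1 hn)
      (ω.statTol_pos net p ε _).le).trans (abs_nonneg _)))
  have hmean : ∑ b : (∀ j, ω.U j) × (∀ k, Y k), ω.law net b.1 b.2 * ω.stat net (.inr (.inr a)) b
      = p a := by
    rw [ω.sum_pair_law_mul]
    exact ω.sum_law_letter net hp a
  have hcount : ∑ t, ω.stat net (.inr (.inr a)) (s t) = (Nat.card {t : Fin n //
      ((fun k => ω.symbol k (s t).1 ((s t).2 k)), (s t).2) = a} : ℝ) := by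
    simp only [stat]
    rw [Finset.sum_boole, Nat.card_eq_fintype_card, Fintype.card_subtype]
  rw [hmean, hcount] at h
  simp only [statTol, tol_of_pos (mul_pos hε ha)] at h
  rw [div_sub' hn.ne', abs_div, abs_of_pos hn, div_le_iff₀ hn]
  linarith

theorem Concentrated.packThreshold_le {p : (∀ k, X k) × (∀ k, Y k) → ℝ} {ε : ℝ} {n : ℕ}
    {s : Fin n → (∀ j, ω.U j) × (∀ k, Y k)} (hs : ω.Concentrated net p ε s)
    (hlaw : ∀ t, ω.law net (s t).1 (s t).2 ≠ 0) {k : Fin N} {S : Finset (Fin ω.μ)}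
    (hS : ∑ i ∈ S, ω.r i < ω.packInfo net k S) :
    ω.packThreshold net n k S ≤ ∏ t, ω.ratio net k (ω.packSet k S)
      ((ω.D k ∪ ω.B k) \ ω.packSet k S) (s t).1 ((s t).2 k) := by
  have h := hs (.inl (k, S))
  have hmean := (ω.sum_pair_law_mul net (ω.stat net (.inl (k, S)))).trans
    (ω.packInfo_eq net k S).symm
  rw [hmean] at h
  simp only [statTol] at h
  rw [tol_of_pos (by linarith)] at h
  rw [prod_eq_rpow_sum_logb fun t => ω.ratio_pos net k _ _ (hlaw t), packThreshold]
  refine Real.rpow_le_rpow_of_exponent_le one_le_two ?_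
  have h' := (abs_lt.1 h).1
  simp only [stat] at h'
  linarith

theorem Concentrated.ratio_le_coverThreshold {p : (∀ k, X k) × (∀ k, Y k) → ℝ} {ε : ℝ} {n : ℕ}
    (hsum : ∑ u, ∑ y, ω.law net u y = 1)
    {s : Fin n → (∀ j, ω.U j) × (∀ k, Y k)} (hs : ω.Concentrated net p ε s)
    (hlaw : ∀ t, ω.law net (s t).1 (s t).2 ≠ 0) {k : Fin N} {T : Finset (Fin ω.μ)}
    (hT : T.Nonempty → ω.coverInfo net k T < ∑ i ∈ T, ω.r i) (h0 : ω.coverInfo net k ∅ = 0) :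
    ∏ t, ω.ratio net k (ω.coverSet k T) (ω.D k) (s t).1 ((s t).2 k)
      ≤ ω.coverThreshold net n k T := by
  rw [coverThreshold]
  split_ifs with hT0
  · subst hT0
    -- For the empty set concentration is too weak; the vanishing information makes each letter's
    -- ratio equal to 1.
    refine le_of_eq (Finset.prod_eq_one fun t _ => ?_)
    refine ω.ratio_eq_one net k _ _ (Finset.disjoint_of_subset_left (ω.coverSet_subset k ∅)
      (ω.disjoint_D_W le_rfl).symm) (fun j hj => (ω.A_subset_of_mem_coverSet hj).trans
      (Finset.union_subset_union_left (Finset.filter_subset _ _))) hsum ?_ (hlaw t)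
    rw [← ω.coverInfo_eq, h0]
  have hT := hT (Finset.nonempty_iff_ne_empty.2 hT0)
  have h := hs (.inr (.inl (k, T)))
  have hmean := (ω.sum_pair_law_mul net (ω.stat net (.inr (.inl (k, T))))).trans
    (ω.coverInfo_eq net k T).symm
  rw [hmean] at h
  simp only [statTol] at h
  rw [tol_of_pos (by linarith)] at h
  rw [prod_eq_rpow_sum_logb fun t => ω.ratio_pos net k _ _ (hlaw t)]
  refine Real.rpow_le_rpow_of_exponent_le one_le_two ?_
  have h' := (abs_lt.1 h).2
  simp only [stat] at h'
  linarith

/-- Transposition between tuples of sequences and sequences of tuples. -/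
def sliceEquiv (ω : CodingParams.{u, v, w} N X Y) (n : ℕ) :
    (∀ k, Fin n → Y k) × (∀ j, Fin n → ω.U j) ≃ (Fin n → (∀ j, ω.U j) × (∀ k, Y k)) where
  toFun p t := (slice p.2 t, slice p.1 t)
  invFun s := (fun k t => (s t).2 k, fun j t => (s t).1 j)
  left_inv _ := rfl
  right_inv _ := rfl

variable (ω net)

theorem errorProb_eq [∀ k, Nonempty (Y k)] (p : (∀ k, X k) × (∀ k, Y k) → ℝ) (ε : ℝ) {n : ℕ}
    (f : ∀ k, (Fin n → Y k) → (Fin n → X k)) :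
    net.errorProb p ε f = 1 - open Classical in ∑ y, net.outputLaw f y *
      if IsTypical p ε (fun t : Fin n => ((fun k => f k (y k) t), (fun k => y k t)))
        then 1 else 0 := by
  classical
  refine eq_sub_of_add_eq ((?_ : _ = _).trans (sum_outputLaw net f))
  rw [ADMN.errorProb, Finset.sum_filter, ← Finset.sum_add_distrib]
  refine Finset.sum_congr rfl fun y _ => ?_
  by_cases h : IsTypical p ε (fun t : Fin n => ((fun k => f k (y k) t), (fun k => y k t)))
  · rw [if_neg (not_not.2 h), if_pos h]; ring
  · rw [if_pos h, if_neg h]; ring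

open Classical in
-- The one-shot bound is applied to the event `A` of concentrated sequences of positive law, on
-- which typicality, the decoding tests and the covering bounds all hold deterministically.
theorem exists_codes {p : (∀ k, X k) × (∀ k, Y k) → ℝ} (hp : ω.Induces net p)
    (hp0 : ∀ a, 0 ≤ p a) (hp1 : ∑ a, p a = 1)
    (hpack : ∀ k, ∀ S ⊆ ω.barD k ∪ ω.barB k, (S ∩ ω.barD k).Nonempty →
      ∑ i ∈ S, ω.r i < ω.packInfo net k S)
    (hcover : ∀ k, ∀ T ⊆ ω.barW k, T.Nonempty → ω.coverInfo net k T < ∑ i ∈ T, ω.r i)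
    (hzero : ∀ k, ω.coverInfo net k ∅ = 0) {ε : ℝ} (hε : 0 < ε) (n : ℕ) :
    ∃ f : ∀ k, (Fin n → Y k) → (Fin n → X k), net.errorProb p ε f
      ≤ |ω.blockLoss net n| + ∑ s : Fin n → (∀ j, ω.U j) × (∀ k, Y k) with
        ¬ ω.Concentrated net p ε s, ∏ t, ω.law net (s t).1 (s t).2 := by
  have hsum : ∑ u, ∑ y, ω.law net u y = 1 := (ω.sum_law net hp).trans hp1
  have hsum' : ∑ s : (∀ j, ω.U j) × (∀ k, Y k), ω.law net s.1 s.2 = 1 := by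
    rw [← hsum]; exact Fintype.sum_prod_type _
  obtain ⟨⟨u₀, y₀⟩, -, -⟩ := Finset.exists_ne_zero_of_sum_ne_zero (hsum'.trans_ne one_ne_zero)
  have : ∀ j, Nonempty (ω.U j) := fun j => ⟨u₀ j⟩
  have : ∀ k, Nonempty (Y k) := fun k => ⟨y₀ k⟩
  have : ∀ i, Nonempty (Fin (ω.indexCard n i)) := fun i => ⟨⟨0, ω.indexCard_pos n i⟩⟩
  set τ := ω.packThreshold net n with hτ
  set A : (∀ j, Fin n → ω.U j) → (∀ k, Fin n → Y k) → Prop := fun u y =>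
    (∀ t, ω.law net (slice u t) (slice y t) ≠ 0) ∧
      ω.Concentrated net p ε fun t => (slice u t, slice y t) with hA
  obtain ⟨f, hf⟩ := (ω.block net n τ).exists_maps (I := fun i => Fin (ω.indexCard n i))
    (fun x y => IsTypical p ε fun t : Fin n => ((fun k => x k t), (fun k => y k t))) A
    (fun u y h => h.2.isTypical hp hp0 hε h.1)
    (fun u y h k => ⟨Finset.prod_pos fun t _ => ω.cyl_pos net k _ (h.1 t), fun S hS =>
      h.2.packThreshold_le h.1 (hpack k S hS.1 hS.2)⟩)
    (ω.coverThreshold net n) (fun k S => (τ k S)⁻¹) (ω.coverThreshold_nonneg net n)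
    (fun k S => inv_nonneg.2 (ω.packThreshold_pos net n k S).le)
    (fun u y h k T hT => (le_of_eq (by congr!)).trans ((ω.block_cover_le net n τ k T h.1).trans
      (h.2.ratio_le_coverThreshold hsum h.1 (hcover k T hT) (hzero k))))
    (fun k u y S hS hne => (le_of_eq (by congr!)).trans
      (ω.block_pack_le net n τ (ω.packThreshold_pos net n) k ⟨hS, hne⟩ u y))
  refine ⟨f, ?_⟩
  set bad := ∑ s : Fin n → (∀ j, ω.U j) × (∀ k, Y k) with ¬ ω.Concentrated net p ε s,
    ∏ t, ω.law net (s t).1 (s t).2 with hbad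
  have hbad0 : 0 ≤ bad := Finset.sum_nonneg fun s _ => Finset.prod_nonneg fun t _ =>
    ω.law_nonneg net _ _
  have hmass : ∑ y, ∑ u, (if A u y then (ω.block net n τ).law u y else 0) = 1 - bad := by
    rw [← Fintype.sum_prod_type' (f := fun y u => if A u y then (ω.block net n τ).law u y else 0),
      ← sum_prod_eq_one hsum' n, hbad, Finset.sum_filter, ← Finset.sum_sub_distrib]
    refine Fintype.sum_equiv (ω.sliceEquiv n) _ _ fun q => ?_
    rw [block_law]
    by_cases h : ω.Concentrated net p ε (ω.sliceEquiv n q)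
    · rw [if_neg (not_not.2 h), sub_zero]
      split_ifs with hA'
      · rfl
      -- Concentrated sequences excluded from `A` contain a letter of law zero and carry no mass.
      · obtain ⟨t, ht⟩ := not_forall.1 fun h' => hA' ⟨h', h⟩
        exact (Finset.prod_eq_zero (Finset.mem_univ t) (not_not.1 ht)).symm
    · rw [if_pos h, if_neg fun hA' => h hA'.2, sub_self]
  have hbad1 : bad ≤ 1 := by
    have : 0 ≤ 1 - bad := by
      rw [← hmass]
      refine Finset.sum_nonneg fun y _ => Finset.sum_nonneg fun u _ => ?_
      split_ifs
      · rw [block_law]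
        exact Finset.prod_nonneg fun t _ => ω.law_nonneg net _ _
      · exact le_rfl
    linarith
  have hsucc : ∑ y, (∏ k, (ω.block net n τ).ch k y fun i => f i (y i)) *
      (if IsTypical p ε (fun t : Fin n => ((fun k => f k (y k) t), (fun k => y k t)))
        then 1 else 0) = 1 - net.errorProb p ε f := by
    rw [errorProb_eq, sub_sub_cancel]
    refine Finset.sum_congr rfl fun y _ => ?_
    refine congrArg (· * _) ?_
    change ∏ k, ∏ t, net.prob k (slice y t) (slice (fun i => f i (y i)) t) = net.outputLaw f y
    rw [Finset.prod_comm]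
    rfl
  have hf' : (1 - ω.blockLoss net n) * (1 - bad) ≤ 1 - net.errorProb p ε f := by
    rw [← hsucc, ← hmass]
    exact (le_of_eq (by congr!)).trans hf
  have := le_abs_self (ω.blockLoss net n)
  have h2 := abs_nonneg (ω.blockLoss net n)
  -- The previous bound reads error ≤ loss * (1 - bad) + bad, and 0 ≤ 1 - bad ≤ 1.
  nlinarith

theorem tendsto_not_concentrated {p : (∀ k, X k) × (∀ k, Y k) → ℝ} (hp : ω.Induces net p)
    (hp1 : ∑ a, p a = 1) (ε : ℝ) :
    open Classical in
    Tendsto (fun n : ℕ => ∑ s : Fin n → (∀ j, ω.U j) × (∀ k, Y k) with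
        ¬ ω.Concentrated net p ε s, ∏ t, ω.law net (s t).1 (s t).2) atTop (𝓝 0) := by
  classical
  have hsum' : ∑ s : (∀ j, ω.U j) × (∀ k, Y k), ω.law net s.1 s.2 = 1 := by
    rw [← hp1, ← ω.sum_law net hp]; exact Fintype.sum_prod_type _
  have := tendsto_deviations (fun s : (∀ j, ω.U j) × (∀ k, Y k) => ω.law_nonneg net s.1 s.2) hsum'
    (ω.stat net) (ω.statTol_pos net p ε)
  refine this.congr fun n => Finset.sum_congr ?_ fun _ _ => rfl
  ext s
  simp [Concentrated]

end CodingParams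

end UnifiedCoding

end

theorem theorem1 {N : ℕ} {X : Fin N → Type u} {Y : Fin N → Type v}
    [∀ k, Fintype (X k)] [∀ k, Fintype (Y k)]
    (net : UnifiedCoding.ADMN N X Y)
    (pstar : stdSimplex ℝ ((∀ k, X k) × (∀ k, Y k)))
    (h : ∃ ω : UnifiedCoding.CodingParams.{u, v, w} N X Y,
      ω.Induces net pstar ∧
      ∀ k : Fin N,
        -- packing (decoding) inequalities
        (∀ S : Finset (Fin ω.μ), S ⊆ ω.barD k ∪ ω.barB k → (S ∩ ω.barD k).Nonempty →
          ∑ i ∈ S, ω.r i < ω.packInfo net k S) ∧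
        -- covering (compression) inequalities
        (∀ T : Finset (Fin ω.μ), T ⊆ ω.barW k → T.Nonempty →
          ω.coverInfo net k T < ∑ i ∈ T, ω.r i) ∧
        -- codewords of `W_k` without any index outside `Γ_{D_k}` need no compression
        ω.coverInfo net k ∅ = 0) :
    net.Achievable pstar := by
  classical
  obtain ⟨ω, hp, hk⟩ := h
  -- The codes built below depend on the tolerance through the concentration event, whereas
  -- achievability asks for one sequence serving all tolerances.
  refine UnifiedCoding.exists_diagonal
    (F := fun n => ∀ k, (Fin n → Y k) → (Fin n → X k))
    (fun n ε f => net.errorProb pstar ε f)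
    (fun n ε f => UnifiedCoding.CodingParams.errorProb_nonneg net _ ε f)
    (fun n f => UnifiedCoding.CodingParams.errorProb_antitone net pstar.2.1 f) fun ε hε => ?_
  choose f hf using fun n => ω.exists_codes net hp pstar.2.1 pstar.2.2 (fun k => (hk k).1)
    (fun k => (hk k).2.1) (fun k => (hk k).2.2) hε n
  refine ⟨f, squeeze_zero
    (fun n => UnifiedCoding.CodingParams.errorProb_nonneg net _ ε (f n)) hf ?_⟩
  have hloss := (ω.tendsto_blockLoss net (fun k => (hk k).1) (fun k => (hk k).2.1)).abs
  have := hloss.add (ω.tendsto_not_concentrated net hp pstar.2.2 ε)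
  simpa using this
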